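/- **Setting.** Let $N\ge 1$ be an integer, $h=\pi/N$, $\mathbb T_h=h\mathbb Z/2\pi\mathbb Z$ (a group of $2N$ points), with frequencies $k\in(\mathbb T_h)^*=\{-N,\dots,N-1\}$ and Fourier transform $\widehat{f}(k)=\frac{h}{\sqrt{2\pi}}\sum_{x\in\mathbb T_h}f(x)e^{-ixk}$ for $f:\mathbb T_h\to\mathbb C$. Write $\langle a\rangle=(1+a^2)^{1/2}$ and $$\|f\|_{H^s(\mathbb T_h)}^2=\sum_{k}\langle k\rangle^{2s}|\widehat f(k)|^2,\qquad \|(f,g)\|_{\mathbb H^s(\mathbb T_h)}^2=\|f\|_{H^s(\mathbb T_h)}^2+\|g\|_{H^s(\mathbb T_h)}^2 .$$ Let $\nabla_h$ and $\partial_h$ be the Fourier multipliers on $\mathbb T_h$ with symbols $\frac{2i}{h}\sin(\frac{hk}{2})$ and $ik$, $k\in\{-N,\dots,N-1\}$, and let $S_h^\pm(t)=e^{\mp\frac{t}{h^2}(\nabla_h-\partial_h)}$. Given $u_{h,0}^\pm$, the *coupled FPU system* for $(u_h^+,u_h^-)$ is $$u_h^\pm(t)=S_h^\pm(t)u_{h,0}^\pm\mp\frac14\int_0^tS_h^\pm(t-t')\nabla_h\Big(u_h^\pm(t')+e^{\pm\frac{2t'}{h^2}\partial_h}u_h^\mp(t')\Big)^2dt',$$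 and the *decoupled FPU system* for $(v_h^+,v_h^-)$ is $$v_h^\pm(t)=S_h^\pm(t)u_{h,0}^\pm\mp\frac14\int_0^tS_h^\pm(t-t')\nabla_h\big(v_h^\pm(t')\big)^2dt'.$$ Let $s_h(k)=\frac1{h^2}\big(k-\frac2h\sin(\frac{hk}2)\big)$ and let $\widetilde u(\tau,k)=\frac{h}{2\pi}\sum_{x\in\mathbb T_h}\int_{\mathbb R}e^{-it\tau}e^{-ixk}u(t,x)\,dt$ be the space-time Fourier transform. The space $Y^s_{h,\pm}$ is the completion of the Schwartz functions (Schwartz in $t$ for each $x \in \mathbb T_h$) in the norm $$\|u\|_{Y^s_{h,\pm}}=\Big(\sum_k\int_{\mathbb R}\langle k\rangle^{2s}\langle\tau\mp s_h(k)\rangle|\widetilde u(\tau,k)|^2d\tau\Big)^{1/2}+\Big(\sum_k\Big(\int_{\mathbb R}\langle k\rangle^{s}|\widetilde u(\tau,k)|\,d\tau\Big)^2\Big)^{1/2},$$ and for $T\in(0,1]$, $\|u\|_{Y^{s,T}_{h,\pm}}$ is the infimum of $\|g\|_{Y^s_{h,\pm}}$ over all $g\in Y^s_{h,\pm}$ that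 agree with $u$ on $[-T,T]\times\mathbb T_h$. **Proposition (uniform bounds for coupled and decoupled FPU).** Let $s\ge0$. There are a constant $C>0$ and a nonincreasing function $R\mapsto T(R)\in(0,1]$, both depending only on $s$, such that the following holds for every $h=\pi/N\in(0,1]$ and all complex-valued (in particular, all real-valued) data $u_{h,0}^\pm:\mathbb T_h\to\mathbb C$ with $h\sum_{x\in\mathbb T_h}u_{h,0}^\pm(x)=0$. Put $R=\|(u_{h,0}^+,u_{h,0}^-)\|_{\mathbb H^s(\mathbb T_h)}$ and $T=T(R)$. Then the coupled FPU system has a unique complex-valued solution $(u_h^+,u_h^-)\in C([-T,T]:\mathbb H^s(\mathbb T_h))$, the decoupled FPU system has a unique complex-valued solution $(v_h^+,v_h^-)\in C([-T,T]:\mathbb H^s(\mathbb T_h))$, all four functions $u_h^\pm(t),v_h^\pm(t)$ have mean zero for every $t\in[-T,T]$, and $$\|u_h^\pm\|_{Y^{s,T}_{h,\pm}}\le C\,\|(u_{h,0}^+,u_{h,0}^-)\|_{\mathbb H^s(\mathbb T_h)},\qquad \|v_h^\pm\|_{Y^{s,T}_{h,\pm}}\le C\,\|(u_{h,0}^+,u_{h,0}^-)\|_{\mathbb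 H^s(\mathbb T_h)} .$$ -/

import Mathlib

open MeasureTheory Set
open scoped ENNReal

noncomputable section

namespace PeriodicFPU

/-- The mesh size `h = π / N` of the periodic lattice with `2N` points. -/
def mesh (N : ℕ) : ℝ := Real.pi / N

/-- The periodic lattice `𝕋_h = hℤ / 2πℤ`, `h = π / N`: the index `n` stands for the point
`x = h n`. -/
abbrev PeriodicLattice (N : ℕ) : Type := ZMod (2 * N)

/-- The representatives `-N, …, N - 1` of the dual group `(𝕋_h)^* = ℤ / 2Nℤ`. -/
def freqs (N : ℕ) : Finset ℤ := Finset.Ico (-(N : ℤ)) (N : ℤ)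

/-- The Japanese bracket `⟨a⟩ = (1 + a²)^{1/2}`. -/
def bracket (a : ℝ) : ℝ := Real.sqrt (1 + a ^ 2)

section Lattice

variable (N : ℕ)

/-- The character `e^{ixk}` at the lattice point `x = h n`
(it depends only on `n` modulo `2N`, because `2 N h = 2π`). -/
def character (k : ℤ) (n : PeriodicLattice N) : ℂ :=
  Complex.exp (Complex.I * ((mesh N * (n.val : ℝ) * (k : ℝ) : ℝ) : ℂ))

/-- The inverse Fourier transform `f(x) = (2π)^{-1/2} ∑_{k = -N}^{N-1} F(k) e^{ixk}`. -/
def latticeFourierInv (F : ℤ → ℂ) (n : PeriodicLattice N) : ℂ :=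
  ((1 / Real.sqrt (2 * Real.pi) : ℝ) : ℂ) * ∑ k ∈ freqs N, F k * character N k n

variable [NeZero N]

/-- The Fourier transform `F(k) = h (2π)^{-1/2} ∑_x f(x) e^{-ixk}`. -/
def latticeFourier (f : PeriodicLattice N → ℂ) (k : ℤ) : ℂ :=
  ((mesh N / Real.sqrt (2 * Real.pi) : ℝ) : ℂ) * ∑ n : PeriodicLattice N, f n * character N (-k) n

/-- The Fourier multiplier with symbol `m` on `{-N, …, N-1}`. -/
def multiplier (m : ℤ → ℂ) (f : PeriodicLattice N → ℂ) : PeriodicLattice N → ℂ :=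
  latticeFourierInv N (fun k => m k * latticeFourier N f k)

/-- The symbol `(2i/h) sin(hk/2)` of `∇_h`. -/
def gradSymbol (k : ℤ) : ℂ :=
  Complex.I * ((2 / mesh N * Real.sin (mesh N * (k : ℝ) / 2) : ℝ) : ℂ)

/-- The symbol `ik` of `∂_h`. -/
def derivSymbol (k : ℤ) : ℂ := Complex.I * (k : ℂ)

/-- The operator `∇_h`. -/
def grad (f : PeriodicLattice N → ℂ) : PeriodicLattice N → ℂ := multiplier N (gradSymbol N) f

/-- The operator `e^{a ∂_h}`, for real `a`. -/
def expDeriv (a : ℝ) (f : PeriodicLattice N → ℂ) : PeriodicLattice N → ℂ :=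
  multiplier N (fun k => Complex.exp ((a : ℂ) * derivSymbol k)) f

/-- The linear FPU propagator `S_h^±(t) = e^{∓ (t/h²) (∇_h - ∂_h)}`; the sign `±` is `σ = ±1`. -/
def propagator (σ t : ℝ) (f : PeriodicLattice N → ℂ) : PeriodicLattice N → ℂ :=
  multiplier N
    (fun k => Complex.exp (((-σ * (t / mesh N ^ 2) : ℝ) : ℂ) * (gradSymbol N k - derivSymbol k))) f

/-- The mean-zero condition `h ∑_x f(x) = 0`. -/
def MeanZero (f : PeriodicLattice N → ℂ) : Prop := (mesh N : ℂ) * ∑ n : PeriodicLattice N, f n = 0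

/-- The norm of `H^s(𝕋_h)`: `(∑_k ⟨k⟩^{2s} |F(k)|²)^{1/2}`. -/
def sobolevNorm (s : ℝ) (f : PeriodicLattice N → ℂ) : ℝ :=
  Real.sqrt (∑ k ∈ freqs N, bracket (k : ℝ) ^ (2 * s) * ‖latticeFourier N f k‖ ^ 2)

/-- The norm of `ℍ^s(𝕋_h) = H^s(𝕋_h) × H^s(𝕋_h)`. -/
def pairNorm (s : ℝ) (f g : PeriodicLattice N → ℂ) : ℝ :=
  Real.sqrt (sobolevNorm N s f ^ 2 + sobolevNorm N s g ^ 2)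

/-! Space-time norms. They are first defined on the Fourier side, for functions `g` of `(τ, k)`. -/

/-- The phase `s_h(k) = h^{-2} (k - (2/h) sin(hk/2))`. -/
def phase (k : ℤ) : ℝ :=
  1 / mesh N ^ 2 * ((k : ℝ) - 2 / mesh N * Real.sin (mesh N * (k : ℝ) / 2))

/-- The `X^{s,b}_{τ=ρ(k)}` norm of the function whose space-time Fourier transform is `g`:
`(∑_k ∫ ⟨k⟩^{2s} ⟨τ - ρ(k)⟩^{2b} |g(τ,k)|² dτ)^{1/2}`. -/
def xNormHat (s b : ℝ) (ρ : ℤ → ℝ) (g : ℝ → ℤ → ℂ) : ℝ≥0∞ :=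
  (∑ k ∈ freqs N, ∫⁻ τ : ℝ,
    ENNReal.ofReal (bracket (k : ℝ) ^ (2 * s) * bracket (τ - ρ k) ^ (2 * b)) *
      ‖g τ k‖ₑ ^ 2) ^ (1 / 2 : ℝ)

/-- The `ℓ²_k L¹_τ` norm of `⟨k⟩^s g(τ,k)`. -/
def ellTwoLOneNorm (s : ℝ) (g : ℝ → ℤ → ℂ) : ℝ≥0∞ :=
  (∑ k ∈ freqs N,
    (∫⁻ τ : ℝ, ENNReal.ofReal (bracket (k : ℝ) ^ s) * ‖g τ k‖ₑ) ^ 2) ^ (1 / 2 : ℝ)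

/-- `g` is the space-time Fourier transform of `u`, with `g(·,k)` in `L¹` for each frequency `k`:
formally `g(τ,k) = (h/2π) ∑_x ∫ e^{-itτ} e^{-ixk} u(t,x) dt`, and, as `u` need not be integrable in
time, this is expressed by Fourier inversion in time,
`(F_h u(t))(k) = (2π)^{-1/2} ∫ e^{itτ} g(τ,k) dτ`. It determines `g(·,k)` almost everywhere, and
`u` is continuous in time. -/
def IsSpaceTimeFourier (u : ℝ → PeriodicLattice N → ℂ) (g : ℝ → ℤ → ℂ) : Prop :=
  ∀ k ∈ freqs N, Integrable (fun τ => g τ k) ∧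
    ∀ t : ℝ, latticeFourier N (u t) k =
      ((1 / Real.sqrt (2 * Real.pi) : ℝ) : ℂ) *
        ∫ τ : ℝ, Complex.exp (Complex.I * ((t * τ : ℝ) : ℂ)) * g τ k

/-- The `Y^s_{h,±}` norm (sign `σ = ±1`): the `X^{s,1/2}_{τ = ± s_h(k)}` norm plus the `ℓ²_k L¹_τ`
norm of `⟨k⟩^s` times the space-time Fourier transform. It is `∞` if `u` does not belong to the
space, which is the completion of the Schwartz functions in this norm, realised as a space of
functions continuous in time. -/
def yNorm (σ s : ℝ) (u : ℝ → PeriodicLattice N → ℂ) : ℝ≥0∞ :=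
  ⨅ (g : ℝ → ℤ → ℂ) (_ : IsSpaceTimeFourier N u g),
    xNormHat N s (1 / 2) (fun k => σ * phase N k) g + ellTwoLOneNorm N s g

/-- The norm of the time-localised space `Y^{s,T}_{h,±}`: the infimum of the `Y^s_{h,±}` norms of
all functions that agree with `u` on `[-T,T] × 𝕋_h`. It depends only on `u` on `[-T,T]`, and is `∞`
if there is no such function in `Y^s_{h,±}`. -/
def yNormLoc (σ s T : ℝ) (u : ℝ → PeriodicLattice N → ℂ) : ℝ≥0∞ :=
  ⨅ (v : ℝ → PeriodicLattice N → ℂ) (_ : EqOn v u (Icc (-T) T)), yNorm N σ s v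

/-- The equation of sign `σ = ±1` in the coupled FPU system, at each time in `[-T,T]`: here `u` is
the component of sign `σ`, with initial datum `u₀`, and `w` the component of the opposite sign. -/
def CoupledEquation (σ T : ℝ) (u₀ : PeriodicLattice N → ℂ) (u w : ℝ → PeriodicLattice N → ℂ) : Prop :=
  ∀ t ∈ Icc (-T) T, ∀ x : PeriodicLattice N,
    u t x = propagator N σ t u₀ x - ((σ / 4 : ℝ) : ℂ) *
      ∫ t' in (0 : ℝ)..t,
        propagator N σ (t - t')
          (grad N ((u t' + expDeriv N (σ * (2 * t' / mesh N ^ 2)) (w t')) ^ 2)) x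

/-- The equation of sign `σ = ±1` in the decoupled FPU system, at each time in `[-T,T]`. -/
def DecoupledEquation (σ T : ℝ) (u₀ : PeriodicLattice N → ℂ) (v : ℝ → PeriodicLattice N → ℂ) : Prop :=
  ∀ t ∈ Icc (-T) T, ∀ x : PeriodicLattice N,
    v t x = propagator N σ t u₀ x - ((σ / 4 : ℝ) : ℂ) *
      ∫ t' in (0 : ℝ)..t, propagator N σ (t - t') (grad N (v t' ^ 2)) x

/-- `(u⁺, u⁻) ∈ C([-T,T] : ℍ^s(𝕋_h))` solves the coupled FPU system on `[-T,T]` with data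
`(u₀⁺, u₀⁻)`. (On the finite lattice all `H^s` norms give the same notion of continuity.) -/
structure IsCoupledSolution (T : ℝ) (u₀p u₀m : PeriodicLattice N → ℂ) (up um : ℝ → PeriodicLattice N → ℂ) :
    Prop where
  continuousOn_plus : ContinuousOn up (Icc (-T) T)
  continuousOn_minus : ContinuousOn um (Icc (-T) T)
  plus : CoupledEquation N 1 T u₀p up um
  minus : CoupledEquation N (-1) T u₀m um up

/-- `(v⁺, v⁻) ∈ C([-T,T] : ℍ^s(𝕋_h))` solves the decoupled FPU system on `[-T,T]` with data
`(u₀⁺, u₀⁻)`. -/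
structure IsDecoupledSolution (T : ℝ) (u₀p u₀m : PeriodicLattice N → ℂ) (vp vm : ℝ → PeriodicLattice N → ℂ) :
    Prop where
  continuousOn_plus : ContinuousOn vp (Icc (-T) T)
  continuousOn_minus : ContinuousOn vm (Icc (-T) T)
  plus : DecoupledEquation N 1 T u₀p vp
  minus : DecoupledEquation N (-1) T u₀m vm

end Lattice

end PeriodicFPU

end

/-! ### Modulation weights, their convolutions, and L² duality in `[0,∞]`. -/

namespace PeriodicFPU

/-! Undoing the linear flow (`profile`) turns either system into an equation a' = ∑ m e^{itΘ} a a
for the Fourier coefficients (`fpuSystem_iff`). The operators e^{±(2t/h²)∂_h} only flip the sign of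
the sine in the dispersion relation of the opposite wave, so the coupled and the decoupled system
are one system with a parameter χ equal to 1 or 0. The nonlinearity loses one derivative, |m| ≤ |k|.
It is recovered, uniformly in h, from two properties of the resonance function Θ (`resPhase`).

Size: |Θ| ≥ c |k k₁ k₂| with k₂ = k - k₁, for every pattern of signs and with aliasing allowed
(`le_abs_resPhase`). Without aliasing, Θ factors into a product of sines and cosines; with aliasing,
a term 2πj outweighs all the sines.

Separation: with one nonzero frequency fixed, Θ runs through boundedly many monotone branches of a
cosine of amplitude at least a constant times h⁻². Its values at the lattice frequencies are
therefore quadratically separated on each branch, and the sum of ⟨q - TΘ⟩^{-5/8} is at most a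
constant times T^{-5/8} (`countBound_resPhase`).

Time is rescaled by T, so that the interval becomes [-1,1] and one fixed cutoff serves. The output
modulation minus the two input modulations equals TΘ, so the largest of the three is bounded below
by a multiple of T |k k₁ k₂| and pays for the derivative, with a power of T to spare. Cauchy-Schwarz
and the counting bound then give the bilinear estimate `IsResonant.zSq_majConv_le`, whose constant
(for squared norms) is O(T^{1/4}) by `bilConst_le`; `ySq_duhamelMaj_le` inverts the time derivative.
The index s ≥ 0 disappears because a multiple of ⟨k⟩^s is submultiplicative along interactions. Zero
modes, on which the lower bound says nothing, are absent: the data have mean zero, and ∇_h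
annihilates the mean.

For existence, the spectra of the Picard iterates are dominated pointwise by an iteration of
functions with values in `[0,∞]`. Its increments sum to a function bounded in Y as soon as T^{1/4}R²
is small (`ySys_majLimit_le`), and dominated convergence gives the solution
(`exists_spectral_solution`). The choice T = (1 + LR²)^{-4} ensures smallness. Uniqueness needs no
uniformity: for fixed N the profiles solve an ODE in finite dimension with a locally Lipschitz
right-hand side (`quadTerm_solution_unique`). -/

/-- The weight `1 + |x|`, with values in `[0,∞]`. -/
noncomputable def wt (x : ℝ) : ℝ≥0∞ := ENNReal.ofReal (1 + |x|)

lemma one_le_wt (x : ℝ) : 1 ≤ wt x := by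
  rw [wt, ← ENNReal.ofReal_one]
  exact ENNReal.ofReal_le_ofReal (by linarith [abs_nonneg x])

lemma wt_ne_zero (x : ℝ) : wt x ≠ 0 := (zero_lt_one.trans_le (one_le_wt x)).ne'

lemma wt_ne_top (x : ℝ) : wt x ≠ ∞ := ENNReal.ofReal_ne_top

@[fun_prop]
lemma measurable_wt : Measurable wt := by
  unfold wt; fun_prop

lemma wt_rpow (x p : ℝ) : wt x ^ p = ENNReal.ofReal ((1 + |x|) ^ p) :=
  ENNReal.ofReal_rpow_of_pos (by positivity)

lemma wt_rpow_mul_rpow (x p q : ℝ) : wt x ^ p * wt x ^ q = wt x ^ (p + q) :=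
  (ENNReal.rpow_add _ _ (wt_ne_zero x) (wt_ne_top x)).symm

lemma wt_rpow_sq (x p : ℝ) : (wt x ^ p) ^ 2 = wt x ^ (2 * p) := by
  rw [sq, wt_rpow_mul_rpow]; congr 1; ring

lemma wt_rpow_cancel (x p : ℝ) : wt x ^ (-p) * wt x ^ p = 1 := by
  rw [wt_rpow_mul_rpow]; simp

lemma wt_add_le_mul (x y : ℝ) : wt (x + y) ≤ wt x * wt y := by
  rw [wt, wt, wt, ← ENNReal.ofReal_mul (by positivity)]
  apply ENNReal.ofReal_le_ofReal
  nlinarith [abs_add_le x y, abs_nonneg x, abs_nonneg y, mul_nonneg (abs_nonneg x) (abs_nonneg y)]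

lemma wt_rpow_le_rpow (x : ℝ) {p q : ℝ} (h : p ≤ q) : wt x ^ p ≤ wt x ^ q :=
  ENNReal.rpow_le_rpow_of_exponent_le (one_le_wt x) h

lemma wt_rpow_le_one (x : ℝ) {p : ℝ} (hp : p ≤ 0) : wt x ^ p ≤ 1 := by
  simpa using wt_rpow_le_rpow x hp

lemma wt_neg (x : ℝ) : wt (-x) = wt x := by simp [wt]

lemma wt_sub_comm (x y : ℝ) : wt (x - y) = wt (y - x) := by rw [← wt_neg, neg_sub]

lemma lintegral_wt_rpow_lt_top {p : ℝ} (hp : 1 < p) : ∫⁻ x, wt x ^ (-p) < ∞ := by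
  simp_rw [wt_rpow]
  have := finite_integral_one_add_norm (E := ℝ) (μ := volume) (r := p) (by simpa using hp)
  simpa [Real.norm_eq_abs] using this

/-- The value of the integral of `(1 + |x|)^{-p}`. -/
noncomputable def wtInt (p : ℝ) : ℝ≥0∞ := ∫⁻ x, wt x ^ (-p)

lemma wtInt_ne_top {p : ℝ} (hp : 1 < p) : wtInt p ≠ ∞ := (lintegral_wt_rpow_lt_top hp).ne

/-- The larger of a and b is at least e/2 and supplies the factor e^{-5/8}. The remaining exponent
3/4 + 1 - 5/8 = 9/8 is moved onto the smaller one, where it is integrable because 9/8 > 1. -/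
lemma rpow_conv_weight {a b e : ℝ} (ha : 1 ≤ a) (hb : 1 ≤ b) (he : 0 < e) (h : e ≤ a + b) :
    a ^ (-(3 / 4) : ℝ) * b ^ (-1 : ℝ) ≤
      2 * (a ^ (-(9 / 8) : ℝ) + b ^ (-(9 / 8) : ℝ)) * e ^ (-(5 / 8) : ℝ) := by
  have ha0 : 0 < a := by linarith
  have hb0 : 0 < b := by linarith
  have key : ∀ m : ℝ, 1 ≤ m → e ≤ 2 * m → m ^ (-(5 / 8) : ℝ) ≤ 2 * e ^ (-(5 / 8) : ℝ) := by
    intro m hm hem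
    have hm0 : 0 < m := by linarith
    have h1 : (2 * m) ^ (-(5 / 8) : ℝ) ≤ e ^ (-(5 / 8) : ℝ) :=
      Real.rpow_le_rpow_of_nonpos he hem (by norm_num)
    rw [Real.mul_rpow (by norm_num) hm0.le] at h1
    have h2 : (1 / 2 : ℝ) ≤ (2 : ℝ) ^ (-(5 / 8) : ℝ) := by
      have : (2 : ℝ) ^ (-1 : ℝ) ≤ (2 : ℝ) ^ (-(5 / 8) : ℝ) :=
        Real.rpow_le_rpow_of_exponent_le (by norm_num) (by norm_num)
      rw [Real.rpow_neg_one] at this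
      linarith
    have h3 : 0 < m ^ (-(5 / 8) : ℝ) := by positivity
    nlinarith
  have pa : 0 < a ^ (-(9 / 8) : ℝ) := by positivity
  have pb : 0 < b ^ (-(9 / 8) : ℝ) := by positivity
  have pe : 0 < e ^ (-(5 / 8) : ℝ) := by positivity
  rcases le_total a b with hab | hab
  · have h1 : b ^ (-1 : ℝ) = b ^ (-(3 / 8) : ℝ) * b ^ (-(5 / 8) : ℝ) := by
      rw [← Real.rpow_add hb0]; norm_num
    have h2 : b ^ (-(3 / 8) : ℝ) ≤ a ^ (-(3 / 8) : ℝ) :=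
      Real.rpow_le_rpow_of_nonpos ha0 hab (by norm_num)
    have h3 : a ^ (-(9 / 8) : ℝ) = a ^ (-(3 / 4) : ℝ) * a ^ (-(3 / 8) : ℝ) := by
      rw [← Real.rpow_add ha0]; norm_num
    have h4 := key b hb (by linarith)
    calc a ^ (-(3 / 4) : ℝ) * b ^ (-1 : ℝ)
        = (a ^ (-(3 / 4) : ℝ) * b ^ (-(3 / 8) : ℝ)) * b ^ (-(5 / 8) : ℝ) := by rw [h1]; ring
      _ ≤ a ^ (-(9 / 8) : ℝ) * (2 * e ^ (-(5 / 8) : ℝ)) := by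
          rw [h3]; gcongr
      _ ≤ _ := by nlinarith [mul_pos pb pe]
  · have h1 : a ^ (-(3 / 4) : ℝ) = a ^ (-(1 / 8) : ℝ) * a ^ (-(5 / 8) : ℝ) := by
      rw [← Real.rpow_add ha0]; norm_num
    have h2 : a ^ (-(1 / 8) : ℝ) ≤ b ^ (-(1 / 8) : ℝ) :=
      Real.rpow_le_rpow_of_nonpos hb0 hab (by norm_num)
    have h3 : b ^ (-(9 / 8) : ℝ) = b ^ (-(1 / 8) : ℝ) * b ^ (-1 : ℝ) := by
      rw [← Real.rpow_add hb0]; norm_num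
    have h4 := key a ha (by linarith)
    calc a ^ (-(3 / 4) : ℝ) * b ^ (-1 : ℝ)
        = (a ^ (-(1 / 8) : ℝ) * b ^ (-1 : ℝ)) * a ^ (-(5 / 8) : ℝ) := by rw [h1]; ring
      _ ≤ b ^ (-(9 / 8) : ℝ) * (2 * e ^ (-(5 / 8) : ℝ)) := by
          rw [h3]; gcongr
      _ ≤ _ := by nlinarith [mul_pos pa pe]

lemma wt_conv_weight (E t : ℝ) :
    wt t ^ (-(3 / 4) : ℝ) * wt (E - t) ^ (-1 : ℝ) ≤
      2 * (wt t ^ (-(9 / 8) : ℝ) + wt (E - t) ^ (-(9 / 8) : ℝ)) * wt E ^ (-(5 / 8) : ℝ) := by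
  have h := rpow_conv_weight (a := 1 + |t|) (b := 1 + |E - t|) (e := 1 + |E|)
    (by linarith [abs_nonneg t]) (by linarith [abs_nonneg (E - t)]) (by positivity)
    (by have := abs_add_le t (E - t); rw [add_sub_cancel] at this; linarith)
  simp_rw [wt_rpow]
  rw [← ENNReal.ofReal_mul (by positivity), ← ENNReal.ofReal_add (by positivity) (by positivity),
    show (2 : ℝ≥0∞) = ENNReal.ofReal 2 by simp, ← ENNReal.ofReal_mul (by positivity),
    ← ENNReal.ofReal_mul (by positivity)]
  exact ENNReal.ofReal_le_ofReal h

/-- `∫ ⟨t⟩^{-3/4} ⟨E - t⟩^{-1} dt ≲ ⟨E⟩^{-5/8}`. -/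
lemma lintegral_wt_conv_le (E : ℝ) :
    ∫⁻ t, wt t ^ (-(3 / 4) : ℝ) * wt (E - t) ^ (-1 : ℝ) ≤
      4 * wtInt (9 / 8) * wt E ^ (-(5 / 8) : ℝ) := by
  calc _ ≤ ∫⁻ t, 2 * (wt t ^ (-(9 / 8) : ℝ) + wt (E - t) ^ (-(9 / 8) : ℝ)) *
        wt E ^ (-(5 / 8) : ℝ) := lintegral_mono fun t => wt_conv_weight E t
    _ = _ := by
        rw [lintegral_mul_const _ (by fun_prop), lintegral_const_mul _ (by fun_prop),
          lintegral_add_left (by fun_prop),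
          lintegral_sub_left_eq_self (fun x => wt x ^ (-(9 / 8) : ℝ)) E, ← wtInt]
        ring

lemma lintegral_wt_conv_le' (E : ℝ) :
    ∫⁻ t, wt t ^ (-1 : ℝ) * wt (E - t) ^ (-1 : ℝ) ≤
      4 * wtInt (9 / 8) * wt E ^ (-(5 / 8) : ℝ) :=
  (lintegral_mono fun t => by
    gcongr ?_ * _
    exact wt_rpow_le_rpow t (by norm_num)).trans (lintegral_wt_conv_le E)

/-- Cauchy-Schwarz for nonnegative functions. -/
lemma lintegral_mul_sq_le {α : Type*} [MeasurableSpace α] {μ : Measure α} {f g : α → ℝ≥0∞}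
    (hf : AEMeasurable f μ) (hg : AEMeasurable g μ) :
    (∫⁻ a, f a * g a ∂μ) ^ 2 ≤ (∫⁻ a, f a ^ 2 ∂μ) * ∫⁻ a, g a ^ 2 ∂μ := by
  have h := ENNReal.lintegral_mul_le_Lp_mul_Lq μ Real.HolderConjugate.two_two hf hg
  calc (∫⁻ a, f a * g a ∂μ) ^ 2
      ≤ ((∫⁻ a, f a ^ (2 : ℝ) ∂μ) ^ (1 / 2 : ℝ) * (∫⁻ a, g a ^ (2 : ℝ) ∂μ) ^ (1 / 2 : ℝ)) ^ 2 := by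
        gcongr; exact h
    _ = _ := by
        rw [mul_pow, ← ENNReal.rpow_natCast, ← ENNReal.rpow_natCast, ← ENNReal.rpow_mul,
          ← ENNReal.rpow_mul]
        norm_num

lemma le_of_sq_le_mul_self {a A : ℝ≥0∞} (ha : a ≠ ∞) (h : a ^ 2 ≤ A * a) : a ≤ A := by
  rcases eq_or_ne a 0 with rfl | h0
  · exact zero_le
  · rw [sq] at h
    exact (ENNReal.mul_le_mul_iff_left h0 ha).1 h

/-- `L²` duality for nonnegative functions. -/
lemma lintegral_sq_le_of_forall_mul {α : Type*} [MeasurableSpace α] {μ : Measure α} [SigmaFinite μ]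
    {F : α → ℝ≥0∞} (hF : Measurable F) {A : ℝ≥0∞}
    (h : ∀ φ : α → ℝ≥0∞, Measurable φ → (∫⁻ a, φ a * F a ∂μ) ^ 2 ≤ A * ∫⁻ a, φ a ^ 2 ∂μ) :
    ∫⁻ a, F a ^ 2 ∂μ ≤ A := by
  -- Truncating F in height and to sets of finite measure makes the norm of φ finite, so that one
  -- factor can be cancelled in a² ≤ A a. Monotone convergence removes the truncation.
  let φ : ℕ → α → ℝ≥0∞ := fun n => (spanningSets μ n).indicator fun a => min (F a) n
  have hφm : ∀ n, Measurable (φ n) := fun n =>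
    (hF.min measurable_const).indicator (measurableSet_spanningSets μ n)
  have hφle : ∀ n a, φ n a ≤ F a := fun n a => by
    by_cases ha : a ∈ spanningSets μ n <;> simp [φ, ha]
  have hbound : ∀ n, ∫⁻ a, φ n a ^ 2 ∂μ ≤ A := by
    intro n
    apply le_of_sq_le_mul_self
    · refine ne_top_of_le_ne_top
        (ENNReal.mul_ne_top (a := (n : ℝ≥0∞) ^ 2) (by simp) (measure_spanningSets_lt_top μ n).ne) ?_
      rw [← setLIntegral_const, ← lintegral_indicator (measurableSet_spanningSets μ n)]
      apply lintegral_mono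
      intro a
      by_cases ha : a ∈ spanningSets μ n
      · simp only [φ, ha, indicator_of_mem]
        gcongr
        exact min_le_right _ _
      · simp [φ, ha]
    · refine le_trans ?_ (h _ (hφm n))
      gcongr with a
      rw [sq]
      gcongr
      exact hφle n a
  have hmono : ∀ a, Monotone fun n => φ n a := by
    intro a m n hmn
    by_cases ha : a ∈ spanningSets μ m
    · have ha' := monotone_spanningSets μ hmn ha
      simp only [φ, ha, ha', indicator_of_mem]
      gcongr
    · simp [φ, ha]
  have hlim : ∀ a, Filter.Tendsto (fun n => φ n a ^ 2) Filter.atTop (nhds (F a ^ 2)) := by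
    intro a
    apply ENNReal.Tendsto.pow
    have h1 : Filter.Tendsto (fun n : ℕ => min (F a) (n : ℝ≥0∞)) Filter.atTop (nhds (F a)) := by
      have := (tendsto_const_nhds (x := F a)).min ENNReal.tendsto_nat_nhds_top
      simpa using this
    refine h1.congr' ?_
    filter_upwards [Filter.eventually_ge_atTop (spanningSetsIndex μ a)] with n hn
    have ha' := monotone_spanningSets μ hn (mem_spanningSetsIndex μ a)
    simp [φ, ha']
  have := lintegral_tendsto_of_tendsto_of_monotone (μ := μ) (f := fun n a => φ n a ^ 2)
    (F := fun a => F a ^ 2) (fun n => ((hφm n).pow_const 2).aemeasurable)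
    (Filter.Eventually.of_forall fun a m n hmn => by
      have := hmono a hmn
      dsimp only at this ⊢
      gcongr) (Filter.Eventually.of_forall hlim)
  exact le_of_tendsto' this hbound

end PeriodicFPU

namespace PeriodicFPU

set_option linter.unusedSectionVars false

/-! ### L² bilinear estimates for the resonant convolution, from counting. -/

section Bilinear

variable {ι : Type*} [Fintype ι] [AddCommGroup ι] [MeasurableSpace ι] [DiscreteMeasurableSpace ι]

/-- The product of the counting measure on the frequencies and the Lebesgue measure in `τ`. -/
noncomputable abbrev specMeasure (ι : Type*) [MeasurableSpace ι] : Measure (ι × ℝ) :=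
  (Measure.count : Measure ι).prod volume

lemma lintegral_specMeasure {f : ι × ℝ → ℝ≥0∞} (hf : Measurable f) :
    ∫⁻ p, f p ∂(specMeasure ι) = ∑ k, ∫⁻ x, f (k, x) := by
  rw [lintegral_prod _ hf.aemeasurable, lintegral_count, tsum_fintype]

open Classical in
/-- The indicator of the interactions with no zero mode. -/
noncomputable def nonzeroInd (k k₁ : ι) : ℝ≥0∞ := if k = 0 ∨ k₁ = 0 ∨ k = k₁ then 0 else 1

lemma nonzeroInd_le_one (k k₁ : ι) : nonzeroInd k k₁ ≤ 1 := by
  unfold nonzeroInd; split_ifs <;> simp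

/-- The convolution in frequency and, up to the resonance function `Θ`, in `τ`. -/
noncomputable def resConv (Θ : ι → ι → ℝ) (U V : ι × ℝ → ℝ≥0∞) (p : ι × ℝ) : ℝ≥0∞ :=
  ∫⁻ q, nonzeroInd p.1 q.1 * (U q * V (p.1 - q.1, p.2 - Θ p.1 q.1 - q.2)) ∂(specMeasure ι)

/-- Uniform counting bounds for the level sets of a resonance function. -/
structure CountBound (B : ℝ≥0∞) (Θ : ι → ι → ℝ) : Prop where
  out : ∀ k, k ≠ 0 → ∀ q : ℝ, ∑ k₁, wt (q - Θ k k₁) ^ (-(5 / 8) : ℝ) ≤ B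
  fst : ∀ k₁, k₁ ≠ 0 → ∀ q : ℝ, ∑ k, wt (q - Θ k k₁) ^ (-(5 / 8) : ℝ) ≤ B
  snd : ∀ k₂, k₂ ≠ 0 → ∀ q : ℝ, ∑ k, wt (q - Θ k (k - k₂)) ^ (-(5 / 8) : ℝ) ≤ B

lemma CountBound.swap {B : ℝ≥0∞} {Θ : ι → ι → ℝ} (h : CountBound B Θ) :
    CountBound B fun k k₂ => Θ k (k - k₂) where
  out k hk q := by
    exact (Equiv.sum_comp (Equiv.subLeft k) fun k₁ => wt (q - Θ k k₁) ^ (-(5 / 8) : ℝ)).trans_le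
      (h.out k hk q)
  fst := h.snd
  snd k₂ hk₂ q := by simpa using h.fst k₂ hk₂ q

variable (Θ : ι → ι → ℝ)

lemma measurable_uncurry_discrete {β : Type*} [MeasurableSpace β] (f : ι → ι → β) {γ : Type*}
    [MeasurableSpace γ] {a b : γ → ι} (ha : Measurable a) (hb : Measurable b) :
    Measurable fun z => f (a z) (b z) :=
  (Measurable.of_discrete (f := fun x : ι × ι => f x.1 x.2)).comp (ha.prodMk hb)

lemma measurable_shift : Measurable fun z : (ι × ℝ) × (ι × ℝ) =>
    (z.1.1 - z.2.1, z.1.2 - Θ z.1.1 z.2.1 - z.2.2) := by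
  refine Measurable.prodMk ?_ ?_
  · exact measurable_uncurry_discrete (fun a b : ι => a - b) (by fun_prop) (by fun_prop)
  · refine Measurable.sub (Measurable.sub (by fun_prop) ?_) (by fun_prop)
    exact measurable_uncurry_discrete Θ (by fun_prop) (by fun_prop)

lemma measurable_nonzeroInd : Measurable fun z : (ι × ℝ) × (ι × ℝ) => nonzeroInd z.1.1 z.2.1 :=
  measurable_uncurry_discrete nonzeroInd (by fun_prop) (by fun_prop)

lemma lintegral_shift_out {W : ι × ℝ → ℝ≥0∞} (hW : Measurable W) (q : ι × ℝ) :
    ∫⁻ p, W (p.1 - q.1, p.2 - Θ p.1 q.1 - q.2) ∂(specMeasure ι) = ∫⁻ p, W p ∂(specMeasure ι) := by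
  have hm : Measurable fun p : ι × ℝ => W (p.1 - q.1, p.2 - Θ p.1 q.1 - q.2) :=
    hW.comp ((measurable_shift Θ).comp measurable_prodMk_right)
  rw [lintegral_specMeasure hm, lintegral_specMeasure hW, ← Equiv.sum_comp (Equiv.subRight q.1) fun k => ∫⁻ x, W (k, x)]
  refine Finset.sum_congr rfl fun k _ => ?_
  simp only [Equiv.subRight_apply, sub_sub]
  exact lintegral_sub_right_eq_self (μ := volume) (fun x => W (k - q.1, x)) _

lemma lintegral_shift_in {W : ι × ℝ → ℝ≥0∞} (hW : Measurable W) (p : ι × ℝ) :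
    ∫⁻ q, W (p.1 - q.1, p.2 - Θ p.1 q.1 - q.2) ∂(specMeasure ι) = ∫⁻ p, W p ∂(specMeasure ι) := by
  have hm : Measurable fun q : ι × ℝ => W (p.1 - q.1, p.2 - Θ p.1 q.1 - q.2) :=
    hW.comp ((measurable_shift Θ).comp measurable_prodMk_left)
  rw [lintegral_specMeasure hm, lintegral_specMeasure hW, ← Equiv.sum_comp (Equiv.subLeft p.1) fun k => ∫⁻ x, W (k, x)]
  refine Finset.sum_congr rfl fun k _ => ?_
  simp only [Equiv.subLeft_apply]
  exact lintegral_sub_left_eq_self (μ := volume) (fun x => W (p.1 - k, x)) _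

lemma measurable_resConv {U V : ι × ℝ → ℝ≥0∞} (hU : Measurable U) (hV : Measurable V) :
    Measurable (resConv Θ U V) := by
  unfold resConv
  refine Measurable.lintegral_prod_right' (f := fun z : (ι × ℝ) × (ι × ℝ) => nonzeroInd z.1.1 z.2.1 *
    (U z.2 * V (z.1.1 - z.2.1, z.1.2 - Θ z.1.1 z.2.1 - z.2.2))) ?_
  exact measurable_nonzeroInd.mul ((hU.comp measurable_snd).mul (hV.comp (measurable_shift Θ)))

lemma resConv_swap {U V : ι × ℝ → ℝ≥0∞} (hU : Measurable U) (hV : Measurable V) :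
    resConv Θ U V = resConv (fun k k₂ => Θ k (k - k₂)) V U := by
  ext p
  have hm : ∀ (Θ : ι → ι → ℝ) {U V : ι × ℝ → ℝ≥0∞} (_ : Measurable U) (_ : Measurable V),
      Measurable fun q : ι × ℝ =>
        nonzeroInd p.1 q.1 * (U q * V (p.1 - q.1, p.2 - Θ p.1 q.1 - q.2)) := fun Θ U V hU hV =>
    (measurable_nonzeroInd.mul ((hU.comp measurable_snd).mul (hV.comp (measurable_shift Θ)))).comp
      measurable_prodMk_left
  unfold resConv
  rw [lintegral_specMeasure (hm _ hU hV), lintegral_specMeasure (hm (fun k k₂ => Θ k (k - k₂)) hV hU),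
    ← Equiv.sum_comp (Equiv.subLeft p.1)]
  refine Finset.sum_congr rfl fun k _ => ?_
  simp only [Equiv.subLeft_apply, sub_sub_cancel]
  rw [← lintegral_sub_left_eq_self _ (p.2 - Θ p.1 (p.1 - k))]
  refine lintegral_congr fun x => ?_
  have : nonzeroInd p.1 (p.1 - k) = nonzeroInd p.1 k := by
    unfold nonzeroInd
    congr 1
    simp only [sub_eq_zero, eq_iff_iff]
    have : p.1 = p.1 - k ↔ k = 0 := by rw [eq_comm, sub_eq_self]
    tauto
  rw [this, sub_sub_cancel]
  ring

variable {Θ}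

/-- Cauchy-Schwarz in the inner variable, after inserting ⟨τ₁⟩^{1/2}⟨τ₂⟩^{1/2} and its inverse. The
inverse weights integrate in τ to ⟨τ - Θ⟩^{-5/8}, and summing over k₁ with k fixed is the bound
`CountBound.out`. The other factor is an ordinary convolution, integrated by translation invariance.
-/
lemma lintegral_resConv_sq_le {B : ℝ≥0∞} (h : CountBound B Θ) {U V : ι × ℝ → ℝ≥0∞}
    (hU : Measurable U) (hV : Measurable V) :
    ∫⁻ p, resConv Θ U V p ^ 2 ∂(specMeasure ι) ≤ 4 * wtInt (9 / 8) * B *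
      ((∫⁻ p, wt p.2 * U p ^ 2 ∂(specMeasure ι)) * ∫⁻ p, wt p.2 * V p ^ 2 ∂(specMeasure ι)) := by
  have hsh := measurable_shift Θ
  have hshp : ∀ p : ι × ℝ, Measurable fun q : ι × ℝ => (p.1 - q.1, p.2 - Θ p.1 q.1 - q.2) := fun p =>
    hsh.comp measurable_prodMk_left
  have hnz : ∀ p : ι × ℝ, Measurable fun q : ι × ℝ => nonzeroInd p.1 q.1 := fun p =>
    measurable_nonzeroInd.comp measurable_prodMk_left
  have hU' : Measurable fun q : ι × ℝ => wt q.2 * U q ^ 2 := by fun_prop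
  have hV' : Measurable fun q : ι × ℝ => wt q.2 * V q ^ 2 := by fun_prop
  have key : ∀ p : ι × ℝ, resConv Θ U V p ^ 2 ≤ 4 * wtInt (9 / 8) * B *
      ∫⁻ q, (wt q.2 * U q ^ 2) * (fun z : ι × ℝ => wt z.2 * V z ^ 2)
        (p.1 - q.1, p.2 - Θ p.1 q.1 - q.2) ∂(specMeasure ι) := by
    intro p
    have hVp := hV.comp (hshp p)
    have ht : Measurable fun q : ι × ℝ => p.2 - Θ p.1 q.1 - q.2 := measurable_snd.comp (hshp p)
    simp only [Function.comp_def] at hVp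
    have e : resConv Θ U V p = ∫⁻ q, (nonzeroInd p.1 q.1 *
        (wt q.2 ^ (-(1 / 2) : ℝ) * wt (p.2 - Θ p.1 q.1 - q.2) ^ (-(1 / 2) : ℝ))) *
        ((wt q.2 ^ (1 / 2 : ℝ) * U q) * (wt (p.2 - Θ p.1 q.1 - q.2) ^ (1 / 2 : ℝ) *
          V (p.1 - q.1, p.2 - Θ p.1 q.1 - q.2))) ∂(specMeasure ι) := by
      refine lintegral_congr fun q => ?_
      calc _ = (wt q.2 ^ (-(1 / 2) : ℝ) * wt q.2 ^ (1 / 2 : ℝ)) *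
            (wt (p.2 - Θ p.1 q.1 - q.2) ^ (-(1 / 2) : ℝ) *
              wt (p.2 - Θ p.1 q.1 - q.2) ^ (1 / 2 : ℝ)) * _ := by
            rw [wt_rpow_cancel, wt_rpow_cancel, one_mul, one_mul]
        _ = _ := by ring
    rw [e]
    refine (lintegral_mul_sq_le ?_ ?_).trans (mul_le_mul' ?_ (le_of_eq ?_))
    · exact ((hnz p).mul (by fun_prop)).aemeasurable
    · exact Measurable.aemeasurable (by fun_prop)
    · rcases eq_or_ne p.1 0 with hp | hp
      · simp [nonzeroInd, hp]
      · calc _ ≤ ∫⁻ q, wt q.2 ^ (-1 : ℝ) * wt (p.2 - Θ p.1 q.1 - q.2) ^ (-1 : ℝ)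
              ∂(specMeasure ι) := by
              refine lintegral_mono fun q => ?_
              rw [mul_pow, mul_pow, wt_rpow_sq, wt_rpow_sq]
              norm_num
              exact mul_le_of_le_one_left' (pow_le_one₀ zero_le (nonzeroInd_le_one _ _))
          _ ≤ ∑ k₁, 4 * wtInt (9 / 8) * wt (p.2 - Θ p.1 k₁) ^ (-(5 / 8) : ℝ) := by
              rw [lintegral_specMeasure (by fun_prop)]
              exact Finset.sum_le_sum fun k₁ _ => lintegral_wt_conv_le' _
          _ ≤ _ := by
              rw [← Finset.mul_sum]
              gcongr
              exact h.out _ hp _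
    · refine lintegral_congr fun q => ?_
      simp only [mul_pow, wt_rpow_sq]
      norm_num
  calc _ ≤ ∫⁻ p, 4 * wtInt (9 / 8) * B * ∫⁻ q, (wt q.2 * U q ^ 2) *
        (fun z : ι × ℝ => wt z.2 * V z ^ 2) (p.1 - q.1, p.2 - Θ p.1 q.1 - q.2)
          ∂(specMeasure ι) ∂(specMeasure ι) := lintegral_mono key
    _ = _ := by
      have hm : Measurable fun z : (ι × ℝ) × (ι × ℝ) => (wt z.2.2 * U z.2 ^ 2) *
          (fun z : ι × ℝ => wt z.2 * V z ^ 2) (z.1.1 - z.2.1, z.1.2 - Θ z.1.1 z.2.1 - z.2.2) :=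
        (hU'.comp measurable_snd).mul (hV'.comp hsh)
      rw [lintegral_const_mul _ hm.lintegral_prod_right', lintegral_lintegral_swap hm.aemeasurable]
      congr 1
      rw [← lintegral_mul_const _ hU']
      refine lintegral_congr fun q => ?_
      exact (lintegral_const_mul (wt q.2 * U q ^ 2)
        (hV'.comp (hsh.comp measurable_prodMk_right))).trans
          (congrArg _ (lintegral_shift_out Θ hV' q))

/-- Here U carries no modulation weight, its half power having been spent on the derivative; the
output weight replaces it. By duality the convolution is moved off U, and Cauchy-Schwarz then
requires a count over the output frequency k with k₁ fixed (`CountBound.fst`). The exponent -3/4,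
better than the -1 of X^{0,-1/2}, is what the ℓ²L¹ estimate needs. -/
lemma lintegral_wt_resConv_sq_le {B : ℝ≥0∞} (h : CountBound B Θ) {U V : ι × ℝ → ℝ≥0∞}
    (hU : Measurable U) (hV : Measurable V) :
    ∫⁻ p, wt p.2 ^ (-(3 / 4) : ℝ) * resConv Θ U V p ^ 2 ∂(specMeasure ι) ≤
      4 * wtInt (9 / 8) * B *
      ((∫⁻ p, U p ^ 2 ∂(specMeasure ι)) * ∫⁻ p, wt p.2 * V p ^ 2 ∂(specMeasure ι)) := by
  have hsh := measurable_shift Θ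
  have hshq : ∀ q : ι × ℝ, Measurable fun p : ι × ℝ => (p.1 - q.1, p.2 - Θ p.1 q.1 - q.2) := fun q =>
    hsh.comp measurable_prodMk_right
  have hV' : Measurable fun q : ι × ℝ => wt q.2 * V q ^ 2 := by fun_prop
  have hN := measurable_resConv Θ hU hV
  have e : ∀ p : ι × ℝ, wt p.2 ^ (-(3 / 4) : ℝ) * resConv Θ U V p ^ 2 =
      (wt p.2 ^ (-(3 / 8) : ℝ) * resConv Θ U V p) ^ 2 := by
    intro p
    rw [mul_pow, wt_rpow_sq]
    norm_num
  simp_rw [e]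
  refine lintegral_sq_le_of_forall_mul (by fun_prop) fun φ hφ => ?_
  -- The transpose of U ↦ ⟨τ⟩^{-3/8} `resConv Θ U V`, applied to the test function φ.
  set W : ι × ℝ → ℝ≥0∞ := fun q => ∫⁻ p, φ p * wt p.2 ^ (-(3 / 8) : ℝ) *
    (nonzeroInd p.1 q.1 * V (p.1 - q.1, p.2 - Θ p.1 q.1 - q.2)) ∂(specMeasure ι) with hWdef
  have hWm2 : Measurable fun z : (ι × ℝ) × (ι × ℝ) => φ z.1 * wt z.1.2 ^ (-(3 / 8) : ℝ) *
      (nonzeroInd z.1.1 z.2.1 * V (z.1.1 - z.2.1, z.1.2 - Θ z.1.1 z.2.1 - z.2.2)) :=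
    Measurable.mul (by fun_prop) (measurable_nonzeroInd.mul (hV.comp hsh))
  have hW : Measurable W := hWm2.lintegral_prod_left'
  have hpair : ∫⁻ p, φ p * (wt p.2 ^ (-(3 / 8) : ℝ) * resConv Θ U V p) ∂(specMeasure ι) =
      ∫⁻ q, U q * W q ∂(specMeasure ι) := by
    have hm : Measurable fun z : (ι × ℝ) × (ι × ℝ) => U z.2 * (φ z.1 * wt z.1.2 ^ (-(3 / 8) : ℝ) *
      (nonzeroInd z.1.1 z.2.1 * V (z.1.1 - z.2.1, z.1.2 - Θ z.1.1 z.2.1 - z.2.2))) :=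
      (hU.comp measurable_snd).mul hWm2
    calc _ = ∫⁻ p, ∫⁻ q, U q * (φ p * wt p.2 ^ (-(3 / 8) : ℝ) *
        (nonzeroInd p.1 q.1 * V (p.1 - q.1, p.2 - Θ p.1 q.1 - q.2)))
          ∂(specMeasure ι) ∂(specMeasure ι) := by
          refine lintegral_congr fun p => ?_
          rw [resConv, ← mul_assoc, ← lintegral_const_mul]
          · refine lintegral_congr fun q => ?_
            ring
          · exact (measurable_nonzeroInd.mul ((hU.comp measurable_snd).mul (hV.comp hsh))).comp
              measurable_prodMk_left
      _ = _ := by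
          rw [lintegral_lintegral_swap hm.aemeasurable]
          refine lintegral_congr fun q => ?_
          exact lintegral_const_mul _ (hWm2.comp measurable_prodMk_right)
  have hWsq : ∫⁻ q, W q ^ 2 ∂(specMeasure ι) ≤ 4 * wtInt (9 / 8) * B *
      ((∫⁻ p, φ p ^ 2 ∂(specMeasure ι)) * ∫⁻ p, wt p.2 * V p ^ 2 ∂(specMeasure ι)) := by
    have key : ∀ q : ι × ℝ, W q ^ 2 ≤ 4 * wtInt (9 / 8) * B *
        ∫⁻ p, φ p ^ 2 * (fun z : ι × ℝ => wt z.2 * V z ^ 2)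
          (p.1 - q.1, p.2 - Θ p.1 q.1 - q.2) ∂(specMeasure ι) := by
      intro q
      have hVq := hV.comp (hshq q)
      have ht : Measurable fun p : ι × ℝ => p.2 - Θ p.1 q.1 - q.2 := measurable_snd.comp (hshq q)
      simp only [Function.comp_def] at hVq
      have e : W q = ∫⁻ p, (nonzeroInd p.1 q.1 *
          (wt p.2 ^ (-(3 / 8) : ℝ) * wt (p.2 - Θ p.1 q.1 - q.2) ^ (-(1 / 2) : ℝ))) *
          (φ p * (wt (p.2 - Θ p.1 q.1 - q.2) ^ (1 / 2 : ℝ) *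
            V (p.1 - q.1, p.2 - Θ p.1 q.1 - q.2))) ∂(specMeasure ι) := by
        refine lintegral_congr fun p => ?_
        calc _ = (wt (p.2 - Θ p.1 q.1 - q.2) ^ (-(1 / 2) : ℝ) *
                wt (p.2 - Θ p.1 q.1 - q.2) ^ (1 / 2 : ℝ)) * _ := by
              rw [wt_rpow_cancel, one_mul]
          _ = _ := by ring
      rw [e]
      refine (lintegral_mul_sq_le ?_ ?_).trans (mul_le_mul' ?_ (le_of_eq ?_))
      · exact ((measurable_nonzeroInd.comp measurable_prodMk_right).mul (by fun_prop)).aemeasurable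
      · exact Measurable.aemeasurable (by fun_prop)
      · rcases eq_or_ne q.1 0 with hq | hq
        · simp [nonzeroInd, hq]
        · calc _ ≤ ∫⁻ p, wt p.2 ^ (-(3 / 4) : ℝ) * wt (p.2 - Θ p.1 q.1 - q.2) ^ (-1 : ℝ)
                ∂(specMeasure ι) := by
                refine lintegral_mono fun p => ?_
                rw [mul_pow, mul_pow, wt_rpow_sq, wt_rpow_sq]
                norm_num
                exact mul_le_of_le_one_left' (pow_le_one₀ zero_le (nonzeroInd_le_one _ _))
            _ ≤ ∑ k, 4 * wtInt (9 / 8) * wt (-q.2 - Θ k q.1) ^ (-(5 / 8) : ℝ) := by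
                rw [lintegral_specMeasure (by fun_prop)]
                refine Finset.sum_le_sum fun k _ => ?_
                have := lintegral_wt_conv_le (q.2 + Θ k q.1)
                rw [← wt_neg, neg_add'] at this
                refine le_trans (le_of_eq (lintegral_congr fun x => ?_)) this
                rw [wt_sub_comm (q.2 + Θ k q.1)]
                congr 3
                ring
            _ ≤ _ := by
                rw [← Finset.mul_sum]
                gcongr
                exact h.fst _ hq _
      · refine lintegral_congr fun p => ?_
        simp only [mul_pow, wt_rpow_sq]
        norm_num
    calc _ ≤ ∫⁻ q, 4 * wtInt (9 / 8) * B * ∫⁻ p, φ p ^ 2 *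
          (fun z : ι × ℝ => wt z.2 * V z ^ 2) (p.1 - q.1, p.2 - Θ p.1 q.1 - q.2)
            ∂(specMeasure ι) ∂(specMeasure ι) := lintegral_mono key
      _ = _ := by
        have hm : Measurable fun z : (ι × ℝ) × (ι × ℝ) => φ z.1 ^ 2 *
            (fun z : ι × ℝ => wt z.2 * V z ^ 2) (z.1.1 - z.2.1, z.1.2 - Θ z.1.1 z.2.1 - z.2.2) :=
          Measurable.mul (by fun_prop) (hV'.comp hsh)
        rw [lintegral_const_mul _ hm.lintegral_prod_left',
          ← lintegral_lintegral_swap hm.aemeasurable]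
        congr 1
        rw [← lintegral_mul_const _ (by fun_prop)]
        refine lintegral_congr fun p => ?_
        exact (lintegral_const_mul (φ p ^ 2) (hV'.comp (hsh.comp measurable_prodMk_left))).trans
          (congrArg _ (lintegral_shift_in Θ hV' p))
  rw [hpair]
  calc _ ≤ (∫⁻ q, U q ^ 2 ∂(specMeasure ι)) * ∫⁻ q, W q ^ 2 ∂(specMeasure ι) :=
        lintegral_mul_sq_le hU.aemeasurable hW.aemeasurable
    _ ≤ _ := mul_le_mul' le_rfl hWsq
    _ = _ := by ring

lemma lintegral_wt_resConv_sq_le' {B : ℝ≥0∞} (h : CountBound B Θ) {U V : ι × ℝ → ℝ≥0∞}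
    (hU : Measurable U) (hV : Measurable V) :
    ∫⁻ p, wt p.2 ^ (-(3 / 4) : ℝ) * resConv Θ U V p ^ 2 ∂(specMeasure ι) ≤
      4 * wtInt (9 / 8) * B *
      ((∫⁻ p, wt p.2 * U p ^ 2 ∂(specMeasure ι)) * ∫⁻ p, V p ^ 2 ∂(specMeasure ι)) := by
  rw [resConv_swap Θ hU hV, mul_comm (∫⁻ p, wt p.2 * U p ^ 2 ∂(specMeasure ι))]
  exact lintegral_wt_resConv_sq_le h.swap hV hU

end Bilinear

end PeriodicFPU

/-! ### Trading the derivative for modulation weights. -/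

namespace PeriodicFPU

set_option linter.unusedSectionVars false

lemma ennreal_add_sq_le (a b : ℝ≥0∞) : (a + b) ^ 2 ≤ 4 * (a ^ 2 + b ^ 2) := by
  rcases le_total a b with h | h
  · calc (a + b) ^ 2 ≤ (b + b) ^ 2 := by gcongr
      _ = 4 * b ^ 2 := by ring
      _ ≤ _ := by gcongr; exact le_add_self
  · calc (a + b) ^ 2 ≤ (a + a) ^ 2 := by gcongr
      _ = 4 * a ^ 2 := by ring
      _ ≤ _ := by gcongr; exact le_self_add

lemma ennreal_add_add_sq_le (a b c : ℝ≥0∞) : (a + b + c) ^ 2 ≤ 16 * (a ^ 2 + b ^ 2 + c ^ 2) := by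
  calc (a + b + c) ^ 2 ≤ 4 * ((a + b) ^ 2 + c ^ 2) := ennreal_add_sq_le _ _
    _ ≤ 4 * (4 * (a ^ 2 + b ^ 2) + 4 * c ^ 2) := by
        gcongr
        · exact ennreal_add_sq_le _ _
        · exact le_mul_of_one_le_left' (by norm_num)
    _ = _ := by ring

lemma sqrt_add_le_add_sqrt {a b : ℝ} (ha : 0 ≤ a) (hb : 0 ≤ b) : √(a + b) ≤ √a + √b := by
  rw [Real.sqrt_le_left (by positivity), add_sq, Real.sq_sqrt ha, Real.sq_sqrt hb]
  have := mul_nonneg (Real.sqrt_nonneg a) (Real.sqrt_nonneg b)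
  linarith

/-- The first consequence of a lower bound on the resonance function. -/
lemma resonance_sqrt_bound {c T x y z j₀ j₁ j₂ : ℝ} (hc : 0 < c) (hT : 0 < T)
    (hx : 0 ≤ x) (hy : 1 ≤ y) (hz : 1 ≤ z) (hxyz : x ≤ y + z)
    (h : c * (T * (x * y * z)) ≤ j₀ + j₁ + j₂) :
    T * x ≤ √(2 / c) * T ^ (1 / 2 : ℝ) * √(j₀ + j₁ + j₂) := by
  have hyz : x / 2 ≤ y * z := by nlinarith
  have h3 : c * (T * (x * (x / 2))) ≤ j₀ + j₁ + j₂ := by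
    refine le_trans ?_ h
    rw [mul_assoc x]
    gcongr
  rw [← Real.sqrt_eq_rpow, ← Real.sqrt_mul (by positivity), ← Real.sqrt_mul (by positivity)]
  apply Real.le_sqrt_of_sq_le
  have : (T * x) ^ 2 = 2 / c * T * (c * (T * (x * (x / 2)))) := by field_simp
  rw [this]
  gcongr

/-- Since y, z ≥ 1, x ≤ y + z ≤ 2yz, so that the resonance T x y z is at least T x²/2. Taking square
roots bounds T x by T^{1/2} times half powers of the modulations. -/
lemma resonance_bound {c T x y z j₀ j₁ j₂ : ℝ} (hc : 0 < c) (hc1 : c ≤ 1) (hT : 0 < T)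
    (hx : 0 ≤ x) (hy : 1 ≤ y) (hz : 1 ≤ z) (hxyz : x ≤ y + z)
    (h0 : 1 ≤ j₀) (h1 : 1 ≤ j₁) (h2 : 1 ≤ j₂) (h : c * (T * (x * y * z)) ≤ j₀ + j₁ + j₂) :
    T * x ≤ 6 / c * T ^ (1 / 2 : ℝ) *
      (j₀ ^ (1 / 2 : ℝ) + j₁ ^ (1 / 2 : ℝ) + j₂ ^ (1 / 2 : ℝ)) := by
  refine (resonance_sqrt_bound hc hT hx hy hz hxyz h).trans ?_
  simp_rw [← Real.sqrt_eq_rpow]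
  have hs : √(j₀ + j₁ + j₂) ≤ √j₀ + √j₁ + √j₂ := by
    refine (sqrt_add_le_add_sqrt (by positivity) (by positivity)).trans ?_
    gcongr
    exact sqrt_add_le_add_sqrt (by positivity) (by positivity)
  have hcc : √(2 / c) ≤ 6 / c := by
    rw [Real.sqrt_le_left (by positivity), div_pow, div_le_div_iff₀ hc (by positivity)]
    nlinarith
  gcongr

/-- In the ℓ²L¹ estimate half a power of the output modulation j₀ would leave ⟨τ⟩^{-1/2}, which is
too weak. When j₀ dominates, a full power is spent instead, and the surplus is a decay in the input
frequencies. With P = cTxyz one uses P^{7/8} ≤ 3j₀ together with x^{1/8} ≤ 2(yz)^{1/8} =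
2(yz)^{-3/4}(yz)^{7/8}. Using P itself would leave no power of T; the exponent 7/8 keeps T^{1/8}.
When j₀ does not dominate, half powers of j₁ and j₂ suffice. -/
lemma resonance_bound' {c T x y z j₀ j₁ j₂ : ℝ} (hc : 0 < c) (hc1 : c ≤ 1) (hT : 0 < T)
    (hx : 0 < x) (hy : 1 ≤ y) (hz : 1 ≤ z) (hxyz : x ≤ y + z)
    (h0 : 1 ≤ j₀) (h1 : 1 ≤ j₁) (h2 : 1 ≤ j₂) (h : c * (T * (x * y * z)) ≤ j₀ + j₁ + j₂) :
    T * x ≤ 6 / c * T ^ (1 / 8 : ℝ) * (y ^ (-(3 / 4) : ℝ) * z ^ (-(3 / 4) : ℝ)) * j₀ +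
      6 / c * T ^ (1 / 2 : ℝ) * (j₁ ^ (1 / 2 : ℝ) + j₂ ^ (1 / 2 : ℝ)) := by
  have hy0 : 0 < y := by linarith
  have hz0 : 0 < z := by linarith
  have hj0 : 0 < j₀ := by linarith
  rcases le_total (j₀ + j₁ + j₂) (3 * j₀) with hS | hS
  · have hyz : x ≤ 2 * (y * z) := by nlinarith
    set P := c * (T * (x * y * z)) with hP
    have hP0 : 0 < P := by positivity
    have hP1 : P ^ (7 / 8 : ℝ) ≤ 3 * j₀ := by
      rcases le_total P 1 with hle | hle
      · exact (Real.rpow_le_one hP0.le hle (by norm_num)).trans (by linarith)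
      · calc P ^ (7 / 8 : ℝ) ≤ P ^ (1 : ℝ) :=
              Real.rpow_le_rpow_of_exponent_le hle (by norm_num)
          _ = P := Real.rpow_one P
          _ ≤ _ := h.trans hS
    have hPe : P ^ (7 / 8 : ℝ) =
        c ^ (7 / 8 : ℝ) * T ^ (7 / 8 : ℝ) * x ^ (7 / 8 : ℝ) * (y * z) ^ (7 / 8 : ℝ) := by
      rw [hP, mul_assoc x y z, Real.mul_rpow hc.le (by positivity),
        Real.mul_rpow hT.le (by positivity), Real.mul_rpow hx.le (by positivity)]
      ring
    have hcc : c ≤ c ^ (7 / 8 : ℝ) := by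
      calc c = c ^ (1 : ℝ) := (Real.rpow_one c).symm
        _ ≤ _ := Real.rpow_le_rpow_of_exponent_ge hc hc1 (by norm_num)
    have hx8 : x ^ (1 / 8 : ℝ) ≤ 2 * (y * z) ^ (1 / 8 : ℝ) := by
      calc x ^ (1 / 8 : ℝ) ≤ (2 * (y * z)) ^ (1 / 8 : ℝ) :=
            Real.rpow_le_rpow hx.le hyz (by norm_num)
        _ = 2 ^ (1 / 8 : ℝ) * (y * z) ^ (1 / 8 : ℝ) :=
            Real.mul_rpow (by norm_num) (by positivity)
        _ ≤ _ := by
            gcongr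
            calc (2 : ℝ) ^ (1 / 8 : ℝ) ≤ 2 ^ (1 : ℝ) :=
                  Real.rpow_le_rpow_of_exponent_le (by norm_num) (by norm_num)
              _ = 2 := Real.rpow_one 2
    have hT1 : T = T ^ (1 / 8 : ℝ) * T ^ (7 / 8 : ℝ) := by
      rw [← Real.rpow_add hT]; norm_num
    have hx1 : x = x ^ (1 / 8 : ℝ) * x ^ (7 / 8 : ℝ) := by
      rw [← Real.rpow_add hx]; norm_num
    have hyz1 : (y * z) ^ (1 / 8 : ℝ) = (y * z) ^ (-(3 / 4) : ℝ) * (y * z) ^ (7 / 8 : ℝ) := by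
      rw [← Real.rpow_add (by positivity)]; norm_num
    have main : T * x ≤ 6 / c * T ^ (1 / 8 : ℝ) * (y * z) ^ (-(3 / 4) : ℝ) * j₀ := by
      calc T * x = T ^ (1 / 8 : ℝ) * T ^ (7 / 8 : ℝ) * (x ^ (1 / 8 : ℝ) * x ^ (7 / 8 : ℝ)) := by
            rw [← hT1, ← hx1]
        _ ≤ T ^ (1 / 8 : ℝ) * T ^ (7 / 8 : ℝ) *
            ((2 * (y * z) ^ (1 / 8 : ℝ)) * x ^ (7 / 8 : ℝ)) := by gcongr
        _ = 2 / c * T ^ (1 / 8 : ℝ) * (y * z) ^ (-(3 / 4) : ℝ) *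
            (c * T ^ (7 / 8 : ℝ) * x ^ (7 / 8 : ℝ) * (y * z) ^ (7 / 8 : ℝ)) := by
            rw [hyz1]; field_simp
        _ ≤ 2 / c * T ^ (1 / 8 : ℝ) * (y * z) ^ (-(3 / 4) : ℝ) * (3 * j₀) := by
            refine mul_le_mul_of_nonneg_left (le_trans ?_ hP1) (by positivity)
            rw [hPe]
            gcongr
        _ = _ := by ring
    rw [← Real.mul_rpow hy0.le hz0.le]
    have : 0 ≤ 6 / c * T ^ (1 / 2 : ℝ) * (j₁ ^ (1 / 2 : ℝ) + j₂ ^ (1 / 2 : ℝ)) := by positivity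
    linarith
  · have main : T * x ≤ 6 / c * T ^ (1 / 2 : ℝ) * (j₁ ^ (1 / 2 : ℝ) + j₂ ^ (1 / 2 : ℝ)) := by
      refine (resonance_sqrt_bound hc hT hx.le hy hz hxyz h).trans ?_
      simp_rw [← Real.sqrt_eq_rpow]
      have hs : √(j₀ + j₁ + j₂) ≤ 2 * (√j₁ + √j₂) := by
        calc √(j₀ + j₁ + j₂) ≤ √(2 ^ 2 * (j₁ + j₂)) := Real.sqrt_le_sqrt (by linarith)
          _ = 2 * √(j₁ + j₂) := by
              rw [Real.sqrt_mul (by norm_num), Real.sqrt_sq (by norm_num)]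
          _ ≤ _ := by gcongr; exact sqrt_add_le_add_sqrt (by positivity) (by positivity)
      have hcc : √(2 / c) ≤ 3 / c := by
        rw [Real.sqrt_le_left (by positivity), div_pow, div_le_div_iff₀ hc (by positivity)]
        nlinarith
      calc _ ≤ 3 / c * √T * (2 * (√j₁ + √j₂)) := by gcongr
        _ = _ := by ring
    have : 0 ≤ 6 / c * T ^ (1 / 8 : ℝ) * (y ^ (-(3 / 4) : ℝ) * z ^ (-(3 / 4) : ℝ)) * j₀ := by
      positivity
    linarith

section Bilinear

variable {ι : Type*} [Fintype ι] [AddCommGroup ι] [MeasurableSpace ι] [DiscreteMeasurableSpace ι]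

open Classical in
/-- The weight `|k|^{-3/4}` on nonzero frequencies. -/
noncomputable def smoothWt (r : ι → ℝ) (k : ι) : ℝ≥0∞ :=
  if k = 0 then 0 else ENNReal.ofReal (r k ^ (-(3 / 4) : ℝ))

/-- Frequencies with sizes `r` and a resonance function `Θ` (in the time scale `T`) satisfying the
lower bound `|Θ| ≥ c T |k k₁ k₂|` and counting bounds with constant `B`. -/
structure IsResonant (c T : ℝ) (B D : ℝ≥0∞) (r : ι → ℝ) (Θ : ι → ι → ℝ) : Prop where
  pos : 0 < c
  le_one : c ≤ 1
  time_pos : 0 < T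
  nonneg : ∀ k, 0 ≤ r k
  one_le : ∀ k, k ≠ 0 → 1 ≤ r k
  triangle : ∀ k k₁, r k ≤ r k₁ + r (k - k₁)
  lower : ∀ k k₁, k ≠ 0 → k₁ ≠ 0 → k ≠ k₁ → c * (T * (r k * r k₁ * r (k - k₁))) ≤ |Θ k k₁|
  sum_le : ∑ k, smoothWt r k ^ 2 ≤ D
  count : CountBound B Θ

variable {c T : ℝ} {B D : ℝ≥0∞} {r : ι → ℝ} {Θ : ι → ι → ℝ}

lemma IsResonant.smoothWt_le_one (h : IsResonant c T B D r Θ) (k : ι) : smoothWt r k ≤ 1 := by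
  unfold smoothWt
  split_ifs with hk
  · exact zero_le_one
  · rw [ENNReal.ofReal_le_one]
    exact Real.rpow_le_one_of_one_le_of_nonpos (h.one_le k hk) (by norm_num)

lemma nonzeroInd_mul_le {k k₁ : ι} {a b : ℝ≥0∞} (h : k ≠ 0 → k₁ ≠ 0 → k ≠ k₁ → a ≤ b) :
    nonzeroInd k k₁ * a ≤ nonzeroInd k k₁ * b := by
  unfold nonzeroInd
  split_ifs with h0
  · simp
  · push Not at h0
    simpa using h h0.1 h0.2.1 h0.2.2

/-- The resonance function is the output modulation l minus the two input modulations, so the three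
of them control |Θ|. -/
lemma IsResonant.one_add_abs_bound (h : IsResonant c T B D r Θ) {k k₁ : ι} (l τ : ℝ)
    (hk : k ≠ 0) (hk₁ : k₁ ≠ 0) (hkk : k ≠ k₁) :
    c * (T * (r k * r k₁ * r (k - k₁))) ≤ (1 + |l|) + (1 + |τ|) + (1 + |l - Θ k k₁ - τ|) := by
  refine (h.lower k k₁ hk hk₁ hkk).trans ?_
  have e : Θ k k₁ = l - τ - (l - Θ k k₁ - τ) := by ring
  have h1 := abs_sub (l - τ) (l - Θ k k₁ - τ)
  have h2 := abs_sub l τ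
  rw [← e] at h1
  linarith

lemma IsResonant.mul_le (h : IsResonant c T B D r Θ) (k k₁ : ι) (l τ : ℝ) :
    nonzeroInd k k₁ * ENNReal.ofReal (T * r k) ≤
      nonzeroInd k k₁ * (ENNReal.ofReal (6 / c * T ^ (1 / 2 : ℝ)) *
        (wt l ^ (1 / 2 : ℝ) + wt τ ^ (1 / 2 : ℝ) + wt (l - Θ k k₁ - τ) ^ (1 / 2 : ℝ))) := by
  have hc := h.pos
  have hT := h.time_pos
  refine nonzeroInd_mul_le fun hk hk₁ hkk => ?_
  simp_rw [wt_rpow]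
  rw [← ENNReal.ofReal_add (by positivity) (by positivity),
    ← ENNReal.ofReal_add (by positivity) (by positivity), ← ENNReal.ofReal_mul (by positivity)]
  exact ENNReal.ofReal_le_ofReal (resonance_bound hc h.le_one h.time_pos (h.nonneg k)
    (h.one_le k₁ hk₁) (h.one_le _ (sub_ne_zero.2 hkk)) (h.triangle k k₁)
    (by linarith [abs_nonneg l]) (by linarith [abs_nonneg τ])
    (by linarith [abs_nonneg (l - Θ k k₁ - τ)]) (h.one_add_abs_bound l τ hk hk₁ hkk))

lemma IsResonant.mul_le' (h : IsResonant c T B D r Θ) (k k₁ : ι) (l τ : ℝ) :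
    nonzeroInd k k₁ * ENNReal.ofReal (T * r k) ≤
      nonzeroInd k k₁ * (ENNReal.ofReal (6 / c * T ^ (1 / 8 : ℝ)) *
        (smoothWt r k₁ * smoothWt r (k - k₁)) * wt l ^ (1 : ℝ) +
        ENNReal.ofReal (6 / c * T ^ (1 / 2 : ℝ)) *
        (wt τ ^ (1 / 2 : ℝ) + wt (l - Θ k k₁ - τ) ^ (1 / 2 : ℝ))) := by
  have hc := h.pos
  have hT := h.time_pos
  refine nonzeroInd_mul_le fun hk hk₁ hkk => ?_
  have hk₂ : k - k₁ ≠ 0 := sub_ne_zero.2 hkk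
  have p1 : 0 < r k₁ := zero_lt_one.trans_le (h.one_le k₁ hk₁)
  have p2 : 0 < r (k - k₁) := zero_lt_one.trans_le (h.one_le _ hk₂)
  simp only [smoothWt, if_neg hk₁, if_neg hk₂, wt_rpow]
  rw [← ENNReal.ofReal_mul (by positivity), ← ENNReal.ofReal_mul (by positivity),
    ← ENNReal.ofReal_mul (by positivity), ← ENNReal.ofReal_add (by positivity) (by positivity),
    ← ENNReal.ofReal_mul (by positivity), ← ENNReal.ofReal_add (by positivity) (by positivity),
    Real.rpow_one]
  exact ENNReal.ofReal_le_ofReal (resonance_bound' hc h.le_one h.time_pos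
    (zero_lt_one.trans_le (h.one_le k hk))
    (h.one_le k₁ hk₁) (h.one_le _ hk₂) (h.triangle k k₁)
    (by linarith [abs_nonneg l]) (by linarith [abs_nonneg τ])
    (by linarith [abs_nonneg (l - Θ k k₁ - τ)]) (h.one_add_abs_bound l τ hk hk₁ hkk))

/-- The square of the (interaction picture) `Y`-norm. -/
noncomputable def ySq (U : ι × ℝ → ℝ≥0∞) : ℝ≥0∞ :=
  ∫⁻ p, wt p.2 * U p ^ 2 ∂(specMeasure ι) + ∑ k, (∫⁻ x, U (k, x)) ^ 2

/-- `T |k|` times the resonant convolution. -/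
noncomputable def majConv (T : ℝ) (r : ι → ℝ) (Θ : ι → ι → ℝ) (U V : ι × ℝ → ℝ≥0∞) (p : ι × ℝ) :
    ℝ≥0∞ :=
  ENNReal.ofReal (T * r p.1) * resConv Θ U V p

lemma measurable_majConv {U V : ι × ℝ → ℝ≥0∞} (hU : Measurable U) (hV : Measurable V) :
    Measurable (majConv T r Θ U V) := by
  unfold majConv
  exact ((Measurable.of_discrete (f := fun k : ι => ENNReal.ofReal (T * r k))).comp
    measurable_fst).mul (measurable_resConv Θ hU hV)

lemma measurable_resConv_integrand {U V : ι × ℝ → ℝ≥0∞} (hU : Measurable U) (hV : Measurable V)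
    (p : ι × ℝ) : Measurable fun q : ι × ℝ =>
      nonzeroInd p.1 q.1 * (U q * V (p.1 - q.1, p.2 - Θ p.1 q.1 - q.2)) :=
  (measurable_nonzeroInd.mul ((hU.comp measurable_snd).mul (hV.comp (measurable_shift Θ)))).comp
    measurable_prodMk_left

lemma IsResonant.majConv_le (h : IsResonant c T B D r Θ) {U V : ι × ℝ → ℝ≥0∞}
    (hU : Measurable U) (hV : Measurable V) (p : ι × ℝ) :
    majConv T r Θ U V p ≤ ENNReal.ofReal (6 / c * T ^ (1 / 2 : ℝ)) *
      (wt p.2 ^ (1 / 2 : ℝ) * resConv Θ U V p +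
        resConv Θ (fun q => wt q.2 ^ (1 / 2 : ℝ) * U q) V p +
        resConv Θ U (fun q => wt q.2 ^ (1 / 2 : ℝ) * V q) p) := by
  have hU' : Measurable fun q : ι × ℝ => wt q.2 ^ (1 / 2 : ℝ) * U q := by fun_prop
  have hV' : Measurable fun q : ι × ℝ => wt q.2 ^ (1 / 2 : ℝ) * V q := by fun_prop
  unfold majConv resConv
  have m0 := measurable_resConv_integrand (Θ := Θ) hU hV p
  have m1 := measurable_resConv_integrand (Θ := Θ) hU' hV p
  have m2 := measurable_resConv_integrand (Θ := Θ) hU hV' p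
  rw [← lintegral_const_mul _ m0, ← lintegral_const_mul _ m0,
    ← lintegral_add_left (m0.const_mul _), ← lintegral_add_right _ m2,
    ← lintegral_const_mul' _ _ ENNReal.ofReal_ne_top]
  refine lintegral_mono fun q => ?_
  calc _ = (nonzeroInd p.1 q.1 * ENNReal.ofReal (T * r p.1)) *
        (U q * V (p.1 - q.1, p.2 - Θ p.1 q.1 - q.2)) := by ring
    _ ≤ _ := mul_le_mul_left (h.mul_le p.1 q.1 p.2 q.2) _
    _ = _ := by ring

/-- The full power of the output weight granted by `IsResonant.mul_le'` cancels ⟨l⟩^{-1} exactly.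
What remains is an unweighted convolution of inputs smoothed by |k|^{-3/4}. -/
lemma IsResonant.wt_mul_majConv_le (h : IsResonant c T B D r Θ) {U V : ι × ℝ → ℝ≥0∞}
    (hU : Measurable U) (hV : Measurable V) (p : ι × ℝ) :
    wt p.2 ^ (-1 : ℝ) * majConv T r Θ U V p ≤ ENNReal.ofReal (6 / c * T ^ (1 / 8 : ℝ)) *
      resConv Θ (fun q => smoothWt r q.1 * U q) (fun q => smoothWt r q.1 * V q) p +
      ENNReal.ofReal (6 / c * T ^ (1 / 2 : ℝ)) *
      (wt p.2 ^ (-1 : ℝ) * resConv Θ (fun q => wt q.2 ^ (1 / 2 : ℝ) * U q) V p +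
        wt p.2 ^ (-1 : ℝ) * resConv Θ U (fun q => wt q.2 ^ (1 / 2 : ℝ) * V q) p) := by
  have hs : Measurable fun q : ι × ℝ => smoothWt r q.1 :=
    (Measurable.of_discrete (f := smoothWt r)).comp measurable_fst
  have hU' : Measurable fun q : ι × ℝ => wt q.2 ^ (1 / 2 : ℝ) * U q := by fun_prop
  have hV' : Measurable fun q : ι × ℝ => wt q.2 ^ (1 / 2 : ℝ) * V q := by fun_prop
  unfold majConv resConv
  have m0 := measurable_resConv_integrand (Θ := Θ) hU hV p
  have ms := measurable_resConv_integrand (Θ := Θ) (hs.mul hU) (hs.mul hV) p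
  have m1 := measurable_resConv_integrand (Θ := Θ) hU' hV p
  have m2 := measurable_resConv_integrand (Θ := Θ) hU hV' p
  simp only [Pi.mul_apply] at ms
  rw [← lintegral_const_mul _ m0, ← lintegral_const_mul _ (m0.const_mul _),
    ← lintegral_const_mul _ ms, ← lintegral_const_mul _ m1, ← lintegral_const_mul _ m2,
    ← lintegral_add_left (m1.const_mul _),
    ← lintegral_const_mul' (ENNReal.ofReal (6 / c * T ^ (1 / 2 : ℝ))) _ ENNReal.ofReal_ne_top,
    ← lintegral_add_left (ms.const_mul _)]
  refine lintegral_mono fun q => ?_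
  calc _ = wt p.2 ^ (-1 : ℝ) * (nonzeroInd p.1 q.1 * ENNReal.ofReal (T * r p.1)) *
        (U q * V (p.1 - q.1, p.2 - Θ p.1 q.1 - q.2)) := by ring
    _ ≤ _ := mul_le_mul_left (mul_le_mul_right (h.mul_le' p.1 q.1 p.2 q.2) _) _
    _ = (wt p.2 ^ (-1 : ℝ) * wt p.2 ^ (1 : ℝ)) * (ENNReal.ofReal (6 / c * T ^ (1 / 8 : ℝ)) *
          (nonzeroInd p.1 q.1 * (smoothWt r q.1 * U q *
          (smoothWt r (p.1 - q.1) * V (p.1 - q.1, p.2 - Θ p.1 q.1 - q.2))))) +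
        ENNReal.ofReal (6 / c * T ^ (1 / 2 : ℝ)) * (wt p.2 ^ (-1 : ℝ) * (nonzeroInd p.1 q.1 *
          (wt q.2 ^ (1 / 2 : ℝ) * U q * V (p.1 - q.1, p.2 - Θ p.1 q.1 - q.2))) +
          wt p.2 ^ (-1 : ℝ) * (nonzeroInd p.1 q.1 * (U q * (wt (p.2 - Θ p.1 q.1 - q.2) ^ (1 / 2 : ℝ)
          * V (p.1 - q.1, p.2 - Θ p.1 q.1 - q.2))))) := by ring
    _ = _ := by rw [wt_rpow_cancel, one_mul]

end Bilinear

end PeriodicFPU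

/-! ### The bilinear estimate in X^{0,-1/2} and in ℓ²L¹. -/

namespace PeriodicFPU

set_option linter.unusedSectionVars false

section Bilinear

variable {ι : Type*} [Fintype ι] [AddCommGroup ι] [MeasurableSpace ι] [DiscreteMeasurableSpace ι]
variable {c T : ℝ} {B D : ℝ≥0∞} {r : ι → ℝ} {Θ : ι → ι → ℝ}

lemma lintegral_wt_half_mul_sq (U : ι × ℝ → ℝ≥0∞) :
    ∫⁻ p, (wt p.2 ^ (1 / 2 : ℝ) * U p) ^ 2 ∂(specMeasure ι) =
      ∫⁻ p, wt p.2 * U p ^ 2 ∂(specMeasure ι) := by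
  refine lintegral_congr fun p => ?_
  rw [mul_pow, wt_rpow_sq]
  norm_num

lemma lintegral_wt_resConv_half_fst (h : CountBound B Θ) {U V : ι × ℝ → ℝ≥0∞}
    (hU : Measurable U) (hV : Measurable V) :
    ∫⁻ p, wt p.2 ^ (-(3 / 4) : ℝ) *
        resConv Θ (fun q => wt q.2 ^ (1 / 2 : ℝ) * U q) V p ^ 2 ∂(specMeasure ι) ≤
      4 * wtInt (9 / 8) * B *
      ((∫⁻ p, wt p.2 * U p ^ 2 ∂(specMeasure ι)) * ∫⁻ p, wt p.2 * V p ^ 2 ∂(specMeasure ι)) := by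
  rw [← lintegral_wt_half_mul_sq U]
  exact lintegral_wt_resConv_sq_le h (by fun_prop) hV

lemma lintegral_wt_resConv_half_snd (h : CountBound B Θ) {U V : ι × ℝ → ℝ≥0∞}
    (hU : Measurable U) (hV : Measurable V) :
    ∫⁻ p, wt p.2 ^ (-(3 / 4) : ℝ) *
        resConv Θ U (fun q => wt q.2 ^ (1 / 2 : ℝ) * V q) p ^ 2 ∂(specMeasure ι) ≤
      4 * wtInt (9 / 8) * B *
      ((∫⁻ p, wt p.2 * U p ^ 2 ∂(specMeasure ι)) * ∫⁻ p, wt p.2 * V p ^ 2 ∂(specMeasure ι)) := by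
  rw [← lintegral_wt_half_mul_sq V]
  exact lintegral_wt_resConv_sq_le' h hU (by fun_prop)

/-- The `X^{0,-1/2}` part of the bilinear estimate. -/
lemma IsResonant.lintegral_majConv_sq_le (h : IsResonant c T B D r Θ) {U V : ι × ℝ → ℝ≥0∞}
    (hU : Measurable U) (hV : Measurable V) :
    ∫⁻ p, wt p.2 ^ (-1 : ℝ) * majConv T r Θ U V p ^ 2 ∂(specMeasure ι) ≤
      48 * ENNReal.ofReal (6 / c * T ^ (1 / 2 : ℝ)) ^ 2 * (4 * wtInt (9 / 8) * B) *
        ((∫⁻ p, wt p.2 * U p ^ 2 ∂(specMeasure ι)) *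
          ∫⁻ p, wt p.2 * V p ^ 2 ∂(specMeasure ι)) := by
  set K := ENNReal.ofReal (6 / c * T ^ (1 / 2 : ℝ))
  have hU' : Measurable fun q : ι × ℝ => wt q.2 ^ (1 / 2 : ℝ) * U q := by fun_prop
  have hV' : Measurable fun q : ι × ℝ => wt q.2 ^ (1 / 2 : ℝ) * V q := by fun_prop
  have m0 := measurable_resConv Θ hU hV
  have m1 := measurable_resConv Θ hU' hV
  have m2 := measurable_resConv Θ hU hV'
  calc _ ≤ ∫⁻ p, 16 * K ^ 2 * (resConv Θ U V p ^ 2 +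
        wt p.2 ^ (-(3 / 4) : ℝ) * resConv Θ (fun q => wt q.2 ^ (1 / 2 : ℝ) * U q) V p ^ 2 +
        wt p.2 ^ (-(3 / 4) : ℝ) * resConv Θ U (fun q => wt q.2 ^ (1 / 2 : ℝ) * V q) p ^ 2)
        ∂(specMeasure ι) := by
        refine lintegral_mono fun p => ?_
        calc _ ≤ wt p.2 ^ (-1 : ℝ) * (K * (wt p.2 ^ (1 / 2 : ℝ) * resConv Θ U V p +
              resConv Θ (fun q => wt q.2 ^ (1 / 2 : ℝ) * U q) V p +
              resConv Θ U (fun q => wt q.2 ^ (1 / 2 : ℝ) * V q) p)) ^ 2 := by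
              gcongr
              exact h.majConv_le hU hV p
          _ ≤ wt p.2 ^ (-1 : ℝ) * (K ^ 2 * (16 * ((wt p.2 ^ (1 / 2 : ℝ) * resConv Θ U V p) ^ 2 +
              resConv Θ (fun q => wt q.2 ^ (1 / 2 : ℝ) * U q) V p ^ 2 +
              resConv Θ U (fun q => wt q.2 ^ (1 / 2 : ℝ) * V q) p ^ 2))) := by
              rw [mul_pow]
              gcongr
              exact ennreal_add_add_sq_le _ _ _
          _ = 16 * K ^ 2 * ((wt p.2 ^ (-1 : ℝ) * wt p.2 ^ (1 : ℝ)) * resConv Θ U V p ^ 2 +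
              wt p.2 ^ (-1 : ℝ) * resConv Θ (fun q => wt q.2 ^ (1 / 2 : ℝ) * U q) V p ^ 2 +
              wt p.2 ^ (-1 : ℝ) * resConv Θ U (fun q => wt q.2 ^ (1 / 2 : ℝ) * V q) p ^ 2) := by
              rw [mul_pow, wt_rpow_sq]
              norm_num
              ring
          _ ≤ _ := by
              rw [wt_rpow_cancel, one_mul]
              -- The duality bounds control the larger weight with exponent -3/4; here -1 is enough.
              have hw : wt p.2 ^ (-1 : ℝ) ≤ wt p.2 ^ (-(3 / 4) : ℝ) :=
                wt_rpow_le_rpow _ (by norm_num)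
              gcongr
    _ ≤ 16 * K ^ 2 * (4 * wtInt (9 / 8) * B * ((∫⁻ p, wt p.2 * U p ^ 2 ∂(specMeasure ι)) *
          ∫⁻ p, wt p.2 * V p ^ 2 ∂(specMeasure ι)) +
        4 * wtInt (9 / 8) * B * ((∫⁻ p, wt p.2 * U p ^ 2 ∂(specMeasure ι)) *
          ∫⁻ p, wt p.2 * V p ^ 2 ∂(specMeasure ι)) +
        4 * wtInt (9 / 8) * B * ((∫⁻ p, wt p.2 * U p ^ 2 ∂(specMeasure ι)) *
          ∫⁻ p, wt p.2 * V p ^ 2 ∂(specMeasure ι))) := by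
        rw [lintegral_const_mul _ (by fun_prop), lintegral_add_left (by fun_prop),
          lintegral_add_left (by fun_prop)]
        gcongr
        · exact lintegral_resConv_sq_le h.count hU hV
        · exact lintegral_wt_resConv_half_fst h.count hU hV
        · exact lintegral_wt_resConv_half_snd h.count hU hV
    _ = _ := by ring

/-- For L¹ norms in τ the shift by Θ is invisible: Fubini and translation invariance leave a plain
convolution in frequency, and the restriction to nonzero modes is dropped. -/
lemma lintegral_resConv_le {U V : ι × ℝ → ℝ≥0∞} (hU : Measurable U) (hV : Measurable V) (k : ι) :
    ∫⁻ x, resConv Θ U V (k, x) ≤ ∑ k₁, (∫⁻ x, U (k₁, x)) * ∫⁻ x, V (k - k₁, x) := by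
  have hm : Measurable fun z : ℝ × (ι × ℝ) =>
      U z.2 * V (k - z.2.1, z.1 - Θ k z.2.1 - z.2.2) :=
    (hU.comp measurable_snd).mul (hV.comp ((measurable_shift Θ).comp
      ((measurable_const.prodMk measurable_fst).prodMk measurable_snd)))
  calc _ ≤ ∫⁻ x, ∫⁻ q, U q * V (k - q.1, x - Θ k q.1 - q.2) ∂(specMeasure ι) := by
        refine lintegral_mono fun x => lintegral_mono fun q => ?_
        exact mul_le_of_le_one_left' (nonzeroInd_le_one _ _)
    _ = ∫⁻ q, U q * (∫⁻ x, V (k - q.1, x)) ∂(specMeasure ι) := by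
        rw [lintegral_lintegral_swap hm.aemeasurable]
        refine lintegral_congr fun q => ?_
        have hv : Measurable fun x : ℝ => V (k - q.1, x) := hV.comp measurable_prodMk_left
        simp only [sub_sub]
        have hv' : Measurable fun x : ℝ => V (k - q.1, x - (Θ k q.1 + q.2)) :=
          hv.comp (measurable_id.sub_const _)
        rw [lintegral_const_mul (U q) hv']
        congr 1
        exact lintegral_sub_right_eq_self (μ := volume) (fun x => V (k - q.1, x)) _
    _ = _ := by
        have hv : Measurable fun j : ι => ∫⁻ x, V (k - j, x) := Measurable.of_discrete
        have hUv : Measurable fun q : ι × ℝ => U q * ∫⁻ x, V (k - q.1, x) :=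
          hU.mul (hv.comp measurable_fst)
        rw [lintegral_specMeasure hUv]
        refine Finset.sum_congr rfl fun k₁ _ => ?_
        have hUk : Measurable fun x : ℝ => U (k₁, x) := hU.comp measurable_prodMk_left
        exact lintegral_mul_const (∫⁻ x, V (k - k₁, x)) hUk

lemma sum_mul_sq_le (a b : ι → ℝ≥0∞) : (∑ k, a k * b k) ^ 2 ≤ (∑ k, a k ^ 2) * ∑ k, b k ^ 2 := by
  have h := lintegral_mul_sq_le (μ := (Measure.count : Measure ι)) (f := a) (g := b)
    Measurable.of_discrete.aemeasurable Measurable.of_discrete.aemeasurable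
  simpa only [lintegral_count, tsum_fintype] using h

/-- Young's inequality ℓ¹ * ℓ² → ℓ², by Cauchy-Schwarz with the weight a split into two square
roots. -/
lemma sum_conv_sq_le (a b : ι → ℝ≥0∞) :
    ∑ k, (∑ k₁, a k₁ * b (k - k₁)) ^ 2 ≤ (∑ k, a k) ^ 2 * ∑ k, b k ^ 2 := by
  have h2 : ∀ x : ℝ≥0∞, (x ^ (1 / 2 : ℝ)) ^ 2 = x := fun x => by
    rw [← ENNReal.rpow_natCast, ← ENNReal.rpow_mul]; norm_num
  calc _ ≤ ∑ k, (∑ k₁, a k₁) * ∑ k₁, a k₁ * b (k - k₁) ^ 2 := by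
        refine Finset.sum_le_sum fun k _ => ?_
        have := sum_mul_sq_le (fun k₁ => a k₁ ^ (1 / 2 : ℝ))
          (fun k₁ => a k₁ ^ (1 / 2 : ℝ) * b (k - k₁))
        simp only [mul_pow, h2, ← mul_assoc, ← sq] at this
        simpa only [h2] using this
    _ = (∑ k₁, a k₁) * ∑ k₁, a k₁ * ∑ k, b (k - k₁) ^ 2 := by
        rw [← Finset.mul_sum, Finset.sum_comm]
        simp_rw [Finset.mul_sum]
    _ = _ := by
        have : ∀ k₁, ∑ k, b (k - k₁) ^ 2 = ∑ k, b k ^ 2 := fun k₁ =>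
          Equiv.sum_comp (Equiv.subRight k₁) fun k => b k ^ 2
        simp_rw [this]
        rw [← Finset.sum_mul]
        ring

/-- One smoothing weight puts the first factor in ℓ¹, as |k|^{-3/4} is square summable with sum of
squares at most D. The other is bounded by 1, and Young's inequality applies. -/
lemma IsResonant.sum_lintegral_resConv_sq_le (h : IsResonant c T B D r Θ) {U V : ι × ℝ → ℝ≥0∞}
    (hU : Measurable U) (hV : Measurable V) :
    ∑ k, (∫⁻ x, resConv Θ (fun q => smoothWt r q.1 * U q) (fun q => smoothWt r q.1 * V q)
      (k, x)) ^ 2 ≤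
      D * ((∑ k, (∫⁻ x, U (k, x)) ^ 2) * ∑ k, (∫⁻ x, V (k, x)) ^ 2) := by
  have hs : Measurable fun q : ι × ℝ => smoothWt r q.1 :=
    (Measurable.of_discrete (f := smoothWt r)).comp measurable_fst
  have hm : ∀ {U : ι × ℝ → ℝ≥0∞}, Measurable U → ∀ k, Measurable fun x : ℝ => U (k, x) :=
    fun hU k => hU.comp measurable_prodMk_left
  calc _ ≤ ∑ k, (∑ k₁, (smoothWt r k₁ * ∫⁻ x, U (k₁, x)) * (∫⁻ x, V (k - k₁, x))) ^ 2 := by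
        refine Finset.sum_le_sum fun k _ => ?_
        gcongr
        refine (lintegral_resConv_le (hs.mul hU) (hs.mul hV) k).trans ?_
        refine Finset.sum_le_sum fun k₁ _ => ?_
        simp only [Pi.mul_apply]
        rw [lintegral_const_mul _ (hm hU k₁)]
        gcongr with x
        exact mul_le_of_le_one_left' (h.smoothWt_le_one _)
    _ ≤ (∑ k, smoothWt r k * ∫⁻ x, U (k, x)) ^ 2 * ∑ k, (∫⁻ x, V (k, x)) ^ 2 :=
        sum_conv_sq_le _ _
    _ ≤ (D * ∑ k, (∫⁻ x, U (k, x)) ^ 2) * ∑ k, (∫⁻ x, V (k, x)) ^ 2 := by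
        gcongr
        refine (sum_mul_sq_le _ _).trans ?_
        gcongr
        exact h.sum_le
    _ = _ := mul_assoc _ _ _

/-- Splitting ⟨x⟩^{-1} = ⟨x⟩^{-5/8}⟨x⟩^{-3/8} in Cauchy-Schwarz: ⟨x⟩^{-5/4} is integrable, and
⟨x⟩^{-3/4} is the weight controlled by the duality bounds. -/
lemma sum_lintegral_wt_sq_le {F : ι × ℝ → ℝ≥0∞} (hF : Measurable F) :
    ∑ k, (∫⁻ x, wt x ^ (-1 : ℝ) * F (k, x)) ^ 2 ≤
      wtInt (5 / 4) * ∫⁻ p, wt p.2 ^ (-(3 / 4) : ℝ) * F p ^ 2 ∂(specMeasure ι) := by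
  rw [lintegral_specMeasure (by fun_prop), Finset.mul_sum]
  refine Finset.sum_le_sum fun k _ => ?_
  have hFk : Measurable fun x : ℝ => F (k, x) := hF.comp measurable_prodMk_left
  have := lintegral_mul_sq_le (μ := volume) (f := fun x => wt x ^ (-(5 / 8) : ℝ))
    (g := fun x => wt x ^ (-(3 / 8) : ℝ) * F (k, x)) (by fun_prop) (by fun_prop)
  simp only [mul_pow, wt_rpow_sq, ← mul_assoc, wt_rpow_mul_rpow] at this
  norm_num at this
  simpa [wtInt] using this

/-- The `ℓ²L¹` part of the bilinear estimate. -/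
lemma IsResonant.sum_lintegral_majConv_sq_le (h : IsResonant c T B D r Θ) {U V : ι × ℝ → ℝ≥0∞}
    (hU : Measurable U) (hV : Measurable V) :
    ∑ k, (∫⁻ x, wt x ^ (-1 : ℝ) * majConv T r Θ U V (k, x)) ^ 2 ≤
      16 * (ENNReal.ofReal (6 / c * T ^ (1 / 8 : ℝ)) ^ 2 * D +
        2 * ENNReal.ofReal (6 / c * T ^ (1 / 2 : ℝ)) ^ 2 * wtInt (5 / 4) *
          (4 * wtInt (9 / 8) * B)) * (ySq U * ySq V) := by
  set K := ENNReal.ofReal (6 / c * T ^ (1 / 2 : ℝ))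
  set K' := ENNReal.ofReal (6 / c * T ^ (1 / 8 : ℝ))
  have hs : Measurable fun q : ι × ℝ => smoothWt r q.1 :=
    (Measurable.of_discrete (f := smoothWt r)).comp measurable_fst
  have hU' : Measurable fun q : ι × ℝ => wt q.2 ^ (1 / 2 : ℝ) * U q := by fun_prop
  have hV' : Measurable fun q : ι × ℝ => wt q.2 ^ (1 / 2 : ℝ) * V q := by fun_prop
  set N₀ := resConv Θ (fun q => smoothWt r q.1 * U q) (fun q => smoothWt r q.1 * V q)
  set N₁ := resConv Θ (fun q => wt q.2 ^ (1 / 2 : ℝ) * U q) V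
  set N₂ := resConv Θ U (fun q => wt q.2 ^ (1 / 2 : ℝ) * V q)
  have m0 : Measurable N₀ := measurable_resConv Θ (hs.mul hU) (hs.mul hV)
  have m1 : Measurable N₁ := measurable_resConv Θ hU' hV
  have m2 : Measurable N₂ := measurable_resConv Θ hU hV'
  have hL2 : ∀ U : ι × ℝ → ℝ≥0∞, ∫⁻ p, wt p.2 * U p ^ 2 ∂(specMeasure ι) ≤ ySq U :=
    fun U => le_self_add
  have hL1 : ∀ U : ι × ℝ → ℝ≥0∞, ∑ k, (∫⁻ x, U (k, x)) ^ 2 ≤ ySq U := fun U => le_add_self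
  have b0 : ∑ k, (∫⁻ x, N₀ (k, x)) ^ 2 ≤ D * (ySq U * ySq V) :=
    (h.sum_lintegral_resConv_sq_le hU hV).trans
      (mul_le_mul' le_rfl (mul_le_mul' (hL1 U) (hL1 V)))
  have b1 : ∑ k, (∫⁻ x, wt x ^ (-1 : ℝ) * N₁ (k, x)) ^ 2 ≤
      wtInt (5 / 4) * (4 * wtInt (9 / 8) * B * (ySq U * ySq V)) :=
    (sum_lintegral_wt_sq_le m1).trans (mul_le_mul' le_rfl
      ((lintegral_wt_resConv_half_fst h.count hU hV).trans
        (mul_le_mul' le_rfl (mul_le_mul' (hL2 U) (hL2 V)))))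
  have b2 : ∑ k, (∫⁻ x, wt x ^ (-1 : ℝ) * N₂ (k, x)) ^ 2 ≤
      wtInt (5 / 4) * (4 * wtInt (9 / 8) * B * (ySq U * ySq V)) :=
    (sum_lintegral_wt_sq_le m2).trans (mul_le_mul' le_rfl
      ((lintegral_wt_resConv_half_snd h.count hU hV).trans
        (mul_le_mul' le_rfl (mul_le_mul' (hL2 U) (hL2 V)))))
  calc _ ≤ ∑ k, 16 * (K' ^ 2 * (∫⁻ x, N₀ (k, x)) ^ 2 +
        K ^ 2 * (∫⁻ x, wt x ^ (-1 : ℝ) * N₁ (k, x)) ^ 2 +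
        K ^ 2 * (∫⁻ x, wt x ^ (-1 : ℝ) * N₂ (k, x)) ^ 2) := by
        refine Finset.sum_le_sum fun k _ => ?_
        rw [← mul_pow, ← mul_pow, ← mul_pow]
        refine le_trans ?_ (ennreal_add_add_sq_le _ _ _)
        gcongr
        have n0 : Measurable fun x : ℝ => N₀ (k, x) := m0.comp measurable_prodMk_left
        have n1 : Measurable fun x : ℝ => wt x ^ (-1 : ℝ) * N₁ (k, x) :=
          Measurable.mul (by fun_prop) (m1.comp measurable_prodMk_left)
        rw [← lintegral_const_mul' _ _ ENNReal.ofReal_ne_top,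
          ← lintegral_const_mul' _ _ ENNReal.ofReal_ne_top,
          ← lintegral_const_mul' _ _ ENNReal.ofReal_ne_top,
          ← lintegral_add_left (n0.const_mul _),
          ← lintegral_add_left (by fun_prop)]
        refine lintegral_mono fun x => ?_
        have := h.wt_mul_majConv_le hU hV (k, x)
        rw [mul_add, ← add_assoc] at this
        exact this
    _ = 16 * (K' ^ 2 * ∑ k, (∫⁻ x, N₀ (k, x)) ^ 2 +
        K ^ 2 * ∑ k, (∫⁻ x, wt x ^ (-1 : ℝ) * N₁ (k, x)) ^ 2 +
        K ^ 2 * ∑ k, (∫⁻ x, wt x ^ (-1 : ℝ) * N₂ (k, x)) ^ 2) := by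
        simp only [← Finset.mul_sum, Finset.sum_add_distrib]
    _ ≤ 16 * (K' ^ 2 * (D * (ySq U * ySq V)) +
        K ^ 2 * (wtInt (5 / 4) * (4 * wtInt (9 / 8) * B * (ySq U * ySq V))) +
        K ^ 2 * (wtInt (5 / 4) * (4 * wtInt (9 / 8) * B * (ySq U * ySq V)))) := by gcongr
    _ = _ := by ring

/-- The square of the norm of Duhamel source terms. -/
noncomputable def zSq (F : ι × ℝ → ℝ≥0∞) : ℝ≥0∞ :=
  ∫⁻ p, wt p.2 ^ (-1 : ℝ) * F p ^ 2 ∂(specMeasure ι) +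
    ∑ k, (∫⁻ x, wt x ^ (-1 : ℝ) * F (k, x)) ^ 2

/-- The constant of the bilinear estimate. -/
noncomputable def bilConst (c T : ℝ) (B D : ℝ≥0∞) : ℝ≥0∞ :=
  48 * ENNReal.ofReal (6 / c * T ^ (1 / 2 : ℝ)) ^ 2 * (4 * wtInt (9 / 8) * B) +
  16 * (ENNReal.ofReal (6 / c * T ^ (1 / 8 : ℝ)) ^ 2 * D +
    2 * ENNReal.ofReal (6 / c * T ^ (1 / 2 : ℝ)) ^ 2 * wtInt (5 / 4) * (4 * wtInt (9 / 8) * B))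

/-- The bilinear estimate. -/
lemma IsResonant.zSq_majConv_le (h : IsResonant c T B D r Θ) {U V : ι × ℝ → ℝ≥0∞}
    (hU : Measurable U) (hV : Measurable V) :
    zSq (majConv T r Θ U V) ≤ bilConst c T B D * (ySq U * ySq V) := by
  unfold bilConst
  rw [add_mul]
  refine add_le_add ((h.lintegral_majConv_sq_le hU hV).trans ?_)
    (h.sum_lintegral_majConv_sq_le hU hV)
  gcongr <;> exact le_self_add

/-! ### Boundedness of the truncated Duhamel operator. -/

/-- The majorant of the kernel of the truncated Duhamel operator. -/
noncomputable def duhamelMaj (C : ℝ≥0∞) (F : ι × ℝ → ℝ≥0∞) (p : ι × ℝ) : ℝ≥0∞ :=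
  ∫⁻ l, C * (wt l ^ (-1 : ℝ) * (wt (p.2 - l) ^ (-3 : ℝ) + wt p.2 ^ (-3 : ℝ))) * F (p.1, l)

lemma measurable_duhamelMaj (C : ℝ≥0∞) {F : ι × ℝ → ℝ≥0∞} (hF : Measurable F) :
    Measurable (duhamelMaj C F) := by
  unfold duhamelMaj
  refine Measurable.lintegral_prod_right' (f := fun z : (ι × ℝ) × ℝ => C * (wt z.2 ^ (-1 : ℝ) *
    (wt (z.1.2 - z.2) ^ (-3 : ℝ) + wt z.1.2 ^ (-3 : ℝ))) * F (z.1.1, z.2)) ?_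
  fun_prop

/-- The constant of the truncated Duhamel estimate. -/
noncomputable def duhamelConst (C : ℝ≥0∞) : ℝ≥0∞ :=
  4 * C ^ 2 * (wtInt 3 * wtInt 2 + wtInt 5 + wtInt 3 ^ 2)

lemma duhamelMaj_eq (C : ℝ≥0∞) {F : ι × ℝ → ℝ≥0∞} (hF : Measurable F) (k : ι) (x : ℝ) :
    duhamelMaj C F (k, x) = C * ((∫⁻ l, wt (x - l) ^ (-3 : ℝ) * (wt l ^ (-1 : ℝ) * F (k, l))) +
      wt x ^ (-3 : ℝ) * ∫⁻ l, wt l ^ (-1 : ℝ) * F (k, l)) := by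
  have hFk : Measurable fun x : ℝ => F (k, x) := hF.comp measurable_prodMk_left
  unfold duhamelMaj
  rw [← lintegral_const_mul _ (by fun_prop), ← lintegral_add_left (by fun_prop),
    ← lintegral_const_mul _ (by fun_prop)]
  refine lintegral_congr fun l => ?_
  ring

/-- The weight passes through the convolution by ⟨x⟩ ≤ ⟨x - l⟩⟨l⟩ (for `wt`), at the cost of one
power of the kernel: ⟨x - l⟩^{-3} becomes ⟨x - l⟩^{-2}, still integrable. -/
lemma lintegral_wt_conv_sq_le {f : ℝ → ℝ≥0∞} (hf : Measurable f) :
    ∫⁻ x, wt x * (∫⁻ l, wt (x - l) ^ (-3 : ℝ) * f l) ^ 2 ≤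
      wtInt 3 * wtInt 2 * ∫⁻ l, wt l * f l ^ 2 := by
  calc _ ≤ ∫⁻ x, wtInt 3 * ∫⁻ l, wt (x - l) ^ (-2 : ℝ) * (wt l * f l ^ 2) := by
        refine lintegral_mono fun x => ?_
        have h1 := lintegral_mul_sq_le (μ := volume) (f := fun l => wt (x - l) ^ (-(3 / 2) : ℝ))
          (g := fun l => wt (x - l) ^ (-(3 / 2) : ℝ) * f l) (by fun_prop) (by fun_prop)
        simp only [mul_pow, wt_rpow_sq, ← mul_assoc, wt_rpow_mul_rpow] at h1
        norm_num at h1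
        rw [lintegral_sub_left_eq_self (fun l => wt l ^ (-3 : ℝ)) x, ← wtInt] at h1
        calc _ ≤ wt x * (wtInt 3 * ∫⁻ l, wt (x - l) ^ (-3 : ℝ) * f l ^ 2) := by gcongr
          _ = wtInt 3 * ∫⁻ l, wt x * (wt (x - l) ^ (-3 : ℝ) * f l ^ 2) := by
              rw [lintegral_const_mul _ (by fun_prop)]; ring
          _ ≤ _ := by
              refine mul_le_mul' le_rfl (lintegral_mono fun l => ?_)
              have h2 : wt x ≤ wt (x - l) * wt l := by simpa using wt_add_le_mul (x - l) l
              calc _ ≤ (wt (x - l) * wt l) * (wt (x - l) ^ (-3 : ℝ) * f l ^ 2) :=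
                    mul_le_mul' h2 le_rfl
                _ = (wt (x - l) ^ (1 : ℝ) * wt (x - l) ^ (-3 : ℝ)) * (wt l * f l ^ 2) := by
                    rw [ENNReal.rpow_one]; ring
                _ = _ := by rw [wt_rpow_mul_rpow]; norm_num
    _ = _ := by
        rw [lintegral_const_mul _ (Measurable.lintegral_prod_right'
          (f := fun z : ℝ × ℝ => wt (z.1 - z.2) ^ (-2 : ℝ) * (wt z.2 * f z.2 ^ 2)) (by fun_prop)),
          lintegral_lintegral_swap (by fun_prop), mul_assoc]
        congr 1
        rw [← lintegral_const_mul _ (by fun_prop)]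
        refine lintegral_congr fun l => ?_
        simp only
        rw [lintegral_mul_const _ (by fun_prop),
          lintegral_sub_right_eq_self (fun x => wt x ^ (-2 : ℝ)) l, ← wtInt]

/-- The truncated Duhamel operator is bounded. -/
lemma ySq_duhamelMaj_le (C : ℝ≥0∞) {F : ι × ℝ → ℝ≥0∞} (hF : Measurable F) :
    ySq (duhamelMaj C F) ≤ duhamelConst C * zSq F := by
  have hFk : ∀ k, Measurable fun x : ℝ => F (k, x) := fun k => hF.comp measurable_prodMk_left
  have hm := measurable_duhamelMaj C hF
  -- The factor ⟨l⟩^{-1} of the kernel is the gain of one power of modulation that turns X^{0,-1/2}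
  -- into X^{0,1/2}.
  have e1 : ∀ k x, wt x * (wt x ^ (-1 : ℝ) * F (k, x)) ^ 2 = wt x ^ (-1 : ℝ) * F (k, x) ^ 2 := by
    intro k x
    calc _ = (wt x ^ (1 : ℝ) * wt x ^ (2 * (-1) : ℝ)) * F (k, x) ^ 2 := by
          rw [mul_pow, wt_rpow_sq, ENNReal.rpow_one]; ring
      _ = _ := by rw [wt_rpow_mul_rpow]; norm_num
  have a1 : ∀ k, ∫⁻ x, wt x * duhamelMaj C F (k, x) ^ 2 ≤ 4 * C ^ 2 *
      (wtInt 3 * wtInt 2 * (∫⁻ x, wt x ^ (-1 : ℝ) * F (k, x) ^ 2) +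
        wtInt 5 * (∫⁻ x, wt x ^ (-1 : ℝ) * F (k, x)) ^ 2) := by
    intro k
    have hk := hFk k
    set f : ℝ → ℝ≥0∞ := fun l => wt l ^ (-1 : ℝ) * F (k, l) with hf
    have hfm : Measurable f := by fun_prop
    have hcm : Measurable fun x => ∫⁻ l, wt (x - l) ^ (-3 : ℝ) * f l :=
      Measurable.lintegral_prod_right' (f := fun z : ℝ × ℝ => wt (z.1 - z.2) ^ (-3 : ℝ) * f z.2)
        (by fun_prop)
    calc _ ≤ ∫⁻ x, 4 * C ^ 2 * (wt x * (∫⁻ l, wt (x - l) ^ (-3 : ℝ) * f l) ^ 2 +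
          wt x ^ (-5 : ℝ) * (∫⁻ l, f l) ^ 2) := by
          refine lintegral_mono fun x => ?_
          simp only
          rw [duhamelMaj_eq C hF, mul_pow]
          calc _ ≤ wt x * (C ^ 2 * (4 * ((∫⁻ l, wt (x - l) ^ (-3 : ℝ) * f l) ^ 2 +
                (wt x ^ (-3 : ℝ) * ∫⁻ l, f l) ^ 2))) := by
                gcongr
                exact ennreal_add_sq_le _ _
            _ = 4 * C ^ 2 * (wt x * (∫⁻ l, wt (x - l) ^ (-3 : ℝ) * f l) ^ 2 +
                (wt x ^ (1 : ℝ) * wt x ^ (2 * (-3) : ℝ)) * (∫⁻ l, f l) ^ 2) := by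
                rw [mul_pow, wt_rpow_sq, ENNReal.rpow_one]; ring
            _ = _ := by rw [wt_rpow_mul_rpow]; norm_num
      _ = 4 * C ^ 2 * (∫⁻ x, wt x * (∫⁻ l, wt (x - l) ^ (-3 : ℝ) * f l) ^ 2) +
          4 * C ^ 2 * (wtInt 5 * (∫⁻ l, f l) ^ 2) := by
          rw [lintegral_const_mul _ (by fun_prop), lintegral_add_left (by fun_prop),
            lintegral_mul_const _ (by fun_prop), mul_add, ← wtInt]
      _ ≤ 4 * C ^ 2 * (wtInt 3 * wtInt 2 * ∫⁻ l, wt l * f l ^ 2) +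
          4 * C ^ 2 * (wtInt 5 * (∫⁻ l, f l) ^ 2) := by
          gcongr
          exact lintegral_wt_conv_sq_le hfm
      _ = _ := by
          simp only [hf, e1]
          ring
  have a2 : ∀ k, (∫⁻ x, duhamelMaj C F (k, x)) ^ 2 =
      4 * C ^ 2 * wtInt 3 ^ 2 * (∫⁻ x, wt x ^ (-1 : ℝ) * F (k, x)) ^ 2 := by
    intro k
    have hk := hFk k
    set f : ℝ → ℝ≥0∞ := fun l => wt l ^ (-1 : ℝ) * F (k, l) with hf
    have hfm : Measurable f := by fun_prop
    have hcm : Measurable fun x => ∫⁻ l, wt (x - l) ^ (-3 : ℝ) * f l :=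
      Measurable.lintegral_prod_right' (f := fun z : ℝ × ℝ => wt (z.1 - z.2) ^ (-3 : ℝ) * f z.2)
        (by fun_prop)
    have : ∫⁻ x, duhamelMaj C F (k, x) = C * (wtInt 3 * (∫⁻ l, f l) + wtInt 3 * ∫⁻ l, f l) := by
      simp only [duhamelMaj_eq C hF]
      rw [lintegral_const_mul _ (by fun_prop), lintegral_add_left (by fun_prop),
        lintegral_mul_const _ (by fun_prop), ← wtInt, lintegral_lintegral_swap (by fun_prop)]
      congr 2
      rw [← lintegral_const_mul _ hfm]
      refine lintegral_congr fun l => ?_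
      rw [lintegral_mul_const _ (by fun_prop),
        lintegral_sub_right_eq_self (fun x => wt x ^ (-3 : ℝ)) l, ← wtInt]
    rw [this]
    ring
  unfold ySq zSq
  rw [lintegral_specMeasure (by fun_prop), lintegral_specMeasure (by fun_prop)]
  simp only [a2]
  set P := ∑ k, ∫⁻ x, wt x ^ (-1 : ℝ) * F (k, x) ^ 2
  set S := ∑ k, (∫⁻ x, wt x ^ (-1 : ℝ) * F (k, x)) ^ 2 with hS
  calc _ ≤ ∑ k, 4 * C ^ 2 *
      (wtInt 3 * wtInt 2 * (∫⁻ x, wt x ^ (-1 : ℝ) * F (k, x) ^ 2) +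
        wtInt 5 * (∫⁻ x, wt x ^ (-1 : ℝ) * F (k, x)) ^ 2) + 4 * C ^ 2 * wtInt 3 ^ 2 * S := by
        rw [← Finset.mul_sum]
        gcongr with k
        exact a1 k
    _ = 4 * C ^ 2 * (wtInt 3 * wtInt 2 * P + wtInt 5 * S) + 4 * C ^ 2 * wtInt 3 ^ 2 * S := by
        simp only [← Finset.mul_sum, Finset.sum_add_distrib, P, S]
    _ ≤ 4 * C ^ 2 * (wtInt 3 * wtInt 2 * (P + S) + wtInt 5 * (P + S)) +
        4 * C ^ 2 * wtInt 3 ^ 2 * (P + S) := by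
        gcongr
        · exact le_self_add
        · exact le_add_self
        · exact le_add_self
    _ = _ := by unfold duhamelConst; ring

end Bilinear

end PeriodicFPU

/-! ### The time cutoff and the truncated Duhamel kernel. -/

namespace PeriodicFPU

open SchwartzMap FourierTransform in
-- Third order decay is enough: against the X^{0,1/2} weight the square ⟨x⟩^{1-6} is integrable, and
-- so is the ⟨x⟩^{-2} left after the weight has been moved through the convolution.
lemma exists_norm_schwartz_le_rpow (f : 𝓢(ℝ, ℂ)) :
    ∃ C : ℝ, 0 < C ∧ ∀ x, ‖f x‖ ≤ C * (1 + |x|) ^ (-3 : ℝ) := by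
  have h := fun x => SchwartzMap.one_add_le_sup_seminorm_apply (𝕜 := ℝ) (m := (3, 0)) (k := 3)
    (n := 0) le_rfl le_rfl f x
  set S : ℝ := 2 ^ 3 * ((Finset.Iic ((3, 0) : ℕ × ℕ)).sup fun m => SchwartzMap.seminorm ℝ m.1 m.2) f
  refine ⟨|S| + 1, by positivity, fun x => ?_⟩
  have hx : (0 : ℝ) < 1 + |x| := by positivity
  have h1 := h x
  rw [norm_iteratedFDeriv_zero, Real.norm_eq_abs] at h1
  rw [Real.rpow_neg hx.le, ← div_eq_mul_inv, le_div_iff₀ (by positivity)]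
  rw [show (3 : ℝ) = ((3 : ℕ) : ℝ) by norm_num, Real.rpow_natCast, mul_comm]
  exact h1.trans ((le_abs_self S).trans (by linarith))

lemma one_add_abs_rpow_le {x y : ℝ} (h : |x - y| ≤ 1) :
    (1 + |x|) ^ (-3 : ℝ) ≤ 8 * (1 + |y|) ^ (-3 : ℝ) := by
  have h1 : (1 + |y|) / 2 ≤ 1 + |x| := by
    have := abs_sub_abs_le_abs_sub y x
    rw [abs_sub_comm] at this
    linarith [abs_nonneg x]
  calc (1 + |x|) ^ (-3 : ℝ) ≤ ((1 + |y|) / 2) ^ (-3 : ℝ) :=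
        Real.rpow_le_rpow_of_nonpos (by positivity) h1 (by norm_num)
    _ = _ := by
        rw [Real.div_rpow (by positivity) (by norm_num), Real.rpow_neg (by norm_num : (0:ℝ) ≤ 2),
          div_inv_eq_mul]
        norm_num
        ring

open SchwartzMap FourierTransform in
/-- The Fourier transform of a smooth time cutoff equal to one on `[-1,1]`. -/
lemma exists_cutoff_fourier : ∃ (ζ : ℝ → ℂ) (C : ℝ), 0 < C ∧ Continuous ζ ∧
    (∀ τ, ‖ζ τ‖ ≤ C * (1 + |τ|) ^ (-3 : ℝ)) ∧
    (∀ τ l, |l| ≤ 1 → ‖ζ (τ - l) - ζ τ‖ ≤ C * |l| * (1 + |τ|) ^ (-3 : ℝ)) ∧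
    ∀ t : ℝ, |t| ≤ 1 → ∫ τ : ℝ, Complex.exp (Complex.I * ((t * τ : ℝ) : ℂ)) * ζ τ = 1 := by
  -- The inner radius 1 is where the cutoff has to equal one; the outer radius 2 is arbitrary.
  let b : ContDiffBump (0 : ℝ) := ⟨1, 2, one_pos, one_lt_two⟩
  have hbs : HasCompactSupport fun x => (b x : ℂ) :=
    b.hasCompactSupport.comp_left (g := fun x : ℝ => (x : ℂ)) Complex.ofReal_zero
  have hbd : ContDiff ℝ (⊤ : ℕ∞) fun x => (b x : ℂ) := Complex.ofRealCLM.contDiff.comp b.contDiff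
  let f : 𝓢(ℝ, ℂ) := hbs.toSchwartzMap hbd
  let ψ : 𝓢(ℝ, ℂ) := 𝓕 f
  obtain ⟨C₀, hC₀, h0⟩ := exists_norm_schwartz_le_rpow
    (SchwartzMap.compCLMOfContinuousLinearEquiv ℂ
      (ContinuousLinearEquiv.smulLeft (Units.mk0 (2 * Real.pi)⁻¹ (by positivity))) ψ)
  obtain ⟨C₁, hC₁, h1⟩ := exists_norm_schwartz_le_rpow (SchwartzMap.derivCLM ℂ ℂ
    (SchwartzMap.compCLMOfContinuousLinearEquiv ℂ
      (ContinuousLinearEquiv.smulLeft (Units.mk0 (2 * Real.pi)⁻¹ (by positivity))) ψ))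
  set χ := SchwartzMap.compCLMOfContinuousLinearEquiv ℂ
      (ContinuousLinearEquiv.smulLeft (Units.mk0 (2 * Real.pi)⁻¹ (by positivity))) ψ with hχ
  have hχe : ∀ x, χ x = ψ ((2 * Real.pi)⁻¹ * x) := fun x => rfl
  have hpi : (1 : ℝ) ≤ 2 * Real.pi := by linarith [Real.pi_gt_three]
  have hnorm : ‖(((2 * Real.pi)⁻¹ : ℝ) : ℂ)‖ ≤ 1 := by
    rw [Complex.norm_real, Real.norm_eq_abs, abs_of_pos (by positivity)]
    exact inv_le_one_of_one_le₀ hpi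
  -- The transform `𝓕` uses e^{-2πixξ}, whereas inversion is wanted in the form ∫ e^{itτ} ζ(τ) dτ;
  -- this accounts for the dilation by 1/(2π) and for the prefactor.
  refine ⟨fun τ => (((2 * Real.pi)⁻¹ : ℝ) : ℂ) * χ τ, C₀ + 8 * C₁, by positivity,
    by fun_prop, fun τ => ?_, fun τ l hl => ?_, fun t ht => ?_⟩
  · rw [norm_mul]
    refine (mul_le_of_le_one_left (norm_nonneg _) hnorm).trans ((h0 τ).trans ?_)
    gcongr
    linarith
  · rw [← mul_sub, norm_mul]
    refine (mul_le_of_le_one_left (norm_nonneg _) hnorm).trans ?_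
    have hmv := (convex_uIcc τ (τ - l)).norm_image_sub_le_of_norm_deriv_le (f := χ)
      (C := C₁ * (8 * (1 + |τ|) ^ (-3 : ℝ)))
      (fun x _ => χ.differentiableAt) (fun x hx => ?_) left_mem_uIcc right_mem_uIcc
    · refine hmv.trans ?_
      have e : ‖τ - l - τ‖ = |l| := by rw [Real.norm_eq_abs, sub_sub_cancel_left, abs_neg]
      rw [e]
      have : 0 ≤ C₀ * |l| * (1 + |τ|) ^ (-3 : ℝ) := by positivity
      linarith
    · refine (h1 x).trans ?_
      gcongr
      apply one_add_abs_rpow_le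
      have := abs_sub_left_of_mem_uIcc hx
      refine this.trans ?_
      simpa using hl
  · have e1 : ∀ τ : ℝ, Complex.exp (Complex.I * ((t * τ : ℝ) : ℂ)) *
        ((((2 * Real.pi)⁻¹ : ℝ) : ℂ) * χ τ) = (((2 * Real.pi)⁻¹ : ℝ) : ℂ) *
        (fun x : ℝ => Complex.exp (Complex.I * ((t * (2 * Real.pi * x) : ℝ) : ℂ)) * ψ x)
          ((2 * Real.pi)⁻¹ * τ) := by
      intro τ
      simp only [hχe]
      rw [mul_inv_cancel_left₀ (by positivity)]
      ring
    simp_rw [e1]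
    have e2 := Measure.integral_comp_inv_mul_left
      (fun x : ℝ => Complex.exp (Complex.I * ((t * (2 * Real.pi * x) : ℝ) : ℂ)) * ψ x)
      (2 * Real.pi)
    rw [integral_const_mul, e2, abs_of_pos (by positivity)]
    rw [Complex.real_smul, ← mul_assoc, ← Complex.ofReal_mul, inv_mul_cancel₀ (by positivity),
      Complex.ofReal_one, one_mul]
    have h2 : 𝓕⁻ ψ = f := FourierTransform.fourierInv_fourier_eq f
    have h3 : (𝓕⁻ ψ) t = f t := by rw [h2]
    rw [SchwartzMap.fourierInv_coe, Real.fourierInv_eq'] at h3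
    have h4 : f t = 1 := by
      change ((b t : ℝ) : ℂ) = 1
      rw [b.one_of_mem_closedBall (by simpa using ht), Complex.ofReal_one]
    rw [← h4, ← h3]
    refine integral_congr_ae (Filter.Eventually.of_forall fun x => ?_)
    simp only [smul_eq_mul]
    congr 2
    simp
    ring

/-- The kernel of the truncated Duhamel operator. -/
noncomputable def duhamelKernel (ζ : ℝ → ℂ) (τ l : ℝ) : ℂ := (ζ (τ - l) - ζ τ) / (Complex.I * l)

lemma measurable_duhamelKernel {ζ : ℝ → ℂ} (hζ : Continuous ζ) :
    Measurable fun z : ℝ × ℝ => duhamelKernel ζ z.1 z.2 := by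
  unfold duhamelKernel
  have := hζ.measurable
  fun_prop

/-- For |l| ≤ 1 the difference quotient is bounded by the derivative of ζ, so there is no
singularity at l = 0. For |l| ≥ 1 the denominator gives the decay in l, and the two terms of the
numerator are bounded separately. -/
lemma norm_duhamelKernel_le {ζ : ℝ → ℂ} {C : ℝ} (hC : 0 < C)
    (h0 : ∀ τ, ‖ζ τ‖ ≤ C * (1 + |τ|) ^ (-3 : ℝ))
    (h1 : ∀ τ l, |l| ≤ 1 → ‖ζ (τ - l) - ζ τ‖ ≤ C * |l| * (1 + |τ|) ^ (-3 : ℝ)) (τ l : ℝ) :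
    ‖duhamelKernel ζ τ l‖ ≤
      2 * C * ((1 + |l|)⁻¹ * ((1 + |τ - l|) ^ (-3 : ℝ) + (1 + |τ|) ^ (-3 : ℝ))) := by
  rw [duhamelKernel, norm_div, norm_mul, Complex.norm_I, one_mul, Complex.norm_real,
    Real.norm_eq_abs]
  have p1 : 0 < (1 + |τ - l|) ^ (-3 : ℝ) := by positivity
  have p2 : 0 < (1 + |τ|) ^ (-3 : ℝ) := by positivity
  rcases eq_or_ne l 0 with rfl | hl
  · simp
    positivity
  have hl0 : 0 < |l| := abs_pos.2 hl
  rw [div_le_iff₀ hl0]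
  rcases le_total |l| 1 with hle | hle
  · have h3 : (1 / 2 : ℝ) ≤ (1 + |l|)⁻¹ := by
      rw [one_div]; exact inv_anti₀ (by positivity) (by linarith)
    calc _ ≤ C * |l| * (1 + |τ|) ^ (-3 : ℝ) := h1 τ l hle
      _ = 2 * C * (1 / 2 * (1 + |τ|) ^ (-3 : ℝ)) * |l| := by ring
      _ ≤ _ := by
        gcongr
        linarith
  · have h3 : 1 ≤ 2 * ((1 + |l|)⁻¹ * |l|) := by
      rw [← div_eq_inv_mul, ← mul_div_assoc, le_div_iff₀ (by positivity)]
      linarith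
    calc _ ≤ C * (1 + |τ - l|) ^ (-3 : ℝ) + C * (1 + |τ|) ^ (-3 : ℝ) :=
          (norm_sub_le _ _).trans (add_le_add (h0 _) (h0 _))
      _ = C * ((1 + |τ - l|) ^ (-3 : ℝ) + (1 + |τ|) ^ (-3 : ℝ)) * 1 := by ring
      _ ≤ C * ((1 + |τ - l|) ^ (-3 : ℝ) + (1 + |τ|) ^ (-3 : ℝ)) * (2 * ((1 + |l|)⁻¹ * |l|)) := by
          gcongr
      _ = _ := by ring

/-- The properties of the Fourier transform of the time cutoff that are used. -/
structure IsCutoff (ζ : ℝ → ℂ) (C : ℝ≥0∞) : Prop where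
  continuous : Continuous ζ
  ne_top : C ≠ ∞
  enorm_le : ∀ τ, ‖ζ τ‖ₑ ≤ C * wt τ ^ (-3 : ℝ)
  kernel_le : ∀ τ l, ‖duhamelKernel ζ τ l‖ₑ ≤
    C * (wt l ^ (-1 : ℝ) * (wt (τ - l) ^ (-3 : ℝ) + wt τ ^ (-3 : ℝ)))
  integral_eq : ∀ t : ℝ, |t| ≤ 1 →
    ∫ τ : ℝ, Complex.exp (Complex.I * ((t * τ : ℝ) : ℂ)) * ζ τ = 1

lemma exists_isCutoff : ∃ ζ C, IsCutoff ζ C := by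
  obtain ⟨ζ, C, hC, hζ, h0, h1, h2⟩ := exists_cutoff_fourier
  refine ⟨ζ, ENNReal.ofReal (2 * C), hζ, ENNReal.ofReal_ne_top, fun τ => ?_, fun τ l => ?_, h2⟩
  · rw [wt_rpow, ← ENNReal.ofReal_mul (by positivity), ← ofReal_norm]
    refine ENNReal.ofReal_le_ofReal ((h0 τ).trans ?_)
    gcongr
    linarith
  · rw [wt_rpow, wt_rpow, wt_rpow, ← ENNReal.ofReal_add (by positivity) (by positivity),
      ← ENNReal.ofReal_mul (by positivity), ← ENNReal.ofReal_mul (by positivity),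
      ← ofReal_norm]
    refine ENNReal.ofReal_le_ofReal ((norm_duhamelKernel_le hC h0 h1 τ l).trans (le_of_eq ?_))
    rw [Real.rpow_neg_one]

end PeriodicFPU

/-! ### Majorant iteration in `[0,∞]`. -/

namespace PeriodicFPU

set_option linter.unusedSectionVars false

section Majorant

variable {ι : Type*} [Fintype ι] [AddCommGroup ι] [MeasurableSpace ι] [DiscreteMeasurableSpace ι]
variable {c T : ℝ} {B D : ℝ≥0∞} {r : ι → ℝ}

lemma resConv_add_left (Θ : ι → ι → ℝ) {U U' V : ι × ℝ → ℝ≥0∞} (hU : Measurable U)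
    (hV : Measurable V) : resConv Θ (U + U') V = resConv Θ U V + resConv Θ U' V := by
  ext p
  simp only [resConv, Pi.add_apply]
  rw [← lintegral_add_left (measurable_resConv_integrand hU hV p)]
  refine lintegral_congr fun q => ?_
  ring

lemma resConv_add_right (Θ : ι → ι → ℝ) {U V V' : ι × ℝ → ℝ≥0∞} (hU : Measurable U)
    (hV : Measurable V) : resConv Θ U (V + V') = resConv Θ U V + resConv Θ U V' := by
  ext p
  simp only [resConv, Pi.add_apply]
  rw [← lintegral_add_left (measurable_resConv_integrand hU hV p)]
  refine lintegral_congr fun q => ?_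
  ring

lemma resConv_mono (Θ : ι → ι → ℝ) {U U' V V' : ι × ℝ → ℝ≥0∞} (hU : U ≤ U') (hV : V ≤ V') :
    resConv Θ U V ≤ resConv Θ U' V' := by
  intro p
  refine lintegral_mono fun q => ?_
  gcongr
  · exact hU q
  · exact hV _

lemma duhamelMaj_add (C : ℝ≥0∞) {F F' : ι × ℝ → ℝ≥0∞} (hF : Measurable F) :
    duhamelMaj C (F + F') = duhamelMaj C F + duhamelMaj C F' := by
  ext p
  have hFk : Measurable fun x : ℝ => F (p.1, x) := hF.comp measurable_prodMk_left
  simp only [duhamelMaj, Pi.add_apply]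
  rw [← lintegral_add_left (by fun_prop)]
  refine lintegral_congr fun q => ?_
  ring

lemma duhamelMaj_mono (C : ℝ≥0∞) {F F' : ι × ℝ → ℝ≥0∞} (h : F ≤ F') :
    duhamelMaj C F ≤ duhamelMaj C F' := by
  intro p
  refine lintegral_mono fun q => ?_
  gcongr
  exact h _

/-- The majorant of the quadratic nonlinearity of the system. -/
noncomputable def srcMaj (T : ℝ) (r : ι → ℝ) (Θ : Bool → Bool → Bool → ι → ι → ℝ)
    (G H : Bool → ι × ℝ → ℝ≥0∞) (σ : Bool) : ι × ℝ → ℝ≥0∞ :=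
  ∑ a, ∑ b, majConv T r (Θ σ a b) (G a) (H b)

/-- The majorant of the bilinear Duhamel term of the system. -/
noncomputable def picardMaj (C : ℝ≥0∞) (T : ℝ) (r : ι → ℝ) (Θ : Bool → Bool → Bool → ι → ι → ℝ)
    (G H : Bool → ι × ℝ → ℝ≥0∞) (σ : Bool) : ι × ℝ → ℝ≥0∞ :=
  duhamelMaj C (srcMaj T r Θ G H σ)

variable {Θ : Bool → Bool → Bool → ι → ι → ℝ} {C : ℝ≥0∞}

lemma measurable_srcMaj {G H : Bool → ι × ℝ → ℝ≥0∞} (hG : ∀ σ, Measurable (G σ))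
    (hH : ∀ σ, Measurable (H σ)) (σ : Bool) : Measurable (srcMaj T r Θ G H σ) := by
  have e : srcMaj T r Θ G H σ = fun p => ∑ a, ∑ b, majConv T r (Θ σ a b) (G a) (H b) p := by
    ext p
    simp only [srcMaj, Finset.sum_apply]
  rw [e]
  exact Finset.measurable_sum _ fun a _ => Finset.measurable_sum _ fun b _ =>
    measurable_majConv (hG a) (hH b)

lemma measurable_picardMaj {G H : Bool → ι × ℝ → ℝ≥0∞} (hG : ∀ σ, Measurable (G σ))
    (hH : ∀ σ, Measurable (H σ)) (σ : Bool) : Measurable (picardMaj C T r Θ G H σ) :=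
  measurable_duhamelMaj C (measurable_srcMaj hG hH σ)

lemma srcMaj_add_left {G G' H : Bool → ι × ℝ → ℝ≥0∞} (hG : ∀ σ, Measurable (G σ))
    (hH : ∀ σ, Measurable (H σ)) :
    srcMaj T r Θ (G + G') H = srcMaj T r Θ G H + srcMaj T r Θ G' H := by
  ext σ p
  simp only [srcMaj, Pi.add_apply, Finset.sum_apply, majConv, resConv_add_left _ (hG _) (hH _),
    mul_add, Finset.sum_add_distrib]

lemma srcMaj_add_right {G H H' : Bool → ι × ℝ → ℝ≥0∞} (hG : ∀ σ, Measurable (G σ))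
    (hH : ∀ σ, Measurable (H σ)) :
    srcMaj T r Θ G (H + H') = srcMaj T r Θ G H + srcMaj T r Θ G H' := by
  ext σ p
  simp only [srcMaj, Pi.add_apply, Finset.sum_apply, majConv, resConv_add_right _ (hG _) (hH _),
    mul_add, Finset.sum_add_distrib]

lemma picardMaj_add_left {G G' H : Bool → ι × ℝ → ℝ≥0∞} (hG : ∀ σ, Measurable (G σ))
    (hH : ∀ σ, Measurable (H σ)) :
    picardMaj C T r Θ (G + G') H = picardMaj C T r Θ G H + picardMaj C T r Θ G' H := by
  ext1 σ
  simp only [picardMaj, srcMaj_add_left hG hH, Pi.add_apply]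
  exact duhamelMaj_add C (measurable_srcMaj hG hH σ)

lemma picardMaj_add_right {G H H' : Bool → ι × ℝ → ℝ≥0∞} (hG : ∀ σ, Measurable (G σ))
    (hH : ∀ σ, Measurable (H σ)) :
    picardMaj C T r Θ G (H + H') = picardMaj C T r Θ G H + picardMaj C T r Θ G H' := by
  ext1 σ
  simp only [picardMaj, srcMaj_add_right hG hH, Pi.add_apply]
  exact duhamelMaj_add C (measurable_srcMaj hG hH σ)

lemma srcMaj_mono {G G' H H' : Bool → ι × ℝ → ℝ≥0∞} (hG : G ≤ G') (hH : H ≤ H') :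
    srcMaj T r Θ G H ≤ srcMaj T r Θ G' H' := by
  intro σ
  refine Finset.sum_le_sum fun a _ => Finset.sum_le_sum fun b _ => fun p => ?_
  unfold majConv
  gcongr
  exact resConv_mono _ (hG a) (hH b) p

lemma picardMaj_mono {G G' H H' : Bool → ι × ℝ → ℝ≥0∞} (hG : G ≤ G') (hH : H ≤ H') :
    picardMaj C T r Θ G H ≤ picardMaj C T r Θ G' H' :=
  fun σ => duhamelMaj_mono C (srcMaj_mono hG hH σ)

lemma zSq_add_le {F F' : ι × ℝ → ℝ≥0∞} (hF : Measurable F) :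
    zSq (F + F') ≤ 4 * (zSq F + zSq F') := by
  have hFk : ∀ k, Measurable fun x : ℝ => F (k, x) := fun k => hF.comp measurable_prodMk_left
  have h1 : ∫⁻ p, wt p.2 ^ (-1 : ℝ) * (F + F') p ^ 2 ∂(specMeasure ι) ≤
      4 * (∫⁻ p, wt p.2 ^ (-1 : ℝ) * F p ^ 2 ∂(specMeasure ι) +
        ∫⁻ p, wt p.2 ^ (-1 : ℝ) * F' p ^ 2 ∂(specMeasure ι)) := by
    rw [← lintegral_add_left (by fun_prop), ← lintegral_const_mul' _ _ (by norm_num)]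
    refine lintegral_mono fun p => ?_
    rw [← mul_add, mul_left_comm]
    gcongr
    exact ennreal_add_sq_le _ _
  have h2 : ∑ k, (∫⁻ x, wt x ^ (-1 : ℝ) * (F + F') (k, x)) ^ 2 ≤
      4 * (∑ k, (∫⁻ x, wt x ^ (-1 : ℝ) * F (k, x)) ^ 2 +
        ∑ k, (∫⁻ x, wt x ^ (-1 : ℝ) * F' (k, x)) ^ 2) := by
    rw [← Finset.sum_add_distrib, Finset.mul_sum]
    refine Finset.sum_le_sum fun k _ => ?_
    have hk := hFk k
    simp only [Pi.add_apply, mul_add]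
    rw [lintegral_add_left (by fun_prop)]
    refine (ennreal_add_sq_le _ _).trans (le_of_eq (mul_add _ _ _))
  unfold zSq
  calc _ ≤ _ := add_le_add h1 h2
    _ = _ := by ring

lemma ySq_add_le {F F' : ι × ℝ → ℝ≥0∞} (hF : Measurable F) :
    ySq (F + F') ≤ 4 * (ySq F + ySq F') := by
  have hFk : ∀ k, Measurable fun x : ℝ => F (k, x) := fun k => hF.comp measurable_prodMk_left
  have h1 : ∫⁻ p, wt p.2 * (F + F') p ^ 2 ∂(specMeasure ι) ≤
      4 * (∫⁻ p, wt p.2 * F p ^ 2 ∂(specMeasure ι) +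
        ∫⁻ p, wt p.2 * F' p ^ 2 ∂(specMeasure ι)) := by
    rw [← lintegral_add_left (by fun_prop), ← lintegral_const_mul' _ _ (by norm_num)]
    refine lintegral_mono fun p => ?_
    rw [← mul_add, mul_left_comm]
    gcongr
    exact ennreal_add_sq_le _ _
  have h2 : ∑ k, (∫⁻ x, (F + F') (k, x)) ^ 2 ≤
      4 * (∑ k, (∫⁻ x, F (k, x)) ^ 2 + ∑ k, (∫⁻ x, F' (k, x)) ^ 2) := by
    rw [← Finset.sum_add_distrib, Finset.mul_sum]
    refine Finset.sum_le_sum fun k _ => ?_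
    simp only [Pi.add_apply]
    rw [lintegral_add_left (hFk k)]
    exact ennreal_add_sq_le _ _
  unfold ySq
  calc _ ≤ _ := add_le_add h1 h2
    _ = _ := by ring

/-- The square of the `Y`-norm of a pair. -/
noncomputable def ySys (G : Bool → ι × ℝ → ℝ≥0∞) : ℝ≥0∞ := ∑ σ, ySq (G σ)

lemma ySys_add_le {F F' : Bool → ι × ℝ → ℝ≥0∞} (hF : ∀ σ, Measurable (F σ)) :
    ySys (F + F') ≤ 4 * (ySys F + ySys F') := by
  unfold ySys
  rw [← Finset.sum_add_distrib, Finset.mul_sum]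
  exact Finset.sum_le_sum fun σ _ => ySq_add_le (hF σ)

lemma ySys_picardMaj_le (h : ∀ σ a b, IsResonant c T B D r (Θ σ a b))
    {G H : Bool → ι × ℝ → ℝ≥0∞} (hG : ∀ σ, Measurable (G σ)) (hH : ∀ σ, Measurable (H σ)) :
    ySys (picardMaj C T r Θ G H) ≤
      32 * duhamelConst C * bilConst c T B D * (ySys G * ySys H) := by
  have key : ∀ σ, ySq (picardMaj C T r Θ G H σ) ≤
      duhamelConst C * (16 * (bilConst c T B D * (ySys G * ySys H))) := by
    intro σ
    refine (ySq_duhamelMaj_le C (measurable_srcMaj hG hH σ)).trans (mul_le_mul' le_rfl ?_)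
    have hm : ∀ a b, Measurable (majConv T r (Θ σ a b) (G a) (H b)) := fun a b =>
      measurable_majConv (hG a) (hH b)
    have hb : ∀ a b, zSq (majConv T r (Θ σ a b) (G a) (H b)) ≤
        bilConst c T B D * (ySq (G a) * ySq (H b)) := fun a b => (h σ a b).zSq_majConv_le (hG a) (hH b)
    unfold srcMaj ySys
    simp only [Fintype.sum_bool]
    calc _ ≤ 4 * (4 * (zSq (majConv T r (Θ σ true true) (G true) (H true)) +
          zSq (majConv T r (Θ σ true false) (G true) (H false))) +
          4 * (zSq (majConv T r (Θ σ false true) (G false) (H true)) +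
          zSq (majConv T r (Θ σ false false) (G false) (H false)))) := by
          refine (zSq_add_le ((hm _ _).add (hm _ _))).trans ?_
          gcongr <;> exact zSq_add_le (hm _ _)
      _ ≤ 4 * (4 * (bilConst c T B D * (ySq (G true) * ySq (H true)) +
          bilConst c T B D * (ySq (G true) * ySq (H false))) +
          4 * (bilConst c T B D * (ySq (G false) * ySq (H true)) +
          bilConst c T B D * (ySq (G false) * ySq (H false)))) := by
          gcongr <;> exact hb _ _
      _ = _ := by ring
  calc _ ≤ ∑ _σ : Bool, duhamelConst C * (16 * (bilConst c T B D * (ySys G * ySys H))) :=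
        Finset.sum_le_sum fun σ _ => key σ
    _ = _ := by
        simp only [Fintype.sum_bool]
        ring

/-- The majorants of the Picard iterates and of their increments. -/
noncomputable def majIter (C : ℝ≥0∞) (T : ℝ) (r : ι → ℝ) (Θ : Bool → Bool → Bool → ι → ι → ℝ)
    (A : Bool → ι × ℝ → ℝ≥0∞) : ℕ → (Bool → ι × ℝ → ℝ≥0∞) × (Bool → ι × ℝ → ℝ≥0∞)
  | 0 => (0, A)
  | n + 1 =>
    let G := (majIter C T r Θ A n).1
    let D := (majIter C T r Θ A n).2
    (G + D, picardMaj C T r Θ D (G + D) + picardMaj C T r Θ G D)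

variable {A : Bool → ι × ℝ → ℝ≥0∞}

lemma measurable_majIter (hA : ∀ σ, Measurable (A σ)) (n : ℕ) :
    (∀ σ, Measurable ((majIter C T r Θ A n).1 σ)) ∧
      ∀ σ, Measurable ((majIter C T r Θ A n).2 σ) := by
  induction n with
  | zero => exact ⟨fun σ => measurable_zero, hA⟩
  | succ n ih =>
    have h1 : ∀ σ, Measurable (((majIter C T r Θ A n).1 + (majIter C T r Θ A n).2) σ) :=
      fun σ => (ih.1 σ).add (ih.2 σ)
    exact ⟨h1, fun σ => (measurable_picardMaj ih.2 h1 σ).add (measurable_picardMaj ih.1 ih.2 σ)⟩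

/-- Writing P for the bilinear Duhamel majorant, P(D, G + D) + P(G, D) is what must be added to P(G,
G) to obtain P(G + D, G + D). Carrying increments along in the iteration avoids subtraction, which
`[0,∞]` does not permit; the sums are nevertheless the Picard iterates. -/
lemma majIter_succ_fst (hA : ∀ σ, Measurable (A σ)) (n : ℕ) :
    (majIter C T r Θ A (n + 1)).1 =
      A + picardMaj C T r Θ (majIter C T r Θ A n).1 (majIter C T r Θ A n).1 := by
  induction n with
  | zero =>
    have h0 : picardMaj C T r Θ 0 0 = 0 := by
      ext σ p
      simp [picardMaj, duhamelMaj, srcMaj, majConv, resConv]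
    change 0 + A = A + picardMaj C T r Θ 0 0
    rw [h0, zero_add, add_zero]
  | succ n ih =>
    obtain ⟨hG, hD⟩ := measurable_majIter (C := C) (T := T) (r := r) (Θ := Θ) hA n
    have hGD := (measurable_majIter (C := C) (T := T) (r := r) (Θ := Θ) hA (n + 1)).1
    set G := (majIter C T r Θ A n).1 with hGdef
    set D := (majIter C T r Θ A n).2 with hDdef
    have e1 : (majIter C T r Θ A (n + 1)).1 = G + D := rfl
    rw [e1] at hGD
    have e2 : (majIter C T r Θ A (n + 2)).1 =
        (G + D) + (picardMaj C T r Θ D (G + D) + picardMaj C T r Θ G D) := rfl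
    rw [e2, e1]
    nth_rewrite 1 [← e1]
    rw [ih, picardMaj_add_left hG hGD, picardMaj_add_right hG hG]
    abel

lemma majIter_fst_eq_sum (n : ℕ) :
    (majIter C T r Θ A n).1 = ∑ i ∈ Finset.range n, (majIter C T r Θ A i).2 := by
  induction n with
  | zero => rfl
  | succ n ih =>
    rw [Finset.sum_range_succ, ← ih]
    rfl

/-- If an iterate is at most 8a, with a the size of the data, the next one is at most 4(a + 64κa²) ≤
8a under smallness. The 4 is the cost of the triangle inequality for squared norms. -/
lemma ySys_majIter_le (h : ∀ σ a b, IsResonant c T B D r (Θ σ a b))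
    (hA : ∀ σ, Measurable (A σ))
    (hsmall : 64 * (32 * duhamelConst C * bilConst c T B D) * ySys A ≤ 1) (n : ℕ) :
    ySys (majIter C T r Θ A n).1 ≤ 8 * ySys A := by
  induction n with
  | zero =>
    change ySys (0 : Bool → ι × ℝ → ℝ≥0∞) ≤ _
    simp [ySys, ySq]
  | succ n ih =>
    have hG := (measurable_majIter (C := C) (T := T) (r := r) (Θ := Θ) hA n).1
    rw [majIter_succ_fst hA]
    refine (ySys_add_le hA).trans ?_
    calc _ ≤ 4 * (ySys A + 32 * duhamelConst C * bilConst c T B D *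
          ((8 * ySys A) * (8 * ySys A))) := by
          gcongr
          refine (ySys_picardMaj_le h hG hG).trans ?_
          gcongr
      _ = 4 * (ySys A + (64 * (32 * duhamelConst C * bilConst c T B D) * ySys A) * ySys A) := by
          ring
      _ ≤ 4 * (ySys A + 1 * ySys A) := by gcongr
      _ = _ := by ring

/-- The limit of the majorants. -/
noncomputable def majLimit (C : ℝ≥0∞) (T : ℝ) (r : ι → ℝ) (Θ : Bool → Bool → Bool → ι → ι → ℝ)
    (A : Bool → ι × ℝ → ℝ≥0∞) (σ : Bool) (p : ι × ℝ) : ℝ≥0∞ :=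
  ∑' n, (majIter C T r Θ A n).2 σ p

lemma measurable_majLimit (hA : ∀ σ, Measurable (A σ)) (σ : Bool) :
    Measurable (majLimit C T r Θ A σ) :=
  Measurable.tsum fun n => (measurable_majIter hA n).2 σ

/-- The partial sums of the increments are the iterates, which increase to the limit; the uniform
bound passes to it by monotone convergence, without any estimate on differences. -/
lemma ySys_majLimit_le (h : ∀ σ a b, IsResonant c T B D r (Θ σ a b))
    (hA : ∀ σ, Measurable (A σ))
    (hsmall : 64 * (32 * duhamelConst C * bilConst c T B D) * ySys A ≤ 1) :
    ySys (majLimit C T r Θ A) ≤ 8 * ySys A := by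
  set G : ℕ → Bool → ι × ℝ → ℝ≥0∞ := fun n => (majIter C T r Θ A n).1 with hGdef
  have hGm : ∀ n σ, Measurable (G n σ) := fun n => (measurable_majIter hA n).1
  have hGapp : ∀ n σ p, G n σ p = ∑ i ∈ Finset.range n, (majIter C T r Θ A i).2 σ p := by
    intro n σ p
    simp only [hGdef]
    rw [majIter_fst_eq_sum]
    simp
  have hmono : ∀ σ p, Monotone fun n => G n σ p := by
    intro σ p
    refine monotone_nat_of_le_succ fun n => ?_
    rw [hGapp, hGapp, Finset.sum_range_succ]
    exact le_self_add
  have hlim : ∀ σ p, Filter.Tendsto (fun n => G n σ p) Filter.atTop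
      (nhds (majLimit C T r Θ A σ p)) := by
    intro σ p
    simp only [hGapp]
    exact ENNReal.tendsto_nat_tsum _
  have htend : Filter.Tendsto (fun n => ySys (G n)) Filter.atTop
      (nhds (ySys (majLimit C T r Θ A))) := by
    unfold ySys ySq
    refine tendsto_finsetSum _ fun σ _ => Filter.Tendsto.add ?_ (tendsto_finsetSum _ fun k _ =>
      ENNReal.Tendsto.pow ?_)
    · refine lintegral_tendsto_of_tendsto_of_monotone (fun n => ?_) ?_ ?_
      · have := hGm n σ
        exact Measurable.aemeasurable (by fun_prop)
      · refine Filter.Eventually.of_forall fun p m n hmn => ?_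
        have := hmono σ p hmn
        dsimp only at this ⊢
        gcongr
      · refine Filter.Eventually.of_forall fun p => ?_
        exact ENNReal.Tendsto.const_mul (ENNReal.Tendsto.pow (hlim σ p)) (Or.inr (wt_ne_top _))
    · refine lintegral_tendsto_of_tendsto_of_monotone (fun n => ?_) ?_ ?_
      · have := hGm n σ
        exact Measurable.aemeasurable (by fun_prop)
      · exact Filter.Eventually.of_forall fun x => hmono σ (k, x)
      · exact Filter.Eventually.of_forall fun x => hlim σ (k, x)
  exact le_of_tendsto' htend fun n => ySys_majIter_le h hA hsmall n

lemma lintegral_lt_top_of_ySys {G : Bool → ι × ℝ → ℝ≥0∞} (h : ySys G ≠ ∞) (σ : Bool) (k : ι) :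
    ∫⁻ x, G σ (k, x) < ∞ := by
  have h1 : ySq (G σ) ≠ ∞ := ne_top_of_le_ne_top h
    (Finset.single_le_sum (f := fun σ => ySq (G σ)) (fun _ _ => zero_le) (Finset.mem_univ σ))
  have h2 : (∫⁻ x, G σ (k, x)) ^ 2 ≤ ySq (G σ) :=
    (Finset.single_le_sum (f := fun k => (∫⁻ x, G σ (k, x)) ^ 2) (fun _ _ => zero_le)
      (Finset.mem_univ k)).trans le_add_self
  have h3 := ne_top_of_le_ne_top h1 h2
  rw [ne_eq, ENNReal.pow_eq_top_iff] at h3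
  exact lt_top_iff_ne_top.2 fun h4 => h3 ⟨h4, by norm_num⟩

end Majorant

end PeriodicFPU

/-! ### Functions of time as inverse Fourier transforms of integrable densities. -/

namespace PeriodicFPU

set_option linter.unusedSectionVars false

/-- The oscillating exponential `e^{itx}`. -/
noncomputable def osc (t x : ℝ) : ℂ := Complex.exp (Complex.I * ((t * x : ℝ) : ℂ))

lemma norm_osc (t x : ℝ) : ‖osc t x‖ = 1 := by
  rw [osc, mul_comm, Complex.norm_exp_ofReal_mul_I]

lemma osc_add (t x y : ℝ) : osc t (x + y) = osc t x * osc t y := by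
  unfold osc
  rw [← Complex.exp_add]
  congr 1
  push_cast
  ring

lemma osc_zero_left (x : ℝ) : osc 0 x = 1 := by simp [osc]

@[fun_prop]
lemma Continuous.osc {α : Type*} [TopologicalSpace α] {f g : α → ℝ} (hf : Continuous f)
    (hg : Continuous g) : Continuous fun a => PeriodicFPU.osc (f a) (g a) := by
  unfold PeriodicFPU.osc
  fun_prop

@[fun_prop]
lemma Measurable.osc {α : Type*} [MeasurableSpace α] {f g : α → ℝ} (hf : Measurable f)
    (hg : Measurable g) : Measurable fun a => PeriodicFPU.osc (f a) (g a) := by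
  unfold PeriodicFPU.osc
  fun_prop

lemma integrable_osc_mul {u : ℝ → ℂ} (hu : Integrable u) (t : ℝ) :
    Integrable fun x => osc t x * u x := by
  refine hu.bdd_mul (c := 1) (Continuous.aestronglyMeasurable (by fun_prop)) ?_
  exact Filter.Eventually.of_forall fun x => (norm_osc t x).le

/-- The function of time with spectral density `u`. -/
noncomputable def timeFT (u : ℝ → ℂ) (t : ℝ) : ℂ := ∫ x, osc t x * u x

lemma norm_timeFT_le (u : ℝ → ℂ) (t : ℝ) : ‖timeFT u t‖ ≤ ∫ x, ‖u x‖ := by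
  refine (norm_integral_le_integral_norm _).trans (le_of_eq ?_)
  simp [norm_osc]

lemma continuous_timeFT {u : ℝ → ℂ} (hu : Integrable u) : Continuous (timeFT u) := by
  refine continuous_of_dominated (bound := fun x => ‖u x‖) (fun t => ?_) (fun t => ?_) hu.norm ?_
  · exact (integrable_osc_mul hu t).aestronglyMeasurable
  · exact Filter.Eventually.of_forall fun x => by simp [norm_osc]
  · exact Filter.Eventually.of_forall fun x => by fun_prop

lemma timeFT_add {u v : ℝ → ℂ} (hu : Integrable u) (hv : Integrable v) (t : ℝ) :
    timeFT (fun x => u x + v x) t = timeFT u t + timeFT v t := by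
  unfold timeFT
  rw [← integral_add (integrable_osc_mul hu t) (integrable_osc_mul hv t)]
  simp only [mul_add]

lemma timeFT_const_mul (a : ℂ) (u : ℝ → ℂ) (t : ℝ) :
    timeFT (fun x => a * u x) t = a * timeFT u t := by
  unfold timeFT
  rw [← integral_const_mul]
  congr 1
  ext x
  ring

lemma timeFT_finset_sum {β : Type*} (s : Finset β) {u : β → ℝ → ℂ}
    (hu : ∀ b ∈ s, Integrable (u b)) (t : ℝ) :
    timeFT (fun x => ∑ b ∈ s, u b x) t = ∑ b ∈ s, timeFT (u b) t := by
  unfold timeFT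
  simp only [Finset.mul_sum]
  exact integral_finsetSum s fun b hb => integrable_osc_mul (hu b hb) t

open Convolution in
lemma integrable_shifted_conv {u v : ℝ → ℂ} (hu : Integrable u) (hv : Integrable v) (c : ℝ) :
    Integrable fun l => ∫ x, u x * v (l - c - x) :=
  (hu.integrable_convolution (ContinuousLinearMap.mul ℂ ℂ) hv).comp_sub_right c

open Convolution in
-- Convolutions become products, and the shift by c becomes the oscillation e^{itc}. This is how the
-- resonance function, a phase in time, enters the spectral convolution as a translation.
lemma timeFT_shifted_conv {u v : ℝ → ℂ} (hu : Integrable u) (hv : Integrable v) (c t : ℝ) :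
    timeFT (fun l => ∫ x, u x * v (l - c - x)) t = osc t c * timeFT u t * timeFT v t := by
  have h1 : timeFT (fun l => ∫ x, u x * v (l - c - x)) t =
      ∫ l, osc t (l + c) * ∫ x, u x * v (l - x) := by
    unfold timeFT
    rw [← integral_add_right_eq_self _ c]
    simp
  have h2 : ∀ l, osc t (l + c) * ∫ x, u x * v (l - x) =
      osc t c * ((fun x => osc t x * u x) ⋆[ContinuousLinearMap.mul ℂ ℂ, volume]
        (fun x => osc t x * v x)) l := by
    intro l
    rw [osc_add, mul_comm (osc t l), mul_assoc, ← integral_const_mul]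
    congr 1
    unfold MeasureTheory.convolution
    congr 1
    ext x
    have : osc t l = osc t x * osc t (l - x) := by rw [← osc_add, add_sub_cancel]
    rw [this]
    simp only [ContinuousLinearMap.mul_apply']
    ring
  simp_rw [h1, h2]
  rw [integral_const_mul, integral_convolution _ (integrable_osc_mul hu t)
    (integrable_osc_mul hv t), ContinuousLinearMap.mul_apply', mul_assoc]
  rfl

lemma integral_osc {l : ℝ} (hl : l ≠ 0) (t : ℝ) :
    ∫ s in (0 : ℝ)..t, osc s l = (osc t l - 1) / (Complex.I * l) := by
  have hc : Complex.I * (l : ℂ) ≠ 0 := mul_ne_zero Complex.I_ne_zero (by exact_mod_cast hl)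
  have := integral_exp_mul_complex (a := 0) (b := t) hc
  simp only [Complex.ofReal_zero, mul_zero, Complex.exp_zero] at this
  have e : ∀ s : ℝ, osc s l = Complex.exp (Complex.I * (l : ℂ) * s) := by
    intro s
    unfold osc
    congr 1
    push_cast
    ring
  simp_rw [e]
  exact this

section Cutoff

variable {ζ : ℝ → ℂ} {C : ℝ≥0∞}

lemma IsCutoff.integrable (h : IsCutoff ζ C) : Integrable ζ := by
  refine ⟨h.continuous.aestronglyMeasurable, ?_⟩
  refine (lintegral_mono fun x => h.enorm_le x).trans_lt ?_
  rw [lintegral_const_mul _ (by fun_prop)]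
  exact ENNReal.mul_lt_top h.ne_top.lt_top (lintegral_wt_rpow_lt_top (by norm_num))

lemma IsCutoff.timeFT_eq (h : IsCutoff ζ C) {t : ℝ} (ht : |t| ≤ 1) : timeFT ζ t = 1 :=
  h.integral_eq t ht

/-- The kernel is designed for this: where the cutoff equals 1, ζ(· - l) - ζ inverts to e^{itl} - 1,
and division by il gives the integral of e^{isl} from 0 to t. -/
lemma IsCutoff.integral_osc_mul_kernel (h : IsCutoff ζ C) {t : ℝ} (ht : |t| ≤ 1) {l : ℝ}
    (hl : l ≠ 0) :
    ∫ x, osc t x * duhamelKernel ζ x l = ∫ s in (0 : ℝ)..t, osc s l := by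
  rw [integral_osc hl]
  have e : ∀ x, osc t x * duhamelKernel ζ x l =
      (osc t x * ζ (x - l) - osc t x * ζ x) / (Complex.I * l) := fun x => by
    rw [duhamelKernel]; ring
  simp_rw [e]
  rw [integral_div, integral_sub (integrable_osc_mul (h.integrable.comp_sub_right l) t)
    (integrable_osc_mul h.integrable t)]
  have e1 : ∫ x, osc t x * ζ x = 1 := h.timeFT_eq ht
  have e2 : ∫ x, osc t x * ζ (x - l) = osc t l := by
    rw [← integral_add_right_eq_self _ l]
    simp only [add_sub_cancel_right, osc_add, mul_comm _ (osc t l), mul_assoc]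
    rw [integral_const_mul, e1, mul_one]
  rw [e1, e2]

lemma IsCutoff.integrable_kernel_mul (h : IsCutoff ζ C) {F : ℝ → ℂ} (hF : Integrable F)
    (t : ℝ) : Integrable (fun z : ℝ × ℝ => osc t z.1 * (duhamelKernel ζ z.1 z.2 * F z.2))
      (volume.prod volume) := by
  have hFm : AEStronglyMeasurable (fun z : ℝ × ℝ => F z.2) (volume.prod volume) :=
    hF.aestronglyMeasurable.comp_snd
  have hm : AEStronglyMeasurable
      (fun z : ℝ × ℝ => osc t z.1 * (duhamelKernel ζ z.1 z.2 * F z.2)) (volume.prod volume) :=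
    (Measurable.aestronglyMeasurable (by fun_prop)).mul
      ((measurable_duhamelKernel h.continuous).aestronglyMeasurable.mul hFm)
  refine ⟨hm, ?_⟩
  unfold HasFiniteIntegral
  rw [lintegral_prod_symm _ hm.enorm]
  have hosc : ∀ x, ‖osc t x‖ₑ = 1 := fun x => by
    rw [← ofReal_norm, norm_osc, ENNReal.ofReal_one]
  calc _ ≤ ∫⁻ l, C * 2 * wtInt 3 * ‖F l‖ₑ := by
        refine lintegral_mono fun l => ?_
        simp only [enorm_mul, hosc, one_mul]
        rw [lintegral_mul_const' _ _ enorm_ne_top]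
        gcongr
        calc _ ≤ ∫⁻ x, C * (wt (x - l) ^ (-3 : ℝ) + wt x ^ (-3 : ℝ)) := by
              refine lintegral_mono fun x => (h.kernel_le x l).trans ?_
              gcongr
              exact mul_le_of_le_one_left' (wt_rpow_le_one l (by norm_num))
          _ = _ := by
              rw [lintegral_const_mul _ (by fun_prop), lintegral_add_left (by fun_prop),
                lintegral_sub_right_eq_self (fun x => wt x ^ (-3 : ℝ)) l, ← wtInt]
              ring
    _ < ∞ := by
        rw [lintegral_const_mul'' _ hF.aestronglyMeasurable.enorm]
        refine ENNReal.mul_lt_top (ENNReal.mul_lt_top (ENNReal.mul_lt_top h.ne_top.lt_top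
          (by norm_num)) (wtInt_ne_top (by norm_num)).lt_top) hF.hasFiniteIntegral

/-- The truncated Duhamel operator is the time integral on `[-1,1]`. -/
lemma IsCutoff.timeFT_duhamel (h : IsCutoff ζ C) {F : ℝ → ℂ} (hF : Integrable F) {t : ℝ}
    (ht : |t| ≤ 1) :
    timeFT (fun x => ∫ l, duhamelKernel ζ x l * F l) t = ∫ s in (0 : ℝ)..t, timeFT F s := by
  have h1 : timeFT (fun x => ∫ l, duhamelKernel ζ x l * F l) t =
      ∫ l, ∫ x, osc t x * (duhamelKernel ζ x l * F l) := by
    unfold timeFT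
    simp_rw [← integral_const_mul]
    exact integral_integral_swap (h.integrable_kernel_mul hF t)
  have h2 : ∀ᵐ l : ℝ, ∫ x, osc t x * (duhamelKernel ζ x l * F l) =
      ∫ s in (0 : ℝ)..t, osc s l * F l := by
    -- At l = 0 the kernel is zero by the convention on division, and the identity may fail; the
    -- point is negligible.
    have : ∀ᵐ l : ℝ, l ≠ 0 := by
      simp [ae_iff]
    filter_upwards [this] with l hl
    simp_rw [← mul_assoc]
    rw [integral_mul_const, h.integral_osc_mul_kernel ht hl, intervalIntegral.integral_mul_const]
  rw [h1, integral_congr_ae h2]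
  refine (intervalIntegral_integral_swap ?_).symm
  have : IsFiniteMeasure (volume.restrict (uIoc 0 t)) := by
    rw [uIoc]
    infer_instance
  have hprod : Integrable (fun z : ℝ × ℝ => F z.2)
      ((volume.restrict (uIoc 0 t)).prod volume) := hF.comp_snd _
  exact hprod.bdd_mul (c := 1) (f := fun z : ℝ × ℝ => osc z.1 z.2)
    (Measurable.aestronglyMeasurable (by fun_prop))
    (Filter.Eventually.of_forall fun z => (norm_osc _ _).le)

end Cutoff

end PeriodicFPU

/-! ### Picard iteration for the spectra, and its limit. -/

namespace PeriodicFPU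

set_option linter.unusedSectionVars false

section Picard

variable {ι : Type*} [Fintype ι] [AddCommGroup ι] [MeasurableSpace ι] [DiscreteMeasurableSpace ι]

/-- The space-time Fourier transform of the quadratic nonlinearity. -/
noncomputable def specSrc (m : Bool → Bool → Bool → ι → ι → ℂ) (Θ : Bool → Bool → Bool → ι → ι → ℝ)
    (u v : Bool → ι × ℝ → ℂ) (σ : Bool) (p : ι × ℝ) : ℂ :=
  ∑ a, ∑ b, ∑ k₁, m σ a b p.1 k₁ * ∫ x, u a (k₁, x) * v b (p.1 - k₁, p.2 - Θ σ a b p.1 k₁ - x)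

/-- The space-time Fourier transform of the truncated bilinear Duhamel term. -/
noncomputable def specPicard (ζ : ℝ → ℂ) (m : Bool → Bool → Bool → ι → ι → ℂ)
    (Θ : Bool → Bool → Bool → ι → ι → ℝ) (u v : Bool → ι × ℝ → ℂ) (σ : Bool) (p : ι × ℝ) : ℂ :=
  ∫ l, duhamelKernel ζ p.2 l * specSrc m Θ u v σ (p.1, l)

/-- The pointwise extended norm. -/
noncomputable def eNorms (u : Bool → ι × ℝ → ℂ) (σ : Bool) (p : ι × ℝ) : ℝ≥0∞ := ‖u σ p‖ₑ

/-- The quadratic nonlinearity in the interaction picture. -/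
noncomputable def quadTerm (m : Bool → Bool → Bool → ι → ι → ℂ)
    (Θ : Bool → Bool → Bool → ι → ι → ℝ) (a b : Bool → ι → ℂ) (t : ℝ) (σ : Bool) (k : ι) : ℂ :=
  ∑ i, ∑ j, ∑ k₁, m σ i j k k₁ * (osc t (Θ σ i j k k₁) * a i k₁ * b j (k - k₁))

variable {m : Bool → Bool → Bool → ι → ι → ℂ} {Θ : Bool → Bool → Bool → ι → ι → ℝ}
variable {T : ℝ} {r : ι → ℝ} {ζ : ℝ → ℂ} {C : ℝ≥0∞}

lemma measurable_eNorms {u : Bool → ι × ℝ → ℂ} (hu : ∀ σ, Measurable (u σ)) (σ : Bool) :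
    Measurable (eNorms u σ) := (hu σ).enorm

lemma enorm_specSrc_le (hm : ∀ σ a b k k₁, ‖m σ a b k k₁‖ₑ ≤
    nonzeroInd k k₁ * ENNReal.ofReal (T * r k)) {u v : Bool → ι × ℝ → ℂ}
    (hu : ∀ σ, Measurable (u σ)) (hv : ∀ σ, Measurable (v σ)) (σ : Bool) (p : ι × ℝ) :
    ‖specSrc m Θ u v σ p‖ₑ ≤ srcMaj T r Θ (eNorms u) (eNorms v) σ p := by
  unfold specSrc srcMaj
  simp only [Finset.sum_apply]
  refine (enorm_sum_le _ _).trans (Finset.sum_le_sum fun a _ =>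
    (enorm_sum_le _ _).trans (Finset.sum_le_sum fun b _ => (enorm_sum_le _ _).trans ?_))
  unfold majConv resConv
  rw [lintegral_specMeasure
    (measurable_resConv_integrand (measurable_eNorms hu a) (measurable_eNorms hv b) p),
    Finset.mul_sum]
  refine Finset.sum_le_sum fun k₁ _ => ?_
  rw [enorm_mul]
  calc _ ≤ (nonzeroInd p.1 k₁ * ENNReal.ofReal (T * r p.1)) *
        ∫⁻ x, eNorms u a (k₁, x) * eNorms v b (p.1 - k₁, p.2 - Θ σ a b p.1 k₁ - x) := by
        refine mul_le_mul' (hm σ a b p.1 k₁) ((enorm_integral_le_lintegral_enorm _).trans ?_)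
        simp only [enorm_mul]
        exact le_rfl
    _ = _ := by
        have : nonzeroInd p.1 k₁ ≠ ∞ := ne_top_of_le_ne_top ENNReal.one_ne_top
          (nonzeroInd_le_one _ _)
        simp only
        rw [lintegral_const_mul' _ _ this]
        ring

lemma enorm_specPicard_le (hζ : IsCutoff ζ C) (hm : ∀ σ a b k k₁, ‖m σ a b k k₁‖ₑ ≤
    nonzeroInd k k₁ * ENNReal.ofReal (T * r k)) {u v : Bool → ι × ℝ → ℂ}
    (hu : ∀ σ, Measurable (u σ)) (hv : ∀ σ, Measurable (v σ)) :
    eNorms (specPicard ζ m Θ u v) ≤ picardMaj C T r Θ (eNorms u) (eNorms v) := by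
  intro σ p
  unfold eNorms specPicard picardMaj duhamelMaj
  refine (enorm_integral_le_lintegral_enorm _).trans (lintegral_mono fun l => ?_)
  rw [enorm_mul]
  exact mul_le_mul' (hζ.kernel_le _ _) (enorm_specSrc_le hm hu hv σ _)

lemma measurable_specSrc {u v : Bool → ι × ℝ → ℂ} (hu : ∀ σ, Measurable (u σ))
    (hv : ∀ σ, Measurable (v σ)) (σ : Bool) : Measurable (specSrc m Θ u v σ) := by
  unfold specSrc
  refine Finset.measurable_sum _ fun a _ => Finset.measurable_sum _ fun b _ =>
    Finset.measurable_sum _ fun k₁ _ => Measurable.mul ?_ ?_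
  · exact (Measurable.of_discrete (f := fun k => m σ a b k k₁)).comp measurable_fst
  · have hs : Measurable fun z : (ι × ℝ) × ℝ =>
        (z.1.1 - k₁, z.1.2 - Θ σ a b z.1.1 k₁ - z.2) :=
      (measurable_shift (Θ σ a b)).comp
        (measurable_fst.prodMk (measurable_const.prodMk measurable_snd))
    have h : Measurable fun z : (ι × ℝ) × ℝ =>
        u a (k₁, z.2) * v b (z.1.1 - k₁, z.1.2 - Θ σ a b z.1.1 k₁ - z.2) :=
      ((hu a).comp (measurable_const.prodMk measurable_snd)).mul ((hv b).comp hs)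
    exact h.stronglyMeasurable.integral_prod_right'.measurable

lemma measurable_specPicard (hζ : IsCutoff ζ C) {u v : Bool → ι × ℝ → ℂ}
    (hu : ∀ σ, Measurable (u σ)) (hv : ∀ σ, Measurable (v σ)) (σ : Bool) :
    Measurable (specPicard ζ m Θ u v σ) := by
  unfold specPicard
  have h : Measurable fun z : (ι × ℝ) × ℝ =>
      duhamelKernel ζ z.1.2 z.2 * specSrc m Θ u v σ (z.1.1, z.2) :=
    ((measurable_duhamelKernel hζ.continuous).comp
      ((measurable_snd.comp measurable_fst).prodMk measurable_snd)).mul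
      ((measurable_specSrc hu hv σ).comp
        ((measurable_fst.comp measurable_fst).prodMk measurable_snd))
  exact h.stronglyMeasurable.integral_prod_right'.measurable

/-- The Fourier coefficients in time of `u`. -/
noncomputable def modes (u : Bool → ι × ℝ → ℂ) (t : ℝ) (σ : Bool) (k : ι) : ℂ :=
  timeFT (fun x => u σ (k, x)) t

/-- Integrability in `τ` of each mode. -/
def ModesIntegrable (u : Bool → ι × ℝ → ℂ) : Prop := ∀ σ k, Integrable fun x => u σ (k, x)

lemma integrable_specSrc {u v : Bool → ι × ℝ → ℂ} (hu : ModesIntegrable u)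
    (hv : ModesIntegrable v) : ModesIntegrable (specSrc m Θ u v) := by
  intro σ k
  unfold specSrc
  simp only
  exact integrable_finsetSum _ fun a _ => integrable_finsetSum _ fun b _ =>
    integrable_finsetSum _ fun k₁ _ =>
      (integrable_shifted_conv (hu a k₁) (hv b (k - k₁)) (Θ σ a b k k₁)).const_mul _

lemma modes_specSrc {u v : Bool → ι × ℝ → ℂ} (hu : ModesIntegrable u)
    (hv : ModesIntegrable v) (t : ℝ) :
    modes (specSrc m Θ u v) t = quadTerm m Θ (modes u t) (modes v t) t := by
  have h3 : ∀ σ a b k k₁, Integrable fun l => m σ a b k k₁ *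
      ∫ x, u a (k₁, x) * v b (k - k₁, l - Θ σ a b k k₁ - x) := fun σ a b k k₁ =>
    (integrable_shifted_conv (hu a k₁) (hv b (k - k₁)) (Θ σ a b k k₁)).const_mul _
  ext σ k
  unfold modes specSrc quadTerm
  simp only
  rw [timeFT_finset_sum _ fun a _ => integrable_finsetSum _ fun b _ =>
    integrable_finsetSum _ fun k₁ _ => h3 σ a b k k₁]
  refine Finset.sum_congr rfl fun a _ => ?_
  rw [timeFT_finset_sum _ fun b _ => integrable_finsetSum _ fun k₁ _ => h3 σ a b k k₁]
  refine Finset.sum_congr rfl fun b _ => ?_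
  rw [timeFT_finset_sum _ fun k₁ _ => h3 σ a b k k₁]
  refine Finset.sum_congr rfl fun k₁ _ => ?_
  rw [timeFT_const_mul, timeFT_shifted_conv (hu a k₁) (hv b (k - k₁))]

lemma modes_specPicard (hζ : IsCutoff ζ C) {u v : Bool → ι × ℝ → ℂ} (hu : ModesIntegrable u)
    (hv : ModesIntegrable v) {t : ℝ} (ht : |t| ≤ 1) (σ : Bool) (k : ι) :
    modes (specPicard ζ m Θ u v) t σ k =
      ∫ s in (0 : ℝ)..t, quadTerm m Θ (modes u s) (modes v s) s σ k := by
  simp_rw [← modes_specSrc hu hv]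
  exact hζ.timeFT_duhamel (integrable_specSrc hu hv σ k) ht

lemma integrable_specPicard (hζ : IsCutoff ζ C) {u v : Bool → ι × ℝ → ℂ}
    (hu : ModesIntegrable u) (hv : ModesIntegrable v) :
    ModesIntegrable (specPicard ζ m Θ u v) := by
  intro σ k
  have h := (hζ.integrable_kernel_mul (integrable_specSrc (m := m) (Θ := Θ) hu hv σ k)
    0).integral_prod_left
  simp only [osc_zero_left, one_mul] at h
  exact h

lemma ModesIntegrable.add {u v : Bool → ι × ℝ → ℂ} (hu : ModesIntegrable u)
    (hv : ModesIntegrable v) : ModesIntegrable (u + v) := fun σ k => (hu σ k).add (hv σ k)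

lemma quadTerm_add_left (a a' b : Bool → ι → ℂ) (t : ℝ) :
    quadTerm m Θ (a + a') b t = quadTerm m Θ a b t + quadTerm m Θ a' b t := by
  ext σ k
  simp only [quadTerm, Pi.add_apply, ← Finset.sum_add_distrib]
  congr! 3
  ring

lemma quadTerm_add_right (a b b' : Bool → ι → ℂ) (t : ℝ) :
    quadTerm m Θ a (b + b') t = quadTerm m Θ a b t + quadTerm m Θ a b' t := by
  ext σ k
  simp only [quadTerm, Pi.add_apply, ← Finset.sum_add_distrib]
  congr! 3
  ring

lemma modes_add {u v : Bool → ι × ℝ → ℂ} (hu : ModesIntegrable u) (hv : ModesIntegrable v)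
    (t : ℝ) : modes (u + v) t = modes u t + modes v t := by
  ext σ k
  exact timeFT_add (hu σ k) (hv σ k) t

lemma continuous_modes {u : Bool → ι × ℝ → ℂ} (hu : ModesIntegrable u) (σ : Bool) (k : ι) :
    Continuous fun t => modes u t σ k := continuous_timeFT (hu σ k)

lemma continuous_quadTerm {a b : ℝ → Bool → ι → ℂ} (ha : ∀ σ k, Continuous fun t => a t σ k)
    (hb : ∀ σ k, Continuous fun t => b t σ k) (σ : Bool) (k : ι) :
    Continuous fun t => quadTerm m Θ (a t) (b t) t σ k := by
  unfold quadTerm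
  refine continuous_finsetSum _ fun i _ => continuous_finsetSum _ fun j _ =>
    continuous_finsetSum _ fun k₁ _ => ?_
  have h1 := ha i k₁
  have h2 := hb j (k - k₁)
  fun_prop

/-- The space-time Fourier transforms of the Picard iterates and of their increments. -/
noncomputable def specIter (ζ : ℝ → ℂ) (m : Bool → Bool → Bool → ι → ι → ℂ)
    (Θ : Bool → Bool → Bool → ι → ι → ℝ) (a₀ : Bool → ι → ℂ) :
    ℕ → (Bool → ι × ℝ → ℂ) × (Bool → ι × ℝ → ℂ)
  | 0 => (0, fun σ p => a₀ σ p.1 * ζ p.2)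
  | n + 1 =>
    let g := (specIter ζ m Θ a₀ n).1
    let d := (specIter ζ m Θ a₀ n).2
    (g + d, specPicard ζ m Θ d (g + d) + specPicard ζ m Θ g d)

/-- The majorant of the free evolution. -/
noncomputable def dataMaj (C : ℝ≥0∞) (a₀ : Bool → ι → ℂ) (σ : Bool) (p : ι × ℝ) : ℝ≥0∞ :=
  ‖a₀ σ p.1‖ₑ * (C * wt p.2 ^ (-3 : ℝ))

lemma measurable_dataMaj (C : ℝ≥0∞) (a₀ : Bool → ι → ℂ) (σ : Bool) :
    Measurable (dataMaj C a₀ σ) := by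
  unfold dataMaj
  exact ((Measurable.of_discrete (f := fun k => ‖a₀ σ k‖ₑ)).comp measurable_fst).mul
    (by fun_prop)

variable {a₀ : Bool → ι → ℂ}

lemma measurable_specIter (hζ : IsCutoff ζ C) (n : ℕ) :
    (∀ σ, Measurable ((specIter ζ m Θ a₀ n).1 σ)) ∧
      ∀ σ, Measurable ((specIter ζ m Θ a₀ n).2 σ) := by
  induction n with
  | zero =>
    refine ⟨fun σ => measurable_zero, fun σ => ?_⟩
    exact ((Measurable.of_discrete (f := fun k => a₀ σ k)).comp measurable_fst).mul
      (hζ.continuous.measurable.comp measurable_snd)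
  | succ n ih =>
    have h1 : ∀ σ, Measurable (((specIter ζ m Θ a₀ n).1 + (specIter ζ m Θ a₀ n).2) σ) :=
      fun σ => (ih.1 σ).add (ih.2 σ)
    exact ⟨h1, fun σ => (measurable_specPicard hζ ih.2 h1 σ).add
      (measurable_specPicard hζ ih.1 ih.2 σ)⟩

lemma eNorms_add_le (u v : Bool → ι × ℝ → ℂ) : eNorms (u + v) ≤ eNorms u + eNorms v :=
  fun _ _ => enorm_add_le _ _

/-- The spectral and the majorant iteration have the same shape, and each ingredient (cutoff,
kernel, symbol) is bounded in absolute value by its majorant; domination thus propagates through the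
increments. -/
lemma eNorms_specIter_le (hζ : IsCutoff ζ C) (hm : ∀ σ a b k k₁, ‖m σ a b k k₁‖ₑ ≤
    nonzeroInd k k₁ * ENNReal.ofReal (T * r k)) (n : ℕ) :
    eNorms (specIter ζ m Θ a₀ n).1 ≤ (majIter C T r Θ (dataMaj C a₀) n).1 ∧
      eNorms (specIter ζ m Θ a₀ n).2 ≤ (majIter C T r Θ (dataMaj C a₀) n).2 := by
  induction n with
  | zero =>
    refine ⟨fun σ p => ?_, fun σ p => ?_⟩
    · simp [eNorms, specIter]
    · simp only [eNorms, specIter, majIter, dataMaj, enorm_mul]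
      gcongr
      exact hζ.enorm_le _
  | succ n ih =>
    obtain ⟨hg, hd⟩ := measurable_specIter (m := m) (Θ := Θ) (a₀ := a₀) hζ n
    have hgd := (measurable_specIter (m := m) (Θ := Θ) (a₀ := a₀) hζ (n + 1)).1
    have h1 : eNorms (specIter ζ m Θ a₀ (n + 1)).1 ≤ (majIter C T r Θ (dataMaj C a₀) (n + 1)).1 :=
      (eNorms_add_le _ _).trans (add_le_add ih.1 ih.2)
    refine ⟨h1, (eNorms_add_le _ _).trans (add_le_add ?_ ?_)⟩
    · exact (enorm_specPicard_le hζ hm hd hgd).trans (picardMaj_mono ih.2 h1)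
    · exact (enorm_specPicard_le hζ hm hg hd).trans (picardMaj_mono ih.1 ih.2)

lemma specIter_fst_eq_sum (n : ℕ) :
    (specIter ζ m Θ a₀ n).1 = ∑ i ∈ Finset.range n, (specIter ζ m Θ a₀ i).2 := by
  induction n with
  | zero => rfl
  | succ n ih =>
    rw [Finset.sum_range_succ, ← ih]
    rfl

lemma integrable_specIter (hζ : IsCutoff ζ C) (n : ℕ) :
    ModesIntegrable (specIter ζ m Θ a₀ n).1 ∧ ModesIntegrable (specIter ζ m Θ a₀ n).2 := by
  induction n with
  | zero => exact ⟨fun σ k => integrable_zero _ _ _, fun σ k => hζ.integrable.const_mul (a₀ σ k)⟩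
  | succ n ih =>
    exact ⟨ih.1.add ih.2, (integrable_specPicard hζ ih.2 (ih.1.add ih.2)).add
      (integrable_specPicard hζ ih.1 ih.2)⟩

/-- The increments recombine by bilinearity as in `majIter_succ_fst`. The restriction |t| ≤ 1 is
where the cutoff is one and the truncated Duhamel operator is the true time integral. -/
lemma modes_specIter_succ (hζ : IsCutoff ζ C) (n : ℕ) {t : ℝ} (ht : |t| ≤ 1) (σ : Bool) (k : ι) :
    modes (specIter ζ m Θ a₀ (n + 1)).1 t σ k = a₀ σ k +
      ∫ s in (0 : ℝ)..t, quadTerm m Θ (modes (specIter ζ m Θ a₀ n).1 s)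
        (modes (specIter ζ m Θ a₀ n).1 s) s σ k := by
  induction n with
  | zero =>
    have h1 : modes (specIter ζ m Θ a₀ 1).1 t σ k = a₀ σ k := by
      change timeFT (fun x => (0 : ℂ) + a₀ σ k * ζ x) t = _
      simp only [zero_add]
      rw [timeFT_const_mul, hζ.timeFT_eq ht, mul_one]
    rw [h1]
    simp [specIter, modes, quadTerm, timeFT]
  | succ n ih =>
    obtain ⟨hg, hd⟩ := integrable_specIter (m := m) (Θ := Θ) (a₀ := a₀) hζ n
    have hgd := hg.add hd
    set g := (specIter ζ m Θ a₀ n).1 with hgdef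
    set d := (specIter ζ m Θ a₀ n).2 with hddef
    have e1 : (specIter ζ m Θ a₀ (n + 1)).1 = g + d := rfl
    have e2 : (specIter ζ m Θ a₀ (n + 1)).2 =
      specPicard ζ m Θ d (g + d) + specPicard ζ m Θ g d := rfl
    have e3 : (specIter ζ m Θ a₀ (n + 2)).1 =
      (specIter ζ m Θ a₀ (n + 1)).1 + (specIter ζ m Θ a₀ (n + 1)).2 := rfl
    have hA := integrable_specIter (m := m) (Θ := Θ) (a₀ := a₀) hζ (n + 1)
    rw [e3, modes_add hA.1 hA.2, Pi.add_apply, Pi.add_apply, ih, e2]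
    rw [e1]
    have e4 : modes (specPicard ζ m Θ d (g + d) + specPicard ζ m Θ g d) t σ k =
        modes (specPicard ζ m Θ d (g + d)) t σ k + modes (specPicard ζ m Θ g d) t σ k := by
      rw [modes_add (integrable_specPicard hζ hd hgd) (integrable_specPicard hζ hg hd)]
      rfl
    rw [e4, modes_specPicard hζ hd hgd ht, modes_specPicard hζ hg hd ht, add_assoc]
    congr 1
    have c : ∀ {u v : Bool → ι × ℝ → ℂ}, ModesIntegrable u → ModesIntegrable v →
        IntervalIntegrable (fun s => quadTerm m Θ (modes u s) (modes v s) s σ k) volume 0 t :=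
      fun hu hv => (continuous_quadTerm (continuous_modes hu) (continuous_modes hv) σ
        k).intervalIntegrable _ _
    rw [← intervalIntegral.integral_add (c hd hgd) (c hg hd),
      ← intervalIntegral.integral_add (c hg hg) ((c hd hgd).add (c hg hd))]
    refine intervalIntegral.integral_congr fun s _ => ?_
    rw [modes_add hg hd, quadTerm_add_left, quadTerm_add_right (modes g s)]
    simp only [Pi.add_apply]
    ring

/-- Existence for the system in the interaction picture, with a bound in the `Y`-norm. -/
theorem exists_spectral_solution {c : ℝ} {B D : ℝ≥0∞}
    (h : ∀ σ a b, IsResonant c T B D r (Θ σ a b)) (hζ : IsCutoff ζ C)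
    (hm : ∀ σ a b k k₁, ‖m σ a b k k₁‖ₑ ≤ nonzeroInd k k₁ * ENNReal.ofReal (T * r k))
    (hsmall : 64 * (32 * duhamelConst C * bilConst c T B D) * ySys (dataMaj C a₀) ≤ 1)
    (hfin : ySys (dataMaj C a₀) ≠ ∞) :
    ∃ g : Bool → ι × ℝ → ℂ, ModesIntegrable g ∧ ySys (eNorms g) ≤ 8 * ySys (dataMaj C a₀) ∧
      ∀ t : ℝ, |t| ≤ 1 → ∀ σ k, modes g t σ k = a₀ σ k +
        ∫ s in (0 : ℝ)..t, quadTerm m Θ (modes g s) (modes g s) s σ k := by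
  have hAm := measurable_dataMaj C a₀
  -- M is integrable in τ for every mode, hence finite almost everywhere, and it dominates every
  -- iterate as well as the sum of all increments. It replaces a contraction argument.
  set M := majLimit C T r Θ (dataMaj C a₀) with hMdef
  have hM : ySys M ≤ 8 * ySys (dataMaj C a₀) := ySys_majLimit_le h hAm hsmall
  have hMm : ∀ σ, Measurable (M σ) := measurable_majLimit hAm
  have hMtop : ySys M ≠ ∞ := ne_top_of_le_ne_top (ENNReal.mul_ne_top (by norm_num) hfin) hM
  have hMint : ∀ σ k, ∫⁻ x, M σ (k, x) < ∞ := lintegral_lt_top_of_ySys hMtop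
  have hMk : ∀ σ k, Measurable fun x => M σ (k, x) := fun σ k =>
    (hMm σ).comp measurable_prodMk_left
  set d : ℕ → Bool → ι × ℝ → ℂ := fun n => (specIter ζ m Θ a₀ n).2 with hd
  have hdM : ∀ σ p, ∑' n, ‖d n σ p‖ₑ ≤ M σ p := fun σ p =>
    ENNReal.tsum_le_tsum fun n => (eNorms_specIter_le hζ hm n).2 σ p
  set g : Bool → ι × ℝ → ℂ := fun σ p => ∑' n, d n σ p with hg
  have hgM : ∀ σ p, ‖g σ p‖ₑ ≤ M σ p := fun σ p => enorm_tsum_le_tsum_enorm.trans (hdM σ p)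
  have hgn : ∀ n σ p, (specIter ζ m Θ a₀ n).1 σ p = ∑ i ∈ Finset.range n, d i σ p := by
    intro n σ p
    rw [specIter_fst_eq_sum]
    simp [hd]
  have hgnM : ∀ n σ p, ‖(specIter ζ m Θ a₀ n).1 σ p‖ₑ ≤ M σ p := by
    intro n σ p
    rw [hgn]
    exact (enorm_sum_le _ _).trans ((ENNReal.sum_le_tsum _).trans (hdM σ p))
  have hfinite : ∀ σ k, ∀ᵐ x, M σ (k, x) < ∞ := fun σ k =>
    ae_lt_top (hMk σ k) (hMint σ k).ne
  have hlim : ∀ σ k, ∀ᵐ x : ℝ, Filter.Tendsto (fun n => (specIter ζ m Θ a₀ n).1 σ (k, x))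
      Filter.atTop (nhds (g σ (k, x))) := by
    intro σ k
    filter_upwards [hfinite σ k] with x hx
    simp only [hgn]
    exact (Summable.of_enorm ((hdM σ (k, x)).trans_lt hx).ne).hasSum.tendsto_sum_nat
  have hbint : ∀ σ k, Integrable fun x => (M σ (k, x)).toReal := fun σ k =>
    integrable_toReal_of_lintegral_ne_top (hMk σ k).aemeasurable (hMint σ k).ne
  have hnorm : ∀ {σ k} {z : ℂ} {x}, M σ (k, x) < ∞ → ‖z‖ₑ ≤ M σ (k, x) →
      ‖z‖ ≤ (M σ (k, x)).toReal := by
    intro σ k z x hx hz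
    have := ENNReal.toReal_mono hx.ne hz
    simpa using this
  have hgnI := fun n => (integrable_specIter (m := m) (Θ := Θ) (a₀ := a₀) hζ n).1
  have hgI : ModesIntegrable g := by
    intro σ k
    refine (hbint σ k).mono' (aestronglyMeasurable_of_tendsto_ae Filter.atTop
      (fun n => (hgnI n σ k).aestronglyMeasurable) (hlim σ k)) ?_
    filter_upwards [hfinite σ k] with x hx
    exact hnorm hx (hgM σ (k, x))
  have hmodes : ∀ t σ k, Filter.Tendsto (fun n => modes (specIter ζ m Θ a₀ n).1 t σ k)
      Filter.atTop (nhds (modes g t σ k)) := by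
    intro t σ k
    refine tendsto_integral_of_dominated_convergence (fun x => (M σ (k, x)).toReal)
      (fun n => (integrable_osc_mul (hgnI n σ k) t).aestronglyMeasurable) (hbint σ k)
      (fun n => ?_) ?_
    · filter_upwards [hfinite σ k] with x hx
      rw [norm_mul, norm_osc, one_mul]
      exact hnorm hx (hgnM n σ (k, x))
    · filter_upwards [hlim σ k] with x hx
      exact hx.const_mul _
  have hbound : ∀ n t σ k, ‖modes (specIter ζ m Θ a₀ n).1 t σ k‖ ≤
      ∫ x, (M σ (k, x)).toReal := by
    intro n t σ k
    refine (norm_timeFT_le _ t).trans (integral_mono_ae (hgnI n σ k).norm (hbint σ k) ?_)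
    filter_upwards [hfinite σ k] with x hx
    exact hnorm hx (hgnM n σ (k, x))
  refine ⟨g, hgI, le_trans ?_ hM, fun t ht σ k => ?_⟩
  · unfold ySys ySq
    gcongr
    · exact hgM _ _
    · exact hgM _ _
  · have h1 := (hmodes t σ k).comp (Filter.tendsto_add_atTop_nat 1)
    refine tendsto_nhds_unique h1 ?_
    simp only [Function.comp_def, modes_specIter_succ hζ _ ht]
    refine Filter.Tendsto.const_add _ ?_
    -- The integrals of M bound all modes of all iterates at all times, so the quadratic terms have
    -- a bound constant in time.
    refine intervalIntegral.tendsto_integral_filter_of_dominated_convergence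
      (fun _ => ∑ i, ∑ j, ∑ k₁, ‖m σ i j k k₁‖ *
        ((∫ x, (M i (k₁, x)).toReal) * ∫ x, (M j (k - k₁, x)).toReal)) ?_ ?_ ?_ ?_
    · exact Filter.Eventually.of_forall fun n => (continuous_quadTerm (continuous_modes (hgnI n))
        (continuous_modes (hgnI n)) σ k).aestronglyMeasurable
    · refine Filter.Eventually.of_forall fun n => Filter.Eventually.of_forall fun s _ => ?_
      unfold quadTerm
      refine (norm_sum_le _ _).trans (Finset.sum_le_sum fun i _ =>
        (norm_sum_le _ _).trans (Finset.sum_le_sum fun j _ =>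
          (norm_sum_le _ _).trans (Finset.sum_le_sum fun k₁ _ => ?_)))
      rw [norm_mul, norm_mul, norm_mul, norm_osc, one_mul]
      gcongr
      · exact hbound n s i k₁
      · exact hbound n s j _
    · exact intervalIntegrable_const
    · refine Filter.Eventually.of_forall fun s _ => ?_
      unfold quadTerm
      refine tendsto_finsetSum _ fun i _ => tendsto_finsetSum _ fun j _ =>
        tendsto_finsetSum _ fun k₁ _ => Filter.Tendsto.const_mul _ ?_
      exact ((hmodes s i k₁).const_mul _).mul (hmodes s j _)

end Picard

end PeriodicFPU

/-! ### Constants uniform in the set of frequencies and explicit in T. -/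

namespace PeriodicFPU

set_option linter.unusedSectionVars false

section Uniform

variable {ι : Type*} [Fintype ι] [AddCommGroup ι] [MeasurableSpace ι] [DiscreteMeasurableSpace ι]

lemma ySys_dataMaj (C : ℝ≥0∞) (a₀ : Bool → ι → ℂ) :
    ySys (dataMaj C a₀) =
      C ^ 2 * (wtInt 5 + wtInt 3 ^ 2) * ENNReal.ofReal (∑ σ, ∑ k, ‖a₀ σ k‖ ^ 2) := by
  have e0 : ENNReal.ofReal (∑ σ, ∑ k, ‖a₀ σ k‖ ^ 2) = ∑ σ, ∑ k, ‖a₀ σ k‖ₑ ^ 2 := by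
    rw [ENNReal.ofReal_sum_of_nonneg fun _ _ => Finset.sum_nonneg fun _ _ => by positivity]
    refine Finset.sum_congr rfl fun σ _ => ?_
    rw [ENNReal.ofReal_sum_of_nonneg fun _ _ => by positivity]
    refine Finset.sum_congr rfl fun k _ => ?_
    rw [ENNReal.ofReal_pow (norm_nonneg _), ofReal_norm]
  rw [e0, Finset.mul_sum]
  unfold ySys
  refine Finset.sum_congr rfl fun σ _ => ?_
  have hm := measurable_dataMaj C a₀ σ
  unfold ySq
  rw [lintegral_specMeasure (by fun_prop), ← Finset.sum_add_distrib, Finset.mul_sum]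
  refine Finset.sum_congr rfl fun k _ => ?_
  have e1 : ∫⁻ x, wt x * dataMaj C a₀ σ (k, x) ^ 2 = ‖a₀ σ k‖ₑ ^ 2 * C ^ 2 * wtInt 5 := by
    rw [wtInt, ← lintegral_const_mul _ (by fun_prop)]
    refine lintegral_congr fun x => ?_
    unfold dataMaj
    calc _ = ‖a₀ σ k‖ₑ ^ 2 * C ^ 2 * (wt x ^ (1 : ℝ) * (wt x ^ (-3 : ℝ)) ^ 2) := by
          rw [ENNReal.rpow_one]; ring
      _ = _ := by rw [wt_rpow_sq, wt_rpow_mul_rpow]; norm_num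
  have e2 : ∫⁻ x, dataMaj C a₀ σ (k, x) = ‖a₀ σ k‖ₑ * (C * wtInt 3) := by
    unfold dataMaj
    simp only
    rw [lintegral_const_mul _ (by fun_prop), lintegral_const_mul _ (by fun_prop), ← wtInt]
  simp only
  rw [e1, e2]
  ring

/-- The finite constant in the bound of `bilConst` by a power of `T`. -/
noncomputable def bilConst' (c S : ℝ) (D : ℝ≥0∞) : ℝ≥0∞ :=
  48 * ENNReal.ofReal (36 / c ^ 2 * S) * (4 * wtInt (9 / 8)) +
  16 * (ENNReal.ofReal (36 / c ^ 2) * D +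
    2 * ENNReal.ofReal (36 / c ^ 2 * S) * wtInt (5 / 4) * (4 * wtInt (9 / 8)))

lemma bilConst'_ne_top (c S : ℝ) {D : ℝ≥0∞} (hD : D ≠ ∞) : bilConst' c S D ≠ ∞ := by
  have h1 : wtInt (9 / 8) ≠ ∞ := wtInt_ne_top (by norm_num)
  have h2 : wtInt (5 / 4) ≠ ∞ := wtInt_ne_top (by norm_num)
  unfold bilConst'
  finiteness

/-- The two sources of T: half powers of modulation give (T^{1/2})²T^{-5/8} = T^{3/8} after
counting, and the smoothed term gives (T^{1/8})² = T^{1/4}. As T ≤ 1, the smaller exponent wins. -/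
lemma bilConst_le {c S T : ℝ} (hc : 0 < c) (hS : 0 ≤ S) (hT : 0 < T) (hT1 : T ≤ 1) (D : ℝ≥0∞) :
    bilConst c T (ENNReal.ofReal (S * T ^ (-(5 / 8) : ℝ))) D ≤
      bilConst' c S D * ENNReal.ofReal (T ^ (1 / 4 : ℝ)) := by
  have e1 : ENNReal.ofReal (6 / c * T ^ (1 / 8 : ℝ)) ^ 2 =
      ENNReal.ofReal (36 / c ^ 2) * ENNReal.ofReal (T ^ (1 / 4 : ℝ)) := by
    rw [← ENNReal.ofReal_pow (by positivity), ← ENNReal.ofReal_mul (by positivity), mul_pow,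
      ← Real.rpow_natCast (T ^ (1 / 8 : ℝ)), ← Real.rpow_mul hT.le]
    norm_num [div_pow]
  have e2 : ENNReal.ofReal (6 / c * T ^ (1 / 2 : ℝ)) ^ 2 *
      ENNReal.ofReal (S * T ^ (-(5 / 8) : ℝ)) ≤
      ENNReal.ofReal (36 / c ^ 2 * S) * ENNReal.ofReal (T ^ (1 / 4 : ℝ)) := by
    rw [← ENNReal.ofReal_pow (by positivity), ← ENNReal.ofReal_mul (by positivity),
      ← ENNReal.ofReal_mul (by positivity), mul_pow,
      ← Real.rpow_natCast (T ^ (1 / 2 : ℝ)), ← Real.rpow_mul hT.le]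
    refine ENNReal.ofReal_le_ofReal ?_
    calc _ = 36 / c ^ 2 * S * (T ^ (1 / 2 * ((2 : ℕ) : ℝ)) * T ^ (-(5 / 8) : ℝ)) := by
          rw [div_pow]; ring
      _ = 36 / c ^ 2 * S * T ^ (3 / 8 : ℝ) := by rw [← Real.rpow_add hT]; norm_num
      _ ≤ _ := by
          gcongr ?_ * ?_
          exact Real.rpow_le_rpow_of_exponent_ge hT hT1 (by norm_num)
  unfold bilConst bilConst'
  rw [e1]
  set E := ENNReal.ofReal (6 / c * T ^ (1 / 2 : ℝ)) ^ 2
  set F := ENNReal.ofReal (S * T ^ (-(5 / 8) : ℝ))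
  set Q := ENNReal.ofReal (T ^ (1 / 4 : ℝ))
  calc _ = 48 * (E * F) * (4 * wtInt (9 / 8)) + 16 * (ENNReal.ofReal (36 / c ^ 2) * Q * D +
        2 * (E * F) * wtInt (5 / 4) * (4 * wtInt (9 / 8))) := by ring
    _ ≤ 48 * (ENNReal.ofReal (36 / c ^ 2 * S) * Q) * (4 * wtInt (9 / 8)) +
        16 * (ENNReal.ofReal (36 / c ^ 2) * Q * D +
        2 * (ENNReal.ofReal (36 / c ^ 2 * S) * Q) * wtInt (5 / 4) * (4 * wtInt (9 / 8))) := by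
        gcongr
    _ = _ := by ring

end Uniform

/-- Existence in the interaction picture with constants uniform in the set of frequencies. -/
theorem exists_uniform_spectral_solution {c S : ℝ} (hc : 0 < c) (hS : 0 ≤ S) {D : ℝ≥0∞}
    (hD : D ≠ ∞) : ∃ K : ℝ, 0 < K ∧ ∀ (ι : Type) [Fintype ι] [AddCommGroup ι] [MeasurableSpace ι]
    [DiscreteMeasurableSpace ι] (T : ℝ) (r : ι → ℝ) (Θ : Bool → Bool → Bool → ι → ι → ℝ)
    (m : Bool → Bool → Bool → ι → ι → ℂ) (a₀ : Bool → ι → ℂ), 0 < T → T ≤ 1 →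
    (∀ σ a b, IsResonant c T (ENNReal.ofReal (S * T ^ (-(5 / 8) : ℝ))) D r (Θ σ a b)) →
    (∀ σ a b k k₁, ‖m σ a b k k₁‖ₑ ≤ nonzeroInd k k₁ * ENNReal.ofReal (T * r k)) →
    K * T ^ (1 / 4 : ℝ) * (∑ σ, ∑ k, ‖a₀ σ k‖ ^ 2) ≤ 1 →
    ∃ g : Bool → ι × ℝ → ℂ, ModesIntegrable g ∧
      ySys (eNorms g) ≤ ENNReal.ofReal (K * ∑ σ, ∑ k, ‖a₀ σ k‖ ^ 2) ∧
      ∀ t : ℝ, |t| ≤ 1 → ∀ σ k, modes g t σ k = a₀ σ k +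
        ∫ s in (0 : ℝ)..t, quadTerm m Θ (modes g s) (modes g s) s σ k := by
  obtain ⟨ζ, C, hζ⟩ := exists_isCutoff
  have hC := hζ.ne_top
  have h5 : wtInt 5 ≠ ∞ := wtInt_ne_top (by norm_num)
  have h3 : wtInt 3 ≠ ∞ := wtInt_ne_top (by norm_num)
  have h2 : wtInt 2 ≠ ∞ := wtInt_ne_top (by norm_num)
  have hb := bilConst'_ne_top c S hD
  set P : ℝ≥0∞ := C ^ 2 * (wtInt 5 + wtInt 3 ^ 2) with hP
  have hPtop : P ≠ ∞ := by rw [hP]; finiteness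
  have hd : duhamelConst C ≠ ∞ := by unfold duhamelConst; finiteness
  set L : ℝ≥0∞ := 64 * (32 * duhamelConst C * bilConst' c S D) * P with hL
  have hLtop : L ≠ ∞ := by rw [hL]; finiteness
  -- One constant serves both the smallness condition (the summand L) and the final bound (8P); the
  -- summand 1 ensures positivity.
  refine ⟨L.toReal + (8 * P).toReal + 1, by positivity, ?_⟩
  intro ι _ _ _ _ T r Θ m a₀ hT hT1 hres hm hsmall
  set R2 : ℝ := ∑ σ, ∑ k, ‖a₀ σ k‖ ^ 2 with hR2
  have hR0 : 0 ≤ R2 := Finset.sum_nonneg fun _ _ => Finset.sum_nonneg fun _ _ => by positivity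
  have hdata : ySys (dataMaj C a₀) = P * ENNReal.ofReal R2 := ySys_dataMaj C a₀
  have hs : 64 * (32 * duhamelConst C *
      bilConst c T (ENNReal.ofReal (S * T ^ (-(5 / 8) : ℝ))) D) * ySys (dataMaj C a₀) ≤ 1 := by
    calc _ ≤ 64 * (32 * duhamelConst C * (bilConst' c S D * ENNReal.ofReal (T ^ (1 / 4 : ℝ)))) *
          (P * ENNReal.ofReal R2) := by
          rw [hdata]
          gcongr
          exact bilConst_le hc hS hT hT1 D
      _ = L * ENNReal.ofReal (T ^ (1 / 4 : ℝ)) * ENNReal.ofReal R2 := by rw [hL]; ring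
      _ = ENNReal.ofReal (L.toReal * T ^ (1 / 4 : ℝ) * R2) := by
          rw [ENNReal.ofReal_mul (by positivity), ENNReal.ofReal_mul (by positivity),
            ENNReal.ofReal_toReal hLtop]
      _ ≤ 1 := by
          rw [ENNReal.ofReal_le_one]
          refine le_trans ?_ hsmall
          gcongr
          have : 0 ≤ (8 * P).toReal := ENNReal.toReal_nonneg
          linarith
  obtain ⟨g, h1, h2, h3⟩ := exists_spectral_solution hres hζ hm hs (by rw [hdata]; finiteness)
  refine ⟨g, h1, h2.trans ?_, h3⟩
  rw [hdata, ← mul_assoc, ENNReal.ofReal_mul (by positivity)]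
  gcongr
  rw [ENNReal.le_ofReal_iff_toReal_le (by finiteness) (by positivity)]
  have : 0 ≤ L.toReal := ENNReal.toReal_nonneg
  linarith

/-! ### Uniqueness for the finite-dimensional integral equation. -/

section Uniqueness

variable {ι : Type*} [Fintype ι] [AddCommGroup ι]

lemma continuousOn_quadTerm {m : Bool → Bool → Bool → ι → ι → ℂ}
    {Θ : Bool → Bool → Bool → ι → ι → ℝ} {a : ℝ → Bool → ι → ℂ} {s : Set ℝ}
    (ha : ContinuousOn a s) (σ : Bool) (k : ι) :
    ContinuousOn (fun t => quadTerm m Θ (a t) (a t) t σ k) s := by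
  have h : ∀ σ k, ContinuousOn (fun t => a t σ k) s := fun σ k =>
    continuousOn_pi.1 (continuousOn_pi.1 ha σ) k
  unfold quadTerm
  refine continuousOn_finsetSum _ fun i _ => continuousOn_finsetSum _ fun j _ =>
    continuousOn_finsetSum _ fun k₁ _ => ContinuousOn.mul continuousOn_const ?_
  exact ((Continuous.continuousOn (by fun_prop)).mul (h i k₁)).mul (h j _)

lemma norm_quadTerm_sub_le (m : Bool → Bool → Bool → ι → ι → ℂ)
    (Θ : Bool → Bool → Bool → ι → ι → ℝ) {M : ℝ} {a b : Bool → ι → ℂ} (ha : ‖a‖ ≤ M)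
    (hb : ‖b‖ ≤ M) (t : ℝ) (σ : Bool) (k : ι) :
    ‖quadTerm m Θ a a t σ k - quadTerm m Θ b b t σ k‖ ≤
      (∑ i, ∑ j, ∑ k₁, ‖m σ i j k k₁‖) * (2 * M) * ‖a - b‖ := by
  have happ : ∀ (c : Bool → ι → ℂ) i k, ‖c i k‖ ≤ ‖c‖ := fun c i k =>
    (norm_le_pi_norm (c i) k).trans (norm_le_pi_norm c i)
  unfold quadTerm
  simp only [← Finset.sum_sub_distrib, Finset.sum_mul]
  refine (norm_sum_le _ _).trans (Finset.sum_le_sum fun i _ =>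
    (norm_sum_le _ _).trans (Finset.sum_le_sum fun j _ =>
      (norm_sum_le _ _).trans (Finset.sum_le_sum fun k₁ _ => ?_)))
  have e : m σ i j k k₁ * (osc t (Θ σ i j k k₁) * a i k₁ * a j (k - k₁)) -
      m σ i j k k₁ * (osc t (Θ σ i j k k₁) * b i k₁ * b j (k - k₁)) =
      m σ i j k k₁ * osc t (Θ σ i j k k₁) *
        ((a - b) i k₁ * a j (k - k₁) + b i k₁ * (a - b) j (k - k₁)) := by
    simp only [Pi.sub_apply]
    ring
  rw [e, norm_mul, norm_mul, norm_osc, mul_one, mul_assoc]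
  refine mul_le_mul_of_nonneg_left ?_ (norm_nonneg _)
  have hM : 0 ≤ M := (norm_nonneg a).trans ha
  calc _ ≤ ‖(a - b) i k₁‖ * ‖a j (k - k₁)‖ + ‖b i k₁‖ * ‖(a - b) j (k - k₁)‖ := by
        refine (norm_add_le _ _).trans ?_
        rw [norm_mul, norm_mul]
    _ ≤ ‖a - b‖ * M + M * ‖a - b‖ := by
        gcongr
        · exact happ _ _ _
        · exact (happ _ _ _).trans ha
        · exact (happ _ _ _).trans hb
        · exact happ _ _ _
    _ = _ := by ring

/-- Uniqueness of continuous solutions of the integral equation on a symmetric interval. -/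
theorem quadTerm_solution_unique (m : Bool → Bool → Bool → ι → ι → ℂ)
    (Θ : Bool → Bool → Bool → ι → ι → ℝ) (a₀ : Bool → ι → ℂ) {T : ℝ} (hT : 0 < T)
    {a b : ℝ → Bool → ι → ℂ} (ha : ContinuousOn a (Icc (-T) T)) (hb : ContinuousOn b (Icc (-T) T))
    (ha' : ∀ t ∈ Icc (-T) T, ∀ σ k, a t σ k = a₀ σ k +
      ∫ s in (0 : ℝ)..t, quadTerm m Θ (a s) (a s) s σ k)
    (hb' : ∀ t ∈ Icc (-T) T, ∀ σ k, b t σ k = a₀ σ k +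
      ∫ s in (0 : ℝ)..t, quadTerm m Θ (b s) (b s) s σ k) :
    EqOn a b (Icc (-T) T) := by
  have hderiv : ∀ {f : ℝ → Bool → ι → ℂ}, ContinuousOn f (Icc (-T) T) →
      (∀ t ∈ Icc (-T) T, ∀ σ k, f t σ k = a₀ σ k +
        ∫ s in (0 : ℝ)..t, quadTerm m Θ (f s) (f s) s σ k) →
      ∀ t ∈ Ioo (-T) T, HasDerivAt f (quadTerm m Θ (f t) (f t) t) t := by
    intro f hf hf' t ht
    rw [hasDerivAt_pi]
    intro σ
    rw [hasDerivAt_pi]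
    intro k
    have hq := continuousOn_quadTerm (m := m) (Θ := Θ) hf σ k
    have hqo := hq.mono Ioo_subset_Icc_self
    have hnhds : Ioo (-T) T ∈ nhds t := isOpen_Ioo.mem_nhds ht
    have h0 : (0 : ℝ) ∈ Icc (-T) T := ⟨by linarith, hT.le⟩
    have hint : IntervalIntegrable (fun s => quadTerm m Θ (f s) (f s) s σ k) volume 0 t :=
      (hq.mono (uIcc_subset_Icc h0 (Ioo_subset_Icc_self ht))).intervalIntegrable
    have hd := (intervalIntegral.integral_hasDerivAt_right hint
      (hqo.stronglyMeasurableAtFilter isOpen_Ioo t ht) (hqo.continuousAt hnhds)).const_add (a₀ σ k)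
    refine hd.congr_of_eventuallyEq ?_
    filter_upwards [hnhds] with x hx
    exact hf' x (Ioo_subset_Icc_self hx) σ k
  obtain ⟨Ma, hMa⟩ := isCompact_Icc.exists_bound_of_continuousOn ha
  obtain ⟨Mb, hMb⟩ := isCompact_Icc.exists_bound_of_continuousOn hb
  set M := max (max Ma Mb) 0 with hM
  set L : ℝ := (∑ σ, ∑ k, ∑ i, ∑ j, ∑ k₁, ‖m σ i j k k₁‖) * (2 * M) with hL
  have hM0 : 0 ≤ M := le_max_right _ _
  have hL0 : 0 ≤ L := by positivity
  -- Both solutions stay in a ball of radius M, on which the quadratic right-hand side is Lipschitz.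
  -- The constant may depend on the number of frequencies, since uniqueness is qualitative.
  refine ODE_solution_unique_of_mem_Icc (v := fun t x => quadTerm m Θ x x t)
    (s := fun _ => Metric.closedBall 0 M) (K := L.toNNReal) (t₀ := 0) (fun t _ => ?_)
    ⟨by linarith, hT⟩ ha (hderiv ha ha') (fun t ht => ?_) hb (hderiv hb hb') (fun t ht => ?_) ?_
  · refine LipschitzOnWith.of_dist_le_mul fun x hx y hy => ?_
    rw [dist_eq_norm, dist_eq_norm, Real.coe_toNNReal _ hL0]
    rw [mem_closedBall_zero_iff] at hx hy
    rw [pi_norm_le_iff_of_nonneg (by positivity)]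
    intro σ
    rw [pi_norm_le_iff_of_nonneg (by positivity)]
    intro k
    refine (norm_quadTerm_sub_le m Θ hx hy t σ k).trans ?_
    rw [hL]
    refine mul_le_mul_of_nonneg_right (mul_le_mul_of_nonneg_right ?_ (by positivity))
      (norm_nonneg _)
    refine le_trans ?_ (Finset.single_le_sum (f := fun σ => ∑ k, ∑ i, ∑ j, ∑ k₁, ‖m σ i j k k₁‖)
      (fun _ _ => by positivity) (Finset.mem_univ σ))
    exact Finset.single_le_sum (f := fun k => ∑ i, ∑ j, ∑ k₁, ‖m σ i j k k₁‖)
      (fun _ _ => by positivity) (Finset.mem_univ k)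
  · rw [mem_closedBall_zero_iff]
    exact (hMa t (Ioo_subset_Icc_self ht)).trans ((le_max_left _ _).trans (le_max_left _ _))
  · rw [mem_closedBall_zero_iff]
    exact (hMb t (Ioo_subset_Icc_self ht)).trans ((le_max_right _ _).trans (le_max_left _ _))
  · have h0 : (0 : ℝ) ∈ Icc (-T) T := ⟨by linarith, hT.le⟩
    ext σ k
    rw [ha' 0 h0, hb' 0 h0]
    simp

end Uniqueness

end PeriodicFPU

/-! ### Trigonometry of the resonance function. -/

namespace PeriodicFPU

set_option linter.unusedSectionVars false

section Trig

lemma abs_le_pi_mul_abs_sin_half {x : ℝ} (hx : |x| ≤ Real.pi) : |x| / Real.pi ≤ |Real.sin (x / 2)| := by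
  have h := Real.mul_abs_le_abs_sin (x := x / 2) (by rw [abs_div, abs_two]; linarith)
  rw [abs_div, abs_two] at h
  calc |x| / Real.pi = 2 / Real.pi * (|x| / 2) := by ring
    _ ≤ _ := h

/-- Wasteful on purpose: the cosine is at least 1/2, and |x|/π is at most 1/2. In this form cosine
factors obey the same lower bound as sine factors, so all sign patterns can be treated alike. -/
lemma abs_le_pi_mul_abs_cos_half {x : ℝ} (hx : |x| ≤ Real.pi / 2) :
    |x| / Real.pi ≤ |Real.cos (x / 2)| := by
  have hpi := Real.pi_pos
  have h := Real.one_sub_mul_le_cos (x := |x| / 2) (by positivity) (by linarith)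
  have hc : Real.cos (|x| / 2) = Real.cos (x / 2) := by
    rw [← Real.cos_abs (x / 2), abs_div, abs_two]
  rw [hc] at h
  refine le_trans ?_ (h.trans (le_abs_self _))
  have h1 : |x| / Real.pi ≤ 1 / 2 := by
    rw [div_le_iff₀ hpi]; linarith
  have h2 : 2 / Real.pi * (|x| / 2) = |x| / Real.pi := by ring
  rw [h2]; linarith

/-- This and the next two identities factor e₁ sin a + e₂ sin b - sin(a + b). A minus sign turns
some of the half-angle sines into cosines; the product structure, and with it the trilinear lower
bound, persists. -/
lemma sin_add_sin_sub_sin_add (a b : ℝ) : Real.sin a + Real.sin b - Real.sin (a + b) =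
    4 * (Real.sin (a / 2) * Real.sin (b / 2) * Real.sin ((a + b) / 2)) := by
  have ha : Real.sin a = 2 * Real.sin (a / 2) * Real.cos (a / 2) := by
    rw [← Real.sin_two_mul]; ring_nf
  have hb : Real.sin b = 2 * Real.sin (b / 2) * Real.cos (b / 2) := by
    rw [← Real.sin_two_mul]; ring_nf
  have hab : Real.sin (a + b) = 2 * Real.sin ((a + b) / 2) * Real.cos ((a + b) / 2) := by
    rw [← Real.sin_two_mul]; ring_nf
  have e : (a + b) / 2 = a / 2 + b / 2 := by ring
  rw [ha, hb, hab, e, Real.sin_add, Real.cos_add]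
  have h1 := Real.sin_sq_add_cos_sq (a / 2)
  have h2 := Real.sin_sq_add_cos_sq (b / 2)
  linear_combination -(2 * Real.sin (b / 2) * Real.cos (b / 2)) * h1 + -(2 * Real.sin (a / 2) * Real.cos (a / 2)) * h2

lemma sin_sub_sin_sub_sin_add (a b : ℝ) : Real.sin a - Real.sin b - Real.sin (a + b) =
    -(4 * (Real.cos (a / 2) * Real.sin (b / 2) * Real.cos ((a + b) / 2))) := by
  have ha : Real.sin a = 2 * Real.sin (a / 2) * Real.cos (a / 2) := by
    rw [← Real.sin_two_mul]; ring_nf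
  have hb : Real.sin b = 2 * Real.sin (b / 2) * Real.cos (b / 2) := by
    rw [← Real.sin_two_mul]; ring_nf
  have hab : Real.sin (a + b) = 2 * Real.sin ((a + b) / 2) * Real.cos ((a + b) / 2) := by
    rw [← Real.sin_two_mul]; ring_nf
  have e : (a + b) / 2 = a / 2 + b / 2 := by ring
  rw [ha, hb, hab, e, Real.sin_add, Real.cos_add]
  have h1 := Real.sin_sq_add_cos_sq (a / 2)
  have h2 := Real.sin_sq_add_cos_sq (b / 2)
  linear_combination (2 * Real.sin (b / 2) * Real.cos (b / 2)) * h1 + -(2 * Real.sin (a / 2) * Real.cos (a / 2)) * h2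

lemma neg_sin_sub_sin_sub_sin_add (a b : ℝ) : -Real.sin a - Real.sin b - Real.sin (a + b) =
    -(4 * (Real.cos (a / 2) * Real.cos (b / 2) * Real.sin ((a + b) / 2))) := by
  have ha : Real.sin a = 2 * Real.sin (a / 2) * Real.cos (a / 2) := by
    rw [← Real.sin_two_mul]; ring_nf
  have hb : Real.sin b = 2 * Real.sin (b / 2) * Real.cos (b / 2) := by
    rw [← Real.sin_two_mul]; ring_nf
  have hab : Real.sin (a + b) = 2 * Real.sin ((a + b) / 2) * Real.cos ((a + b) / 2) := by
    rw [← Real.sin_two_mul]; ring_nf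
  have e : (a + b) / 2 = a / 2 + b / 2 := by ring
  rw [ha, hb, hab, e, Real.sin_add, Real.cos_add]
  have h1 := Real.sin_sq_add_cos_sq (a / 2)
  have h2 := Real.sin_sq_add_cos_sq (b / 2)
  linear_combination (2 * Real.sin (b / 2) * Real.cos (b / 2)) * h1 + (2 * Real.sin (a / 2) * Real.cos (a / 2)) * h2

/-- The resonance function without aliasing, for all choices of the two signs. -/
lemma four_mul_le_abs_sin_resonance {a b e₁ e₂ : ℝ} (he₁ : e₁ = 1 ∨ e₁ = -1) (he₂ : e₂ = 1 ∨ e₂ = -1)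
    (ha : |a| ≤ Real.pi / 2) (hb : |b| ≤ Real.pi / 2) (hab : |a + b| ≤ Real.pi / 2) :
    4 * (|a| / Real.pi * (|b| / Real.pi) * (|a + b| / Real.pi)) ≤
      |e₁ * Real.sin a + e₂ * Real.sin b - Real.sin (a + b)| := by
  have hpi := Real.pi_pos
  have sa := abs_le_pi_mul_abs_sin_half (ha.trans (by linarith))
  have sb := abs_le_pi_mul_abs_sin_half (hb.trans (by linarith))
  have sab := abs_le_pi_mul_abs_sin_half (hab.trans (by linarith))
  have ca := abs_le_pi_mul_abs_cos_half ha
  have cb := abs_le_pi_mul_abs_cos_half hb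
  have cab := abs_le_pi_mul_abs_cos_half hab
  rcases he₁ with rfl | rfl <;> rcases he₂ with rfl | rfl
  · have := sin_add_sin_sub_sin_add a b
    rw [one_mul, one_mul, this, abs_mul, abs_mul, abs_mul, abs_of_pos (by norm_num : (0 : ℝ) < 4)]
    gcongr
  · have := sin_sub_sin_sub_sin_add a b
    rw [show 1 * Real.sin a + -1 * Real.sin b - Real.sin (a + b) =
      Real.sin a - Real.sin b - Real.sin (a + b) by ring, this, abs_neg, abs_mul, abs_mul, abs_mul,
      abs_of_pos (by norm_num : (0 : ℝ) < 4)]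
    gcongr
  · have := sin_sub_sin_sub_sin_add b a
    rw [show -1 * Real.sin a + 1 * Real.sin b - Real.sin (a + b) =
      Real.sin b - Real.sin a - Real.sin (b + a) by ring_nf, this, abs_neg, abs_mul, abs_mul, abs_mul,
      abs_of_pos (by norm_num : (0 : ℝ) < 4), add_comm b a, mul_comm |Real.cos (b / 2)|]
    gcongr
  · have := neg_sin_sub_sin_sub_sin_add a b
    rw [show -1 * Real.sin a + -1 * Real.sin b - Real.sin (a + b) =
      -Real.sin a - Real.sin b - Real.sin (a + b) by ring, this, abs_neg, abs_mul, abs_mul, abs_mul,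
      abs_of_pos (by norm_num : (0 : ℝ) < 4)]
    gcongr

/-- The resonance function with aliasing allowed, for all choices of the two signs. -/
lemma le_abs_aliased_resonance {a b d e₁ e₂ : ℝ} {j : ℤ} (he₁ : e₁ = 1 ∨ e₁ = -1)
    (he₂ : e₂ = 1 ∨ e₂ = -1) (ha : |a| ≤ Real.pi / 2) (hb : |b| ≤ Real.pi / 2)
    (hd : |d| ≤ Real.pi / 2) (hj : d = a + b + Real.pi * j) :
    |d| * |a| * |b| / 25 ≤
      |2 * Real.pi * j + 2 * (e₁ * Real.sin a + e₂ * Real.sin b - Real.sin d)| := by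
  have hpi := Real.pi_pos
  have hpi3 := Real.pi_gt_d2
  have hpi4 := Real.pi_lt_d2
  -- Without aliasing the factorisation gives the constant 8/π³ ≥ 1/25. With aliasing |2πj| ≥ 6.28
  -- while the sine terms contribute at most 6, and the remaining 0.28 exceeds (3.15/2)³/25.
  rcases eq_or_ne j 0 with rfl | hj0
  · have hd' : d = a + b := by rw [hj]; simp
    subst hd'
    have h := four_mul_le_abs_sin_resonance he₁ he₂ ha hb hd
    simp only [Int.cast_zero, mul_zero, zero_add]
    rw [abs_mul, abs_two]
    have e : 4 * (|a| / Real.pi * (|b| / Real.pi) * (|a + b| / Real.pi)) =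
        4 / Real.pi ^ 3 * (|a + b| * |a| * |b|) := by field_simp
    rw [e] at h
    have h2 : (1 : ℝ) / 50 ≤ 4 / Real.pi ^ 3 := by
      rw [div_le_div_iff₀ (by norm_num) (by positivity)]
      have : Real.pi ^ 3 ≤ 3.15 ^ 3 := by gcongr
      norm_num at this ⊢; linarith
    have h3 := mul_le_mul_of_nonneg_right h2 (by positivity : 0 ≤ |a + b| * |a| * |b|)
    linarith
  · have hj1 : (1 : ℝ) ≤ |(j : ℝ)| := by exact_mod_cast Int.one_le_abs hj0
    have h1 : |e₁ * Real.sin a| ≤ 1 := by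
      rcases he₁ with rfl | rfl <;> simpa using Real.abs_sin_le_one a
    have h2 : |e₂ * Real.sin b| ≤ 1 := by
      rcases he₂ with rfl | rfl <;> simpa using Real.abs_sin_le_one b
    have h3 := Real.abs_sin_le_one d
    have h4 : |2 * (e₁ * Real.sin a + e₂ * Real.sin b - Real.sin d)| ≤ 6 := by
      rw [abs_mul, abs_two]
      have := abs_sub (e₁ * Real.sin a + e₂ * Real.sin b) (Real.sin d)
      have := abs_add_le (e₁ * Real.sin a) (e₂ * Real.sin b)
      linarith
    have h5 : 2 * Real.pi ≤ |2 * Real.pi * (j : ℝ)| := by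
      rw [abs_mul, abs_of_pos (by positivity : 0 < 2 * Real.pi)]
      nlinarith
    have h6 := abs_sub_abs_le_abs_sub (2 * Real.pi * (j : ℝ))
      (-(2 * (e₁ * Real.sin a + e₂ * Real.sin b - Real.sin d)))
    rw [abs_neg, sub_neg_eq_add] at h6
    have h7 : |d| * |a| * |b| ≤ (3.15 / 2) * (3.15 / 2) * (3.15 / 2) := by
      gcongr <;> linarith
    norm_num at h7
    linarith

/-- The difference is a product of the sines of (x + y)/2 and of d = |x - y|/2. The midpoint lies at
distance at least d from both ends of [0,π], so its sine is also at least sin d ≥ 2d/π. Quadratic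
separation is the best possible near the critical points of the cosine. -/
lemma two_mul_sq_le_abs_cos_sub_cos {x y : ℝ} (hx : x ∈ Icc 0 Real.pi) (hy : y ∈ Icc 0 Real.pi) :
    2 / Real.pi ^ 2 * (x - y) ^ 2 ≤ |Real.cos x - Real.cos y| := by
  have hpi := Real.pi_pos
  wlog hxy : y ≤ x generalizing x y
  · have := this hy hx (le_of_not_ge hxy)
    rw [abs_sub_comm, ← neg_sub x y, neg_sq] at this
    exact this
  obtain ⟨hx0, hx1⟩ := hx
  obtain ⟨hy0, hy1⟩ := hy
  set d := (x - y) / 2 with hd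
  have hd0 : 0 ≤ d := by rw [hd]; linarith
  have hd1 : d ≤ Real.pi / 2 := by rw [hd]; linarith
  have hsd : 2 / Real.pi * d ≤ Real.sin d := Real.mul_le_sin hd0 hd1
  have hsm : Real.sin d ≤ Real.sin ((x + y) / 2) := by
    rw [← Real.cos_pi_div_two_sub d, ← Real.cos_pi_div_two_sub ((x + y) / 2),
      ← Real.cos_abs (Real.pi / 2 - (x + y) / 2)]
    refine Real.cos_le_cos_of_nonneg_of_le_pi (abs_nonneg _) (by linarith) ?_
    rw [abs_le]
    constructor <;> rw [hd] <;> linarith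
  rw [Real.cos_sub_cos, abs_mul, abs_mul, abs_neg, abs_two]
  have h0 : 0 ≤ 2 / Real.pi * d := by positivity
  have hs0 : 0 ≤ Real.sin d := h0.trans hsd
  calc 2 / Real.pi ^ 2 * (x - y) ^ 2 = 2 * (2 / Real.pi * d) * (2 / Real.pi * d) := by
        rw [hd]; field_simp
    _ ≤ 2 * Real.sin ((x + y) / 2) * Real.sin d := by
        have := hsd.trans hsm
        gcongr
        linarith
    _ ≤ _ := by
        have := hs0.trans hsm
        gcongr <;> exact le_abs_self _

/-- Equal floors mean that both points lie between the same consecutive multiples of π; translating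
to [0,π] changes the cosine by a common sign. -/
lemma two_mul_sq_le_abs_cos_sub_cos_of_floor {x y : ℝ} (h : ⌊x / Real.pi⌋ = ⌊y / Real.pi⌋) :
    2 / Real.pi ^ 2 * (x - y) ^ 2 ≤ |Real.cos x - Real.cos y| := by
  have hpi := Real.pi_pos
  have key : ∀ z : ℝ, z - ⌊z / Real.pi⌋ * Real.pi ∈ Icc 0 Real.pi := by
    intro z
    have h1 := Int.floor_le (z / Real.pi)
    have h2 := Int.lt_floor_add_one (z / Real.pi)
    rw [le_div_iff₀ hpi] at h1
    rw [div_lt_iff₀ hpi] at h2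
    constructor <;> linarith
  have hy := key y
  rw [← h] at hy
  have := two_mul_sq_le_abs_cos_sub_cos (key x) hy
  rw [Real.cos_sub_int_mul_pi, Real.cos_sub_int_mul_pi, ← mul_sub, abs_mul, abs_zpow, abs_neg,
    abs_one, one_zpow, one_mul] at this
  convert this using 2
  ring

/-- A sum of two translated sines is a multiple of a translated cosine. -/
lemma exists_amplitude {e e' β : ℝ} (he : e = 1 ∨ e = -1) (he' : e' = 1 ∨ e' = -1)
    (hβ : |β| ≤ Real.pi / 2) : ∃ ρ γ : ℝ, (γ = 0 ∨ γ = Real.pi / 2) ∧ 2 * (|β| / Real.pi) ≤ |ρ| ∧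
      ∀ θ, e * Real.sin θ + e' * Real.sin (θ - β) = ρ * Real.cos (θ - β / 2 - γ) := by
  have hpi := Real.pi_pos
  have s := abs_le_pi_mul_abs_sin_half (hβ.trans (by linarith))
  have c := abs_le_pi_mul_abs_cos_half hβ
  have hplus : ∀ θ, Real.sin θ + Real.sin (θ - β) =
      2 * Real.cos (β / 2) * Real.cos (θ - β / 2 - Real.pi / 2) := by
    intro θ
    rw [Real.cos_sub_pi_div_two]
    have e1 : Real.sin θ = Real.sin (θ - β / 2 + β / 2) := by ring_nf
    have e2 : Real.sin (θ - β) = Real.sin (θ - β / 2 - β / 2) := by ring_nf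
    rw [e1, e2, Real.sin_add, Real.sin_sub (θ - β / 2)]
    ring
  have hminus : ∀ θ, Real.sin θ - Real.sin (θ - β) =
      2 * Real.sin (β / 2) * Real.cos (θ - β / 2 - 0) := by
    intro θ
    rw [sub_zero]
    have e1 : Real.sin θ = Real.sin (θ - β / 2 + β / 2) := by ring_nf
    have e2 : Real.sin (θ - β) = Real.sin (θ - β / 2 - β / 2) := by ring_nf
    rw [e1, e2, Real.sin_add, Real.sin_sub (θ - β / 2)]
    ring
  rcases he with rfl | rfl <;> rcases he' with rfl | rfl
  · refine ⟨2 * Real.cos (β / 2), Real.pi / 2, Or.inr rfl, ?_, fun θ => ?_⟩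
    · rw [abs_mul, abs_two]; gcongr
    · rw [← hplus]; ring
  · refine ⟨2 * Real.sin (β / 2), 0, Or.inl rfl, ?_, fun θ => ?_⟩
    · rw [abs_mul, abs_two]; gcongr
    · rw [← hminus]; ring
  · refine ⟨-(2 * Real.sin (β / 2)), 0, Or.inl rfl, ?_, fun θ => ?_⟩
    · rw [abs_neg, abs_mul, abs_two]; gcongr
    · linear_combination -hminus θ
  · refine ⟨-(2 * Real.cos (β / 2)), Real.pi / 2, Or.inr rfl, ?_, fun θ => ?_⟩
    · rw [abs_neg, abs_mul, abs_two]; gcongr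
    · linear_combination -hplus θ

end Trig

/-! ### Counting near level sets of a quadratically separated phase. -/

section Counting

/-- The sum bounding the number of lattice points near a curve with quadratic separation. -/
noncomputable def sepSum : ℝ≥0∞ := ∑' n : ℤ, wt ((n : ℝ) ^ 2 / 64) ^ (-(5 / 8) : ℝ)

/-- Quadratic separation doubles the exponent: 2 · 5/8 = 5/4 > 1. -/
lemma sepSum_ne_top : sepSum ≠ ∞ := by
  have hs : Summable fun n : ℤ => (64 : ℝ) ^ (5 / 8 : ℝ) * |(n : ℝ)| ^ (-(5 / 4) : ℝ) :=
    (Real.summable_abs_int_rpow (by norm_num)).mul_left _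
  have hs' : Summable fun n : ℤ => (if n = 0 then (1 : ℝ) else 0) +
      (64 : ℝ) ^ (5 / 8 : ℝ) * |(n : ℝ)| ^ (-(5 / 4) : ℝ) :=
    (hasSum_ite_eq (0 : ℤ) (1 : ℝ)).summable.add hs
  refine ne_top_of_le_ne_top (b := ∑' n : ℤ, ENNReal.ofReal ((if n = 0 then (1 : ℝ) else 0) +
      (64 : ℝ) ^ (5 / 8 : ℝ) * |(n : ℝ)| ^ (-(5 / 4) : ℝ))) ?_ ?_
  · rw [← ENNReal.ofReal_tsum_of_nonneg (fun n => by positivity) hs']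
    exact ENNReal.ofReal_ne_top
  · refine ENNReal.tsum_le_tsum fun n => ?_
    rw [wt_rpow]
    refine ENNReal.ofReal_le_ofReal ?_
    rcases eq_or_ne n 0 with rfl | hn
    · simp
    · rw [if_neg hn, zero_add]
      have hn0 : (0 : ℝ) < |(n : ℝ)| := by simpa using hn
      have e : (64 : ℝ) ^ (5 / 8 : ℝ) * |(n : ℝ)| ^ (-(5 / 4) : ℝ) =
          ((n : ℝ) ^ 2 / 64) ^ (-(5 / 8) : ℝ) := by
        rw [← sq_abs, Real.div_rpow (by positivity) (by norm_num),
          Real.rpow_neg (by norm_num : (0 : ℝ) ≤ 64), div_inv_eq_mul, ← Real.rpow_natCast,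
          ← Real.rpow_mul hn0.le, mul_comm]
        norm_num
      rw [e]
      refine Real.rpow_le_rpow_of_nonpos (by rw [← sq_abs]; positivity) ?_ (by norm_num)
      rw [abs_of_nonneg (by positivity)]
      linarith

variable {ι : Type*} [Fintype ι]

/-- Let z be the point whose phase is nearest to q/T. Then |φ x - φ z| ≤ 2|q/T - φ x|, so the
separation from z bounds the distance to q/T from below (whence 64 = 2 · 32), and the sum is
dominated by one over all integers. The factor T^{-5/8} comes from T(1 + n²/64) ≤ 1 + T n²/64. -/
lemma sum_wt_le_of_separated {A : Finset ι} {ρ : ι → ℤ} (hρ : Function.Injective ρ) {φ : ι → ℝ}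
    (hφ : ∀ x ∈ A, ∀ y ∈ A, ((ρ x - ρ y : ℤ) : ℝ) ^ 2 / 32 ≤ |φ x - φ y|) {T : ℝ} (hT : 0 < T)
    (hT1 : T ≤ 1) (q : ℝ) :
    ∑ x ∈ A, wt (q - T * φ x) ^ (-(5 / 8) : ℝ) ≤ ENNReal.ofReal (T ^ (-(5 / 8) : ℝ)) * sepSum := by
  rcases A.eq_empty_or_nonempty with rfl | hA
  · simp
  obtain ⟨z, hz, hmin⟩ := A.exists_min_image (fun x => |q / T - φ x|) hA
  have key : ∀ x ∈ A, wt (q - T * φ x) ^ (-(5 / 8) : ℝ) ≤ ENNReal.ofReal (T ^ (-(5 / 8) : ℝ)) *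
      wt (((ρ x - ρ z : ℤ) : ℝ) ^ 2 / 64) ^ (-(5 / 8) : ℝ) := by
    intro x hx
    rw [wt_rpow, wt_rpow, ← ENNReal.ofReal_mul (by positivity), ← Real.mul_rpow hT.le (by positivity)]
    refine ENNReal.ofReal_le_ofReal (Real.rpow_le_rpow_of_nonpos (by positivity) ?_ (by norm_num))
    have h1 := hφ x hx z hz
    have h2 := hmin x hx
    have h3 : |φ x - φ z| ≤ 2 * |q / T - φ x| := by
      have h4 := abs_sub_le (φ x) (q / T) (φ z)
      rw [abs_sub_comm (φ x) (q / T)] at h4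
      linarith
    have h5 : |q - T * φ x| = T * |q / T - φ x| := by
      rw [← abs_of_pos hT, ← abs_mul, abs_of_pos hT, mul_sub, mul_div_cancel₀ _ hT.ne']
    rw [h5, abs_of_nonneg (by positivity), mul_add, mul_one]
    have h6 : ((ρ x - ρ z : ℤ) : ℝ) ^ 2 / 64 ≤ |q / T - φ x| := by linarith
    have h7 := mul_le_mul_of_nonneg_left h6 hT.le
    linarith
  refine (Finset.sum_le_sum key).trans ?_
  rw [← Finset.mul_sum]
  gcongr
  have hinj : Set.InjOn (fun x => ρ x - ρ z) (A : Set ι) := fun x _ y _ h => hρ (by simpa using h)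
  rw [← Finset.sum_image (f := fun n : ℤ => wt ((n : ℝ) ^ 2 / 64) ^ (-(5 / 8) : ℝ)) hinj]
  exact ENNReal.sum_le_tsum _

lemma sum_wt_le_of_parts {κ : Type*} [DecidableEq κ] (s : Finset κ) {part : ι → κ}
    (hpart : ∀ x, part x ∈ s) {ρ : ι → ℤ} (hρ : Function.Injective ρ) {φ : ι → ℝ}
    (hφ : ∀ x y, part x = part y → ((ρ x - ρ y : ℤ) : ℝ) ^ 2 / 32 ≤ |φ x - φ y|) {T : ℝ}
    (hT : 0 < T) (hT1 : T ≤ 1) (q : ℝ) :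
    ∑ x, wt (q - T * φ x) ^ (-(5 / 8) : ℝ) ≤
      s.card * (ENNReal.ofReal (T ^ (-(5 / 8) : ℝ)) * sepSum) := by
  rw [← Finset.sum_fiberwise_of_maps_to (s := Finset.univ) (t := s) fun x _ => hpart x]
  refine (Finset.sum_le_card_nsmul s _ (ENNReal.ofReal (T ^ (-(5 / 8) : ℝ)) * sepSum)
    fun c _ => ?_).trans (by rw [nsmul_eq_mul])
  refine sum_wt_le_of_separated hρ (fun x hx y hy => hφ x y ?_) hT hT1 q
  rw [(Finset.mem_filter.1 hx).2, (Finset.mem_filter.1 hy).2]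

end Counting

end PeriodicFPU

/-! ### Representatives of frequencies and aliasing. -/

namespace PeriodicFPU

set_option linter.unusedSectionVars false

/-- The representative in `{-N, …, N - 1}` of a class modulo `2N`. -/
def repr (N : ℕ) (k : ZMod (2 * N)) : ℤ := -(-k).valMinAbs

/-- The sign `±1` attached to a Boolean. -/
noncomputable def sgn (σ : Bool) : ℝ := if σ then 1 else -1

@[simp] lemma sgn_true : sgn true = 1 := by simp [sgn]

@[simp] lemma sgn_false : sgn false = -1 := by simp [sgn]

lemma sgn_eq (σ : Bool) : sgn σ = 1 ∨ sgn σ = -1 := by cases σ <;> simp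

lemma sgn_mul_sgn_eq (σ a : Bool) : sgn σ * sgn a = 1 ∨ sgn σ * sgn a = -1 := by
  cases σ <;> cases a <;> simp

section Repr

variable {N : ℕ} [NeZero N]

lemma coe_repr (k : ZMod (2 * N)) : ((repr N k : ℤ) : ZMod (2 * N)) = k := by
  simp [repr, ZMod.coe_valMinAbs]

lemma repr_injective : Function.Injective (repr N) := fun k l h => by
  rw [← coe_repr k, ← coe_repr l, h]

/-- `ZMod.valMinAbs` takes values in (-N, N]; the two negations in `repr` move the endpoint from N
to -N, as in `freqs`. -/
lemma repr_mem_Ico (k : ZMod (2 * N)) : -(N : ℤ) ≤ repr N k ∧ repr N k < N := by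
  have h := ZMod.valMinAbs_mem_Ioc (-k)
  simp only [mem_Ioc, Nat.cast_mul, Nat.cast_ofNat] at h
  unfold repr
  omega

lemma repr_mem_freqs (k : ZMod (2 * N)) : repr N k ∈ freqs N := by
  have := repr_mem_Ico k
  simp [freqs, this.1, this.2]

lemma abs_repr_le (k : ZMod (2 * N)) : |repr N k| ≤ N := by
  have := repr_mem_Ico k
  rw [abs_le]; omega

lemma eq_zero_of_dvd_of_abs_lt {n : ℤ} (h : ((2 * N : ℕ) : ℤ) ∣ n) (hn : |n| < 2 * N) : n = 0 := by
  refine Int.eq_zero_of_abs_lt_dvd h ?_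
  push_cast; exact hn

lemma repr_intCast {n : ℤ} (hn : n ∈ freqs N) : repr N (n : ZMod (2 * N)) = n := by
  have h := repr_mem_Ico (n : ZMod (2 * N))
  simp only [freqs, Finset.mem_Ico] at hn
  have h1 : ((2 * N : ℕ) : ℤ) ∣ n - repr N (n : ZMod (2 * N)) := by
    rw [← ZMod.intCast_eq_intCast_iff_dvd_sub, coe_repr]
  have := eq_zero_of_dvd_of_abs_lt h1 (by rw [abs_lt]; omega)
  omega

@[simp] lemma repr_zero : repr N 0 = 0 := by
  simp [repr]

lemma repr_eq_zero {k : ZMod (2 * N)} : repr N k = 0 ↔ k = 0 := by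
  rw [← repr_zero (N := N), repr_injective.eq_iff]

lemma sum_freqs {M : Type*} [AddCommMonoid M] (f : ℤ → M) :
    ∑ n ∈ freqs N, f n = ∑ k : ZMod (2 * N), f (repr N k) := by
  refine Finset.sum_nbij' (fun n => (n : ZMod (2 * N))) (repr N) (fun _ _ => Finset.mem_univ _)
    (fun k _ => repr_mem_freqs k) (fun n hn => repr_intCast hn) (fun k _ => coe_repr k)
    fun n hn => by rw [repr_intCast hn]

/-- The difference of representatives, up to aliasing. -/
lemma exists_alias (k k₁ : ZMod (2 * N)) :
    ∃ j : ℤ, j ∈ Finset.Icc (-1 : ℤ) 1 ∧ repr N k = repr N k₁ + repr N (k - k₁) + 2 * N * j := by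
  have h1 : ((2 * N : ℕ) : ℤ) ∣ repr N k - (repr N k₁ + repr N (k - k₁)) := by
    rw [← ZMod.intCast_eq_intCast_iff_dvd_sub]
    push_cast
    simp only [coe_repr]
    ring
  obtain ⟨j, hj⟩ := h1
  refine ⟨j, ?_, by push_cast at hj; linarith⟩
  have a := repr_mem_Ico k
  have b := repr_mem_Ico k₁
  have c := repr_mem_Ico (k - k₁)
  have hN : (0 : ℤ) < N := by exact_mod_cast Nat.pos_of_ne_zero (NeZero.ne N)
  push_cast at hj
  rw [Finset.mem_Icc]
  constructor
  · by_contra hlt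
    have : j ≤ -2 := by omega
    nlinarith
  · by_contra hlt
    have : 2 ≤ j := by omega
    nlinarith

/-- Aliasing does not hurt: if the sum of the representatives differs from that of k by ±2N, its
absolute value is at least 2N - |k| ≥ N ≥ |k|. -/
lemma abs_repr_triangle (k k₁ : ZMod (2 * N)) :
    |repr N k| ≤ |repr N k₁| + |repr N (k - k₁)| := by
  obtain ⟨j, hj, h⟩ := exists_alias k k₁
  have a := abs_repr_le k
  have hN : (0 : ℤ) < N := by exact_mod_cast Nat.pos_of_ne_zero (NeZero.ne N)
  have t := abs_add_le (repr N k₁) (repr N (k - k₁))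
  rw [Finset.mem_Icc] at hj
  have : j = -1 ∨ j = 0 ∨ j = 1 := by omega
  rcases this with rfl | rfl | rfl
  · have : repr N k₁ + repr N (k - k₁) = repr N k + 2 * N := by linarith
    have := le_abs_self (repr N k₁ + repr N (k - k₁))
    have := neg_abs_le (repr N k)
    linarith
  · have : repr N k₁ + repr N (k - k₁) = repr N k := by linarith
    rw [← this]; exact t
  · have : repr N k₁ + repr N (k - k₁) = repr N k - 2 * N := by linarith
    have := neg_abs_le (repr N k₁ + repr N (k - k₁))
    have := le_abs_self (repr N k)
    linarith

end Repr

/-! ### Lower bound and counting bound for the FPU resonance function. -/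

section Resonance

/-- The dispersion relation of the wave with relative sign `ε`. -/
noncomputable def signedPhase (N : ℕ) (ε : ℝ) (n : ℤ) : ℝ :=
  (n : ℝ) / mesh N ^ 2 - ε * (2 / mesh N ^ 3 * Real.sin (mesh N * n / 2))

/-- The resonance function of the interaction of the waves of signs `a`, `b` that feeds the wave of
sign `σ`. -/
noncomputable def resPhase (N : ℕ) (σ a b : Bool) (k k₁ : ZMod (2 * N)) : ℝ :=
  -(sgn σ * (signedPhase N 1 (repr N k) - signedPhase N (sgn σ * sgn a) (repr N k₁) -
    signedPhase N (sgn σ * sgn b) (repr N (k - k₁))))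

variable {N : ℕ} [NeZero N]

lemma mesh_pos : 0 < mesh N := by
  have hN : (0 : ℝ) < N := by exact_mod_cast Nat.pos_of_ne_zero (NeZero.ne N)
  exact div_pos Real.pi_pos hN

lemma mesh_mul_self : mesh N * N = Real.pi := by
  have hN : (N : ℝ) ≠ 0 := by exact_mod_cast NeZero.ne N
  rw [mesh, div_mul_cancel₀ _ hN]

lemma abs_angle_le (k : ZMod (2 * N)) : |mesh N * (repr N k : ℝ) / 2| ≤ Real.pi / 2 := by
  have h : |(repr N k : ℝ)| ≤ N := by exact_mod_cast abs_repr_le k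
  rw [abs_div, abs_mul, abs_two, abs_of_pos (mesh_pos (N := N)), ← mesh_mul_self (N := N)]
  have := mesh_pos (N := N)
  gcongr

lemma angle_eq {k k₁ : ZMod (2 * N)} {j : ℤ}
    (h : repr N k = repr N k₁ + repr N (k - k₁) + 2 * N * j) :
    mesh N * (repr N k : ℝ) / 2 =
      mesh N * (repr N k₁ : ℝ) / 2 + mesh N * (repr N (k - k₁) : ℝ) / 2 + Real.pi * j := by
  rw [h, ← mesh_mul_self (N := N)]; push_cast; ring

/-- The linear parts of the three phases cancel, except that aliasing leaves 2Nj/h² = 2πj/h³;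
everything else is a sum of sines. -/
lemma resPhase_eq (σ a b : Bool) {k k₁ : ZMod (2 * N)} {j : ℤ}
    (h : repr N k = repr N k₁ + repr N (k - k₁) + 2 * N * j) :
    resPhase N σ a b k k₁ = -(sgn σ * (1 / mesh N ^ 3 * (2 * Real.pi * j +
      2 * (sgn σ * sgn a * Real.sin (mesh N * (repr N k₁ : ℝ) / 2) +
      sgn σ * sgn b * Real.sin (mesh N * (repr N (k - k₁) : ℝ) / 2) -
      Real.sin (mesh N * (repr N k : ℝ) / 2))))) := by
  have hm := (mesh_pos (N := N)).ne'
  have e : (repr N k : ℝ) = repr N k₁ + repr N (k - k₁) + 2 * N * j := by rw [h]; push_cast; ring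
  have e2 : (repr N k : ℝ) / mesh N ^ 2 - repr N k₁ / mesh N ^ 2 - repr N (k - k₁) / mesh N ^ 2 =
      1 / mesh N ^ 3 * (2 * Real.pi * j) := by
    rw [e, ← mesh_mul_self (N := N)]; field_simp; ring
  unfold resPhase signedPhase
  linear_combination -sgn σ * e2

lemma abs_resPhase (σ a b : Bool) {k k₁ : ZMod (2 * N)} {j : ℤ}
    (h : repr N k = repr N k₁ + repr N (k - k₁) + 2 * N * j) :
    |resPhase N σ a b k k₁| = 1 / mesh N ^ 3 * |2 * Real.pi * j +
      2 * (sgn σ * sgn a * Real.sin (mesh N * (repr N k₁ : ℝ) / 2) +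
      sgn σ * sgn b * Real.sin (mesh N * (repr N (k - k₁) : ℝ) / 2) -
      Real.sin (mesh N * (repr N k : ℝ) / 2))| := by
  have hm := mesh_pos (N := N)
  have h1 : |sgn σ| = 1 := by cases σ <;> simp
  rw [resPhase_eq σ a b h, abs_neg, abs_mul, h1, one_mul, abs_mul, abs_of_pos (by positivity)]

/-- The angles are hk/2, so the three factors 1/2 turn 1/25 into 1/200, and h³ cancels the prefactor
h⁻³: the bound does not see h. -/
lemma le_abs_resPhase (σ a b : Bool) (k k₁ : ZMod (2 * N)) :
    1 / 200 * (|(repr N k : ℝ)| * |(repr N k₁ : ℝ)| * |(repr N (k - k₁) : ℝ)|) ≤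
      |resPhase N σ a b k k₁| := by
  obtain ⟨j, -, h⟩ := exists_alias k k₁
  have hm := mesh_pos (N := N)
  rw [abs_resPhase σ a b h]
  have := le_abs_aliased_resonance (sgn_mul_sgn_eq σ a) (sgn_mul_sgn_eq σ b) (abs_angle_le k₁)
    (abs_angle_le (k - k₁)) (abs_angle_le k) (angle_eq h)
  refine le_trans (le_of_eq ?_) (mul_le_mul_of_nonneg_left this (by positivity))
  simp only [abs_div, abs_mul, abs_two, abs_of_pos hm]
  field_simp
  ring

/-- The counting bound for a phase that is, on each aliasing branch, a sum of two translated
sines. -/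
lemma sum_wt_sines_le {y : ZMod (2 * N)} (hy : y ≠ 0) {φ : ZMod (2 * N) → ℝ}
    {j : ZMod (2 * N) → ℤ} (hj : ∀ x, j x ∈ Finset.Icc (-1 : ℤ) 1) {A e e' : ℤ → ℝ}
    (he : ∀ i, e i = 1 ∨ e i = -1) (he' : ∀ i, e' i = 1 ∨ e' i = -1)
    (hφ : ∀ x, φ x = A (j x) + 2 / mesh N ^ 3 *
      (e (j x) * Real.sin (mesh N * (repr N x : ℝ) / 2) +
        e' (j x) * Real.sin (mesh N * (repr N x : ℝ) / 2 - mesh N * (repr N y : ℝ) / 2)))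
    {T : ℝ} (hT : 0 < T) (hT1 : T ≤ 1) (q : ℝ) :
    ∑ x, wt (q - T * φ x) ^ (-(5 / 8) : ℝ) ≤
      9 * (ENNReal.ofReal (T ^ (-(5 / 8) : ℝ)) * sepSum) := by
  have hpi := Real.pi_pos
  have hm := mesh_pos (N := N)
  set θ : ZMod (2 * N) → ℝ := fun x => mesh N * (repr N x : ℝ) / 2 with hθ
  have hβ := abs_angle_le y
  choose ρ γ hγ hρ hργ using fun i => exists_amplitude (he i) (he' i) hβ
  set χ : ZMod (2 * N) → ℝ := fun x => θ x - mesh N * (repr N y : ℝ) / 2 / 2 - γ (j x) with hχ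
  -- Nine parts: three aliasing indices times three monotone branches, as χ lies between -5π/4 and
  -- 3π/4.
  have hcard : ((Finset.Icc (-1 : ℤ) 1 ×ˢ Finset.Icc (-2 : ℤ) 0).card : ℝ≥0∞) = 9 := by
    have : (Finset.Icc (-1 : ℤ) 1 ×ˢ Finset.Icc (-2 : ℤ) 0).card = 9 := by decide
    rw [this]; norm_num
  rw [← hcard]
  refine sum_wt_le_of_parts _ (part := fun x => (j x, ⌊χ x / Real.pi⌋)) (fun x => ?_)
    repr_injective (fun x x' hxx => ?_) hT hT1 q
  · rw [Finset.mem_product]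
    refine ⟨hj x, ?_⟩
    have h1 := abs_le.1 (abs_angle_le x)
    have h2 := abs_le.1 hβ
    have h3 : 0 ≤ γ (j x) ∧ γ (j x) ≤ Real.pi / 2 := by
      rcases hγ (j x) with h | h <;> rw [h] <;> constructor <;> linarith
    have h4 : -2 ≤ χ x / Real.pi := by
      rw [le_div_iff₀ hpi]; simp only [hχ, hθ]; linarith
    have h5 : χ x / Real.pi < 1 := by
      rw [div_lt_iff₀ hpi]; simp only [hχ, hθ]; linarith
    rw [Finset.mem_Icc]
    constructor
    · rw [Int.le_floor]; exact_mod_cast h4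
    · have := Int.floor_lt.2 (show χ x / Real.pi < ((1 : ℤ) : ℝ) by exact_mod_cast h5)
      omega
  · obtain ⟨hjj, hfl⟩ := Prod.mk.inj hxx
    have h1 := two_mul_sq_le_abs_cos_sub_cos_of_floor hfl
    have hy1 : (1 : ℝ) ≤ |(repr N y : ℝ)| := by
      exact_mod_cast Int.one_le_abs (repr_eq_zero.not.2 hy)
    -- The fixed frequency y being nonzero, the amplitude is at least h/π. With h⁻³ in front and the
    -- h² of the squared angle differences, all powers of h cancel.
    have hρ1 : mesh N / Real.pi ≤ |ρ (j x)| := by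
      refine le_trans ?_ (hρ (j x))
      rw [abs_div, abs_mul, abs_two, abs_of_pos hm]
      rw [show 2 * (mesh N * |(repr N y : ℝ)| / 2 / Real.pi) =
        mesh N * |(repr N y : ℝ)| / Real.pi by ring]
      gcongr
      nlinarith
    have e1 : φ x - φ x' = 2 / mesh N ^ 3 * (ρ (j x) * (Real.cos (χ x) - Real.cos (χ x'))) := by
      rw [hφ x, hφ x', ← hjj, hργ, hργ]
      simp only [hχ, hθ, ← hjj]
      ring
    have e2 : χ x - χ x' = mesh N / 2 * ((repr N x - repr N x' : ℤ) : ℝ) := by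
      simp only [hχ, hθ, ← hjj]; push_cast; ring
    rw [e1, abs_mul, abs_mul, abs_of_pos (by positivity : 0 < 2 / mesh N ^ 3)]
    rw [e2] at h1
    have hpi3 : Real.pi ^ 3 ≤ 32 := by
      have := Real.pi_lt_d2
      calc Real.pi ^ 3 ≤ 3.15 ^ 3 := by gcongr
        _ ≤ 32 := by norm_num
    calc ((repr N x - repr N x' : ℤ) : ℝ) ^ 2 / 32
        ≤ ((repr N x - repr N x' : ℤ) : ℝ) ^ 2 / Real.pi ^ 3 := by gcongr
      _ = 2 / mesh N ^ 3 * (mesh N / Real.pi * (2 / Real.pi ^ 2 *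
          (mesh N / 2 * ((repr N x - repr N x' : ℤ) : ℝ)) ^ 2)) := by field_simp
      _ ≤ _ := by gcongr

lemma sin_add_pi_mul_int (x : ℝ) (j : ℤ) :
    Real.sin (x + Real.pi * j) = (-1) ^ j * Real.sin x := by
  rw [mul_comm, Real.sin_add_int_mul_pi]

lemma neg_one_zpow_eq (j : ℤ) : (-1 : ℝ) ^ j = 1 ∨ (-1 : ℝ) ^ j = -1 := by
  rcases Int.even_or_odd j with h | h
  · exact Or.inl h.neg_one_zpow
  · exact Or.inr h.neg_one_zpow

/-- With one of the three frequencies fixed, its sine is a constant, and the angles of the other two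
differ, up to sign, by a fixed shift modulo π. The multiple πj only changes the sign of a sine, so
on each aliasing branch Θ is a constant plus a signed sum of sin θ and sin(θ - β). This is the form
required by `sum_wt_sines_le`. -/
lemma countBound_resPhase (σ a b : Bool) {T : ℝ} (hT : 0 < T) (hT1 : T ≤ 1) :
    CountBound (9 * (ENNReal.ofReal (T ^ (-(5 / 8) : ℝ)) * sepSum))
      (fun k k₁ => T * resPhase N σ a b k k₁) := by
  have hpm : ∀ {x y : ℝ}, (x = 1 ∨ x = -1) → (y = 1 ∨ y = -1) → (x * y = 1 ∨ x * y = -1) := by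
    rintro x y (rfl | rfl) (rfl | rfl) <;> norm_num
  have hneg : ∀ {x : ℝ}, (x = 1 ∨ x = -1) → (-x = 1 ∨ -x = -1) := by
    rintro x (rfl | rfl) <;> norm_num
  have hs2 : sgn σ * sgn σ = 1 := by cases σ <;> simp
  choose j hj hjk using exists_alias (N := N)
  constructor
  · intro k hk q
    refine sum_wt_sines_le hk (j := fun x => j k x) (fun x => hj k x)
      (A := fun i => -(sgn σ * (1 / mesh N ^ 3 * (2 * Real.pi * i -
        2 * Real.sin (mesh N * (repr N k : ℝ) / 2)))))
      (e := fun _ => -sgn a) (e' := fun i => sgn b * (-1) ^ i)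
      (fun _ => hneg (sgn_eq a)) (fun i => hpm (sgn_eq b) (neg_one_zpow_eq i)) (fun x => ?_) hT hT1 q
    have h1 := angle_eq (hjk k x)
    have h2 : Real.sin (mesh N * (repr N (k - x) : ℝ) / 2) = -((-1) ^ (j k x) *
        Real.sin (mesh N * (repr N x : ℝ) / 2 - mesh N * (repr N k : ℝ) / 2)) := by
      have h3 : mesh N * (repr N (k - x) : ℝ) / 2 =
          -(mesh N * (repr N x : ℝ) / 2 - mesh N * (repr N k : ℝ) / 2 + Real.pi * (j k x)) := by
        linarith
      rw [h3, Real.sin_neg, sin_add_pi_mul_int]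
    rw [resPhase_eq σ a b (hjk k x), h2]
    linear_combination -(1 / mesh N ^ 3 * 2 * (sgn a * Real.sin (mesh N * (repr N x : ℝ) / 2) -
      sgn b * ((-1) ^ (j k x) *
        Real.sin (mesh N * (repr N x : ℝ) / 2 - mesh N * (repr N k : ℝ) / 2)))) * hs2
  · intro k₁ hk₁ q
    refine sum_wt_sines_le hk₁ (j := fun x => j x k₁) (fun x => hj x k₁)
      (A := fun i => -(sgn σ * (1 / mesh N ^ 3 * (2 * Real.pi * i +
        2 * (sgn σ * sgn a * Real.sin (mesh N * (repr N k₁ : ℝ) / 2))))))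
      (e := fun _ => sgn σ) (e' := fun i => -sgn b * (-1) ^ i)
      (fun _ => sgn_eq σ) (fun i => hpm (hneg (sgn_eq b)) (neg_one_zpow_eq i)) (fun x => ?_) hT hT1 q
    have h1 := angle_eq (hjk x k₁)
    have h2 : Real.sin (mesh N * (repr N (x - k₁) : ℝ) / 2) = (-1) ^ (j x k₁) *
        Real.sin (mesh N * (repr N x : ℝ) / 2 - mesh N * (repr N k₁ : ℝ) / 2) := by
      have h3 : mesh N * (repr N (x - k₁) : ℝ) / 2 =
          mesh N * (repr N x : ℝ) / 2 - mesh N * (repr N k₁ : ℝ) / 2 + Real.pi * (-(j x k₁) : ℤ) := by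
        push_cast; linarith
      rw [h3, sin_add_pi_mul_int, zpow_neg]
      rcases neg_one_zpow_eq (j x k₁) with h | h <;> rw [h] <;> norm_num
    rw [resPhase_eq σ a b (hjk x k₁), h2]
    linear_combination -(1 / mesh N ^ 3 * 2 * (sgn b * ((-1) ^ (j x k₁) *
        Real.sin (mesh N * (repr N x : ℝ) / 2 - mesh N * (repr N k₁ : ℝ) / 2)))) * hs2
  · intro k₂ hk₂ q
    refine sum_wt_sines_le hk₂ (j := fun x => j x (x - k₂)) (fun x => hj x (x - k₂))
      (A := fun i => -(sgn σ * (1 / mesh N ^ 3 * (2 * Real.pi * i +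
        2 * (sgn σ * sgn b * Real.sin (mesh N * (repr N k₂ : ℝ) / 2))))))
      (e := fun _ => sgn σ) (e' := fun i => -sgn a * (-1) ^ i)
      (fun _ => sgn_eq σ) (fun i => hpm (hneg (sgn_eq a)) (neg_one_zpow_eq i)) (fun x => ?_) hT hT1 q
    have h0 := hjk x (x - k₂)
    have h1 := angle_eq h0
    have h4 : x - (x - k₂) = k₂ := by ring
    rw [h4] at h1
    have h2 : Real.sin (mesh N * (repr N (x - k₂) : ℝ) / 2) = (-1) ^ (j x (x - k₂)) *
        Real.sin (mesh N * (repr N x : ℝ) / 2 - mesh N * (repr N k₂ : ℝ) / 2) := by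
      have h3 : mesh N * (repr N (x - k₂) : ℝ) / 2 =
          mesh N * (repr N x : ℝ) / 2 - mesh N * (repr N k₂ : ℝ) / 2 +
            Real.pi * (-(j x (x - k₂)) : ℤ) := by
        push_cast; linarith
      rw [h3, sin_add_pi_mul_int, zpow_neg]
      rcases neg_one_zpow_eq (j x (x - k₂)) with h | h <;> rw [h] <;> norm_num
    rw [resPhase_eq σ a b h0, h2, h4]
    linear_combination -(1 / mesh N ^ 3 * 2 * (sgn a * ((-1) ^ (j x (x - k₂)) *
        Real.sin (mesh N * (repr N x : ℝ) / 2 - mesh N * (repr N k₂ : ℝ) / 2)))) * hs2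

/-- A bound for `∑ |k| ^ (-3/2)` over nonzero integers. -/
noncomputable def smoothSum : ℝ≥0∞ := ∑' n : ℤ, ENNReal.ofReal (|(n : ℝ)| ^ (-(3 / 2) : ℝ))

lemma smoothSum_ne_top : smoothSum ≠ ∞ := by
  rw [smoothSum, ← ENNReal.ofReal_tsum_of_nonneg (fun n => by positivity)
    (Real.summable_abs_int_rpow (by norm_num))]
  exact ENNReal.ofReal_ne_top

lemma sum_smoothWt_sq_le :
    ∑ k : ZMod (2 * N), smoothWt (fun k => |(repr N k : ℝ)|) k ^ 2 ≤ smoothSum := by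
  calc ∑ k : ZMod (2 * N), smoothWt (fun k => |(repr N k : ℝ)|) k ^ 2
      ≤ ∑ k : ZMod (2 * N), ENNReal.ofReal (|((repr N k : ℤ) : ℝ)| ^ (-(3 / 2) : ℝ)) := by
        refine Finset.sum_le_sum fun k _ => ?_
        unfold smoothWt
        split_ifs with h
        · simp
        · rw [← ENNReal.ofReal_pow (by positivity), ← Real.rpow_natCast,
            ← Real.rpow_mul (abs_nonneg _)]
          norm_num
    _ = ∑ n ∈ freqs N, ENNReal.ofReal (|(n : ℝ)| ^ (-(3 / 2) : ℝ)) := by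
        rw [sum_freqs (fun n : ℤ => ENNReal.ofReal (|(n : ℝ)| ^ (-(3 / 2) : ℝ)))]
    _ ≤ _ := ENNReal.sum_le_tsum _

/-- The FPU resonance functions satisfy the hypotheses of the bilinear estimate, uniformly in the
mesh size. -/
theorem isResonant_resPhase (σ a b : Bool) {T : ℝ} (hT : 0 < T) (hT1 : T ≤ 1) :
    IsResonant (1 / 200) T (ENNReal.ofReal ((9 * sepSum).toReal * T ^ (-(5 / 8) : ℝ))) smoothSum
      (fun k : ZMod (2 * N) => |(repr N k : ℝ)|) (fun k k₁ => T * resPhase N σ a b k k₁) where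
  pos := by norm_num
  le_one := by norm_num
  time_pos := hT
  nonneg _ := abs_nonneg _
  one_le k hk := by exact_mod_cast Int.one_le_abs (repr_eq_zero.not.2 hk)
  triangle k k₁ := by exact_mod_cast abs_repr_triangle k k₁
  lower k k₁ _ _ _ := by
    have := mul_le_mul_of_nonneg_left (le_abs_resPhase σ a b k k₁) hT.le
    rw [abs_mul, abs_of_pos hT]
    linarith
  sum_le := sum_smoothWt_sq_le
  count := by
    have h := countBound_resPhase (N := N) σ a b hT hT1
    have hs := sepSum_ne_top
    rw [ENNReal.ofReal_mul (by positivity), ENNReal.ofReal_toReal (by finiteness)]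
    convert h using 1
    ring

end Resonance

end PeriodicFPU

/-! ### The lattice Fourier transform on the dual group. -/

namespace PeriodicFPU

set_option linter.unusedSectionVars false

section Fourier

variable (N : ℕ) [NeZero N]

lemma character_eq (n : ℤ) (x : PeriodicLattice N) :
    character N n x = ZMod.stdAddChar ((n : ZMod (2 * N)) * x) := by
  have h : (n : ZMod (2 * N)) * x = ((n * (x.val : ℤ) : ℤ) : ZMod (2 * N)) := by
    push_cast; rw [ZMod.natCast_zmod_val]
  have hN : (N : ℂ) ≠ 0 := by exact_mod_cast NeZero.ne N
  rw [h, ZMod.stdAddChar_coe, character, mesh]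
  congr 1
  push_cast
  field_simp

/-- The lattice Fourier transform, as a function on the dual group. -/
noncomputable def hat (u : PeriodicLattice N → ℂ) (k : PeriodicLattice N) : ℂ :=
  latticeFourier N u (repr N k)

/-- The inverse of `hat`. -/
noncomputable def synth (F : PeriodicLattice N → ℂ) (x : PeriodicLattice N) : ℂ :=
  ((1 / Real.sqrt (2 * Real.pi) : ℝ) : ℂ) * ∑ k, F k * ZMod.stdAddChar (k * x)

lemma hat_eq (u : PeriodicLattice N → ℂ) (k : PeriodicLattice N) :
    hat N u k = ((mesh N / Real.sqrt (2 * Real.pi) : ℝ) : ℂ) * ∑ x, u x * ZMod.stdAddChar (-k * x) := by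
  simp [hat, latticeFourier, character_eq, coe_repr]

lemma latticeFourier_eq_hat (u : PeriodicLattice N → ℂ) {n : ℤ} (hn : n ∈ freqs N) :
    latticeFourier N u n = hat N u (n : ZMod (2 * N)) := by
  rw [hat, repr_intCast hn]

lemma latticeFourierInv_eq (F : ℤ → ℂ) :
    latticeFourierInv N F = synth N fun k => F (repr N k) := by
  ext x
  simp [latticeFourierInv, synth, character_eq, sum_freqs, coe_repr]

lemma multiplier_eq (m : ℤ → ℂ) (f : PeriodicLattice N → ℂ) :
    multiplier N m f = synth N fun k => m (repr N k) * hat N f k := by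
  rw [multiplier, latticeFourierInv_eq]; rfl

lemma normalisation : ((mesh N / Real.sqrt (2 * Real.pi) : ℝ) : ℂ) *
    ((1 / Real.sqrt (2 * Real.pi) : ℝ) : ℂ) * ((2 * N : ℕ) : ℂ) = 1 := by
  rw [← Complex.ofReal_mul, ← Complex.ofReal_natCast, ← Complex.ofReal_mul]
  norm_cast
  have h := mesh_mul_self (N := N)
  have hs : Real.sqrt (2 * Real.pi) * Real.sqrt (2 * Real.pi) = 2 * Real.pi :=
    Real.mul_self_sqrt (by positivity)
  have hpi := Real.pi_pos
  rw [div_mul_div_comm, hs, mul_one, div_mul_eq_mul_div, div_eq_one_iff_eq (by positivity)]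
  push_cast
  rw [← h]; ring

lemma sum_stdAddChar (b : PeriodicLattice N) :
    ∑ x : PeriodicLattice N, ZMod.stdAddChar (b * x) = if b = 0 then ((2 * N : ℕ) : ℂ) else 0 := by
  have h := AddChar.sum_mulShift b (ZMod.isPrimitive_stdAddChar (2 * N))
  rw [ZMod.card] at h
  simp only [mul_comm b]
  rw [h]
  split_ifs <;> simp

lemma hat_synth (F : PeriodicLattice N → ℂ) : hat N (synth N F) = F := by
  ext k
  rw [hat_eq]
  simp only [synth]
  have h1 : ∑ x, ((1 / Real.sqrt (2 * Real.pi) : ℝ) : ℂ) * (∑ l, F l * ZMod.stdAddChar (l * x)) *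
      ZMod.stdAddChar (-k * x) = ((1 / Real.sqrt (2 * Real.pi) : ℝ) : ℂ) * ∑ l, F l *
        ∑ x : PeriodicLattice N, ZMod.stdAddChar ((l - k) * x) := by
    simp only [Finset.mul_sum, Finset.sum_mul]
    rw [Finset.sum_comm]
    refine Finset.sum_congr rfl fun l _ => Finset.sum_congr rfl fun x _ => ?_
    rw [show (l - k) * x = l * x + -k * x by ring, AddChar.map_add_eq_mul]
    ring
  rw [h1]
  simp only [sum_stdAddChar, sub_eq_zero, mul_ite, mul_zero, Finset.sum_ite_eq', Finset.mem_univ,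
    if_true]
  linear_combination F k * normalisation N

lemma synth_hat (u : PeriodicLattice N → ℂ) : synth N (hat N u) = u := by
  ext x
  simp only [synth, hat_eq]
  have h1 : ∑ k, ((mesh N / Real.sqrt (2 * Real.pi) : ℝ) : ℂ) *
      (∑ y, u y * ZMod.stdAddChar (-k * y)) * ZMod.stdAddChar (k * x) =
      ((mesh N / Real.sqrt (2 * Real.pi) : ℝ) : ℂ) * ∑ y, u y *
        ∑ k : PeriodicLattice N, ZMod.stdAddChar ((x - y) * k) := by
    simp only [Finset.mul_sum, Finset.sum_mul]
    rw [Finset.sum_comm]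
    refine Finset.sum_congr rfl fun l _ => Finset.sum_congr rfl fun k _ => ?_
    rw [show (x - l) * k = k * x + -k * l by ring, AddChar.map_add_eq_mul]
    ring
  rw [h1]
  simp only [sum_stdAddChar, sub_eq_zero, mul_ite, mul_zero, Finset.sum_ite_eq, Finset.mem_univ,
    if_true]
  linear_combination u x * normalisation N

lemma hat_multiplier (m : ℤ → ℂ) (f : PeriodicLattice N → ℂ) (k : PeriodicLattice N) :
    hat N (multiplier N m f) k = m (repr N k) * hat N f k := by
  rw [multiplier_eq, hat_synth]

lemma hat_add (u v : PeriodicLattice N → ℂ) (k : PeriodicLattice N) :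
    hat N (u + v) k = hat N u k + hat N v k := by
  simp [hat_eq, add_mul, Finset.sum_add_distrib, mul_add]

lemma hat_smul (c : ℂ) (u : PeriodicLattice N → ℂ) (k : PeriodicLattice N) :
    hat N (c • u) k = c * hat N u k := by
  simp only [hat_eq, Pi.smul_apply, smul_eq_mul, Finset.mul_sum]
  exact Finset.sum_congr rfl fun _ _ => by ring

lemma hat_mul (u v : PeriodicLattice N → ℂ) (k : PeriodicLattice N) :
    hat N (u * v) k = ((1 / Real.sqrt (2 * Real.pi) : ℝ) : ℂ) *
      ∑ k₁, hat N u k₁ * hat N v (k - k₁) := by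
  have h : u * v = synth N (fun k => ((1 / Real.sqrt (2 * Real.pi) : ℝ) : ℂ) *
      ∑ k₁, hat N u k₁ * hat N v (k - k₁)) := by
    ext x
    have hu := congrFun (synth_hat N u) x
    have hv := congrFun (synth_hat N v) x
    rw [Pi.mul_apply, ← hu, ← hv]
    simp only [synth]
    have h2 : ∑ k, ((1 / Real.sqrt (2 * Real.pi) : ℝ) : ℂ) *
        (∑ k₁, hat N u k₁ * hat N v (k - k₁)) * ZMod.stdAddChar (k * x) =
        ((1 / Real.sqrt (2 * Real.pi) : ℝ) : ℂ) * ((∑ k, hat N u k * ZMod.stdAddChar (k * x)) *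
          ∑ k, hat N v k * ZMod.stdAddChar (k * x)) := by
      simp only [Finset.mul_sum, Finset.sum_mul]
      rw [Finset.sum_comm]
      conv_rhs => rw [Finset.sum_comm]
      refine Finset.sum_congr rfl fun k₁ _ => ?_
      rw [← Equiv.sum_comp (Equiv.addLeft k₁)]
      refine Finset.sum_congr rfl fun l _ => ?_
      simp only [Equiv.coe_addLeft, add_sub_cancel_left]
      rw [add_mul, AddChar.map_add_eq_mul]
      ring
    rw [h2]
    ring
  rw [h, hat_synth]

lemma meanZero_iff (u : PeriodicLattice N → ℂ) : MeanZero N u ↔ hat N u 0 = 0 := by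
  have hm := mesh_pos (N := N)
  have hs : 0 < Real.sqrt (2 * Real.pi) := by positivity
  rw [hat_eq, MeanZero]
  simp only [neg_zero, zero_mul, AddChar.map_zero_eq_one, mul_one, mul_eq_zero,
    Complex.ofReal_eq_zero, hm.ne', div_eq_zero_iff, hs.ne', or_false]

end Fourier

/-! ### The FPU systems in the interaction picture. -/

section Equation

variable (N : ℕ) [NeZero N]

/-- The coefficient of the wave of sign `i` in the nonlinearity of the wave of sign `σ`: the system
is coupled for `χ = 1` and decoupled for `χ = 0`. -/
noncomputable def coupling (χ : ℂ) (σ i : Bool) : ℂ := if i = σ then 1 else χ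

/-- The multiplier of the quadratic nonlinearity on the Fourier side. -/
noncomputable def fpuSymbol (χ : ℂ) (σ i j : Bool) (k _k₁ : PeriodicLattice N) : ℂ :=
  -(((sgn σ / 4 : ℝ) : ℂ) * ((1 / Real.sqrt (2 * Real.pi) : ℝ) : ℂ) * gradSymbol N (repr N k) *
    (coupling χ σ i * coupling χ σ j))

/-- The FPU system with coupling parameter `χ` for a pair of waves indexed by their signs. -/
def FPUSystem (χ : ℂ) (T : ℝ) (u₀ : Bool → PeriodicLattice N → ℂ)
    (u : Bool → ℝ → PeriodicLattice N → ℂ) : Prop :=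
  ∀ σ, ∀ t ∈ Icc (-T) T, ∀ x : PeriodicLattice N,
    u σ t x = propagator N (sgn σ) t (u₀ σ) x - ((sgn σ / 4 : ℝ) : ℂ) *
      ∫ t' in (0 : ℝ)..t, propagator N (sgn σ) (t - t')
        (grad N ((u σ t' + χ • expDeriv N (sgn σ * (2 * t' / mesh N ^ 2)) (u (!σ) t')) ^ 2)) x

/-- The Fourier coefficients in the interaction picture. -/
noncomputable def profile (u : Bool → ℝ → PeriodicLattice N → ℂ) (t : ℝ) (σ : Bool)
    (k : PeriodicLattice N) : ℂ :=
  osc t (-(sgn σ * signedPhase N 1 (repr N k))) * hat N (u σ t) k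

lemma hat_eq_osc_mul_profile (u : Bool → ℝ → PeriodicLattice N → ℂ) (t : ℝ) (σ : Bool)
    (k : PeriodicLattice N) :
    hat N (u σ t) k = osc t (sgn σ * signedPhase N 1 (repr N k)) * profile N u t σ k := by
  rw [profile, ← mul_assoc, ← osc_add, add_neg_cancel]
  simp [osc]

lemma propagator_symbol (σ t : ℝ) (n : ℤ) :
    Complex.exp (((-σ * (t / mesh N ^ 2) : ℝ) : ℂ) * (gradSymbol N n - derivSymbol n)) =
      osc t (σ * signedPhase N 1 n) := by
  have hm : (mesh N : ℂ) ≠ 0 := by exact_mod_cast (mesh_pos (N := N)).ne'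
  unfold osc gradSymbol derivSymbol signedPhase
  congr 1
  push_cast
  field_simp
  ring

lemma hat_propagator (σ t : ℝ) (f : PeriodicLattice N → ℂ) (k : PeriodicLattice N) :
    hat N (propagator N σ t f) k = osc t (σ * signedPhase N 1 (repr N k)) * hat N f k := by
  rw [propagator, hat_multiplier, propagator_symbol]

/-- The opposite wave oscillates with -σ(n/h² - (2/h³) sin(hn/2)), and the exponential adds 2σn/h².
The result is σ times the phase with the sign of the sine reversed, so both waves take the same
form. -/
lemma hat_coupled (χ : ℂ) (u : Bool → ℝ → PeriodicLattice N → ℂ) (t : ℝ) (σ : Bool)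
    (k : PeriodicLattice N) :
    hat N (u σ t + χ • expDeriv N (sgn σ * (2 * t / mesh N ^ 2)) (u (!σ) t)) k =
      ∑ i, coupling χ σ i * (osc t (sgn σ * signedPhase N (sgn σ * sgn i) (repr N k)) *
        profile N u t i k) := by
  have h1 : Complex.exp (((sgn σ * (2 * t / mesh N ^ 2) : ℝ) : ℂ) * derivSymbol (repr N k)) *
      osc t (sgn (!σ) * signedPhase N 1 (repr N k)) =
        osc t (sgn σ * signedPhase N (sgn σ * sgn (!σ)) (repr N k)) := by
    unfold osc derivSymbol signedPhase
    rw [← Complex.exp_add]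
    congr 1
    cases σ <;> (simp; ring)
  rw [hat_add, hat_smul, expDeriv, hat_multiplier, hat_eq_osc_mul_profile N u t σ,
    hat_eq_osc_mul_profile N u t (!σ), ← mul_assoc (Complex.exp _), h1]
  cases σ
  · simp [coupling]; ring
  · simp [coupling]

/-- In each interaction the phases of the two inputs and the inverse phase of the output at time t'
combine into `resPhase`, by its definition. -/
lemma nonlinearity_eq (χ : ℂ) (u : Bool → ℝ → PeriodicLattice N → ℂ) (t t' : ℝ) (σ : Bool) :
    (-((sgn σ / 4 : ℝ) : ℂ)) • propagator N (sgn σ) (t - t')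
        (grad N ((u σ t' + χ • expDeriv N (sgn σ * (2 * t' / mesh N ^ 2)) (u (!σ) t')) ^ 2)) =
      synth N fun k => osc t (sgn σ * signedPhase N 1 (repr N k)) *
        quadTerm (fpuSymbol N χ) (resPhase N) (profile N u t') (profile N u t') t' σ k := by
  rw [← synth_hat N (_ • _)]
  congr 1
  ext k
  rw [hat_smul, hat_propagator, grad, hat_multiplier, sq, hat_mul]
  simp only [hat_coupled]
  have h1 : osc (t - t') (sgn σ * signedPhase N 1 (repr N k)) =
      osc t (sgn σ * signedPhase N 1 (repr N k)) *
        osc t' (-(sgn σ * signedPhase N 1 (repr N k))) := by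
    unfold osc
    rw [← Complex.exp_add]
    congr 1
    push_cast
    ring
  have h2 : ∀ i j k₁, osc t' (resPhase N σ i j k k₁) =
      osc t' (-(sgn σ * signedPhase N 1 (repr N k))) *
      osc t' (sgn σ * signedPhase N (sgn σ * sgn i) (repr N k₁)) *
      osc t' (sgn σ * signedPhase N (sgn σ * sgn j) (repr N (k - k₁))) := by
    intro i j k₁
    rw [← osc_add, ← osc_add]
    congr 1
    unfold resPhase
    ring
  unfold quadTerm
  simp only [h2, fpuSymbol, h1]
  simp only [Finset.sum_mul_sum]
  simp only [Finset.mul_sum]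
  refine Finset.sum_comm.trans (Finset.sum_congr rfl fun i _ => ?_)
  refine Finset.sum_comm.trans ?_
  refine Finset.sum_congr rfl fun j _ => Finset.sum_congr rfl fun k₁ _ => ?_
  ring

lemma continuousOn_profile {u : Bool → ℝ → PeriodicLattice N → ℂ} {s : Set ℝ}
    (hu : ∀ σ, ContinuousOn (u σ) s) : ContinuousOn (profile N u) s := by
  rw [continuousOn_pi]
  intro σ
  rw [continuousOn_pi]
  intro k
  unfold profile
  simp only [hat_eq]
  have h : ∀ x, ContinuousOn (fun t => u σ t x) s := fun x => continuousOn_pi.1 (hu σ) x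
  refine ContinuousOn.mul (Continuous.continuousOn (by fun_prop)) ?_
  refine ContinuousOn.mul continuousOn_const ?_
  exact continuousOn_finsetSum _ fun x _ => (h x).mul continuousOn_const

/-- The FPU system is equivalent to the integral equation for the profiles. -/
theorem fpuSystem_iff (χ : ℂ) {T : ℝ} {u₀ : Bool → PeriodicLattice N → ℂ}
    {u : Bool → ℝ → PeriodicLattice N → ℂ} (hu : ∀ σ, ContinuousOn (u σ) (Icc (-T) T)) :
    FPUSystem N χ T u₀ u ↔ ∀ t ∈ Icc (-T) T, ∀ σ k, profile N u t σ k = hat N (u₀ σ) k +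
      ∫ t' in (0 : ℝ)..t,
        quadTerm (fpuSymbol N χ) (resPhase N) (profile N u t') (profile N u t') t' σ k := by
  have hcont := continuousOn_profile N hu
  have key : ∀ σ, ∀ t ∈ Icc (-T) T, ∀ x, propagator N (sgn σ) t (u₀ σ) x - ((sgn σ / 4 : ℝ) : ℂ) *
      ∫ t' in (0 : ℝ)..t, propagator N (sgn σ) (t - t')
        (grad N ((u σ t' + χ • expDeriv N (sgn σ * (2 * t' / mesh N ^ 2)) (u (!σ) t')) ^ 2)) x =
      synth N (fun k => osc t (sgn σ * signedPhase N 1 (repr N k)) * (hat N (u₀ σ) k +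
        ∫ t' in (0 : ℝ)..t, quadTerm (fpuSymbol N χ) (resPhase N) (profile N u t')
          (profile N u t') t' σ k)) x := by
    intro σ t ht x
    have h0 : (0 : ℝ) ∈ Icc (-T) T := ⟨by linarith [ht.1, ht.2], by linarith [ht.1, ht.2]⟩
    have hint : ∀ k, IntervalIntegrable (fun t' => quadTerm (fpuSymbol N χ) (resPhase N)
        (profile N u t') (profile N u t') t' σ k) volume 0 t := fun k =>
      ((continuousOn_quadTerm hcont σ k).mono (uIcc_subset_Icc h0 ht)).intervalIntegrable
    have h1 : propagator N (sgn σ) t (u₀ σ) x =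
        synth N (fun k => osc t (sgn σ * signedPhase N 1 (repr N k)) * hat N (u₀ σ) k) x := by
      rw [← synth_hat N (propagator N (sgn σ) t (u₀ σ))]
      congr 1
      ext k
      rw [hat_propagator]
    rw [sub_eq_add_neg, ← neg_mul, ← intervalIntegral.integral_const_mul]
    have h2 : ∀ t', -((sgn σ / 4 : ℝ) : ℂ) * propagator N (sgn σ) (t - t')
        (grad N ((u σ t' + χ • expDeriv N (sgn σ * (2 * t' / mesh N ^ 2)) (u (!σ) t')) ^ 2)) x =
        ((1 / Real.sqrt (2 * Real.pi) : ℝ) : ℂ) * ∑ k,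
          (osc t (sgn σ * signedPhase N 1 (repr N k)) * ZMod.stdAddChar (k * x)) *
          quadTerm (fpuSymbol N χ) (resPhase N) (profile N u t') (profile N u t') t' σ k := by
      intro t'
      have := congrFun (nonlinearity_eq N χ u t t' σ) x
      rw [Pi.smul_apply, smul_eq_mul] at this
      rw [this, synth]
      congr 1
      exact Finset.sum_congr rfl fun k _ => by ring
    simp only [h2]
    rw [intervalIntegral.integral_const_mul, intervalIntegral.integral_finsetSum
      fun k _ => (hint k).const_mul _, h1]
    simp only [intervalIntegral.integral_const_mul, synth]
    rw [← mul_add, ← Finset.sum_add_distrib]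
    congr 1
    exact Finset.sum_congr rfl fun k _ => by ring
  constructor
  · intro h t ht σ k
    have h1 : u σ t = synth N (fun k => osc t (sgn σ * signedPhase N 1 (repr N k)) *
        (hat N (u₀ σ) k + ∫ t' in (0 : ℝ)..t, quadTerm (fpuSymbol N χ) (resPhase N)
          (profile N u t') (profile N u t') t' σ k)) := by
      ext x
      rw [h σ t ht x, key σ t ht x]
    rw [profile, h1, hat_synth, ← mul_assoc, ← osc_add, neg_add_cancel]
    simp [osc]
  · intro h σ t ht x
    rw [key σ t ht x, ← congrFun (synth_hat N (u σ t)) x]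
    congr 1
    ext k
    rw [hat_eq_osc_mul_profile, h t ht σ k]

end Equation

end PeriodicFPU

/-! ### Time rescaling, Sobolev weights and removal of zero modes. -/

namespace PeriodicFPU

set_option linter.unusedSectionVars false

section Measure

/-- Stated without measurability, because the constructed spectrum is only known to be integrable
mode by mode. Replacing each section by a measurable minorant with the same integral gives this
direction. -/
lemma sum_lintegral_le_specMeasure {ι : Type*} [Fintype ι] [MeasurableSpace ι]
    [DiscreteMeasurableSpace ι] (f : ι × ℝ → ℝ≥0∞) :
    ∑ k, ∫⁻ x, f (k, x) ≤ ∫⁻ p, f p ∂(specMeasure ι) := by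
  choose g hg hgf hint using fun k => exists_measurable_le_lintegral_eq volume fun x => f (k, x)
  have hG : Measurable fun p : ι × ℝ => g p.1 p.2 := measurable_from_prod_countable_right hg
  calc ∑ k, ∫⁻ x, f (k, x) = ∑ k, ∫⁻ x, g k x := by simp only [hint]
    _ = ∫⁻ p, g p.1 p.2 ∂(specMeasure ι) := by
        rw [lintegral_prod _ hG.aemeasurable, lintegral_count, tsum_fintype]
    _ ≤ _ := lintegral_mono fun p => hgf p.1 p.2

lemma lintegral_comp_affine {T : ℝ} (hT : 0 < T) (c : ℝ) (f : ℝ → ℝ≥0∞) :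
    ∫⁻ x, f (T * (x - c)) = ENNReal.ofReal T⁻¹ * ∫⁻ x, f x := by
  rw [lintegral_sub_right_eq_self (fun x => f (T * x)) c]
  have h := (Homeomorph.mulLeft₀ T hT.ne').measurableEmbedding.lintegral_map (μ := volume) f
  simp only [Homeomorph.coe_mulLeft₀] at h
  rw [← h, Real.map_volume_mul_left hT.ne', lintegral_smul_measure, abs_of_pos (by positivity),
    smul_eq_mul]

lemma integral_comp_affine {T : ℝ} (hT : 0 < T) (c : ℝ) (f : ℝ → ℂ) :
    ∫ x, f (T * (x - c)) = ((T⁻¹ : ℝ) : ℂ) * ∫ x, f x := by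
  rw [integral_sub_right_eq_self (fun x => f (T * x)) c, Measure.integral_comp_mul_left,
    abs_of_pos (by positivity), Complex.real_smul]

lemma integrable_comp_affine {T : ℝ} (hT : 0 < T) (c : ℝ) {f : ℝ → ℂ} (hf : Integrable f) :
    Integrable fun x => f (T * (x - c)) :=
  (hf.comp_mul_left' hT.ne').comp_sub_right c

end Measure

section Weights

lemma bracket_pos (x : ℝ) : 0 < bracket x := by unfold bracket; positivity

lemma bracket_le_mul {x y z : ℝ} (h : |x| ≤ |y| + |z|) :
    bracket x ≤ Real.sqrt 2 * (bracket y * bracket z) := by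
  unfold bracket
  rw [← Real.sqrt_mul (by positivity), ← Real.sqrt_mul (by norm_num)]
  refine Real.sqrt_le_sqrt ?_
  have h1 : x ^ 2 ≤ (|y| + |z|) ^ 2 := by rw [← sq_abs]; gcongr
  have h2 : y ^ 2 = |y| ^ 2 := (sq_abs y).symm
  have h3 : z ^ 2 = |z| ^ 2 := (sq_abs z).symm
  rw [h2, h3]
  nlinarith [sq_nonneg (|y| - |z|), mul_nonneg (sq_nonneg |y|) (sq_nonneg |z|)]

variable (N : ℕ) [NeZero N]

/-- The Sobolev weight, normalised so as to be submultiplicative along interactions. -/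
noncomputable def sobWt (s : ℝ) (k : PeriodicLattice N) : ℝ :=
  Real.sqrt 2 ^ s * bracket (repr N k) ^ s

lemma sobWt_pos (s : ℝ) (k : PeriodicLattice N) : 0 < sobWt N s k := by
  have := bracket_pos (repr N k)
  unfold sobWt; positivity

/-- From ⟨k⟩ ≤ √2 ⟨k₁⟩⟨k - k₁⟩; the factor √2^s in the weight absorbs the constant, so that the
normalised symbol is no larger than the original one. -/
lemma sobWt_le {s : ℝ} (hs : 0 ≤ s) (k k₁ : PeriodicLattice N) :
    sobWt N s k ≤ sobWt N s k₁ * sobWt N s (k - k₁) := by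
  have h := bracket_le_mul (x := repr N k) (y := repr N k₁) (z := repr N (k - k₁))
    (by exact_mod_cast abs_repr_triangle k k₁)
  have h0 := bracket_pos (repr N k)
  have h1 := bracket_pos (repr N k₁)
  have h2 := bracket_pos (repr N (k - k₁))
  unfold sobWt
  rw [← Real.mul_rpow (by positivity) h0.le, ← Real.mul_rpow (by positivity) h1.le,
    ← Real.mul_rpow (by positivity) h2.le, ← Real.mul_rpow (by positivity) (by positivity)]
  refine Real.rpow_le_rpow (by positivity) ?_ hs
  calc _ ≤ Real.sqrt 2 * (Real.sqrt 2 * (bracket (repr N k₁) * bracket (repr N (k - k₁)))) := by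
        gcongr
    _ = _ := by ring

lemma norm_gradSymbol_le (n : ℤ) : ‖gradSymbol N n‖ ≤ |(n : ℝ)| := by
  have hm := mesh_pos (N := N)
  rw [gradSymbol, norm_mul, Complex.norm_I, one_mul, Complex.norm_real, Real.norm_eq_abs, abs_mul,
    abs_of_pos (by positivity)]
  calc 2 / mesh N * |Real.sin (mesh N * n / 2)| ≤ 2 / mesh N * |mesh N * n / 2| :=
        mul_le_mul_of_nonneg_left Real.abs_sin_le_abs (by positivity)
    _ = |(n : ℝ)| := by
        rw [abs_div, abs_mul, abs_two, abs_of_pos hm]; field_simp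

lemma norm_coupling_le {χ : ℂ} (hχ : ‖χ‖ ≤ 1) (σ i : Bool) : ‖coupling χ σ i‖ ≤ 1 := by
  unfold coupling; split_ifs <;> simp [hχ]

lemma norm_fpuSymbol_le {χ : ℂ} (hχ : ‖χ‖ ≤ 1) (σ i j : Bool) (k k₁ : PeriodicLattice N) :
    ‖fpuSymbol N χ σ i j k k₁‖ ≤ |(repr N k : ℝ)| := by
  have h1 : ‖((sgn σ / 4 : ℝ) : ℂ)‖ ≤ 1 := by
    rw [Complex.norm_real]; cases σ <;> norm_num [sgn]
  have h2 : ‖((1 / Real.sqrt (2 * Real.pi) : ℝ) : ℂ)‖ ≤ 1 := by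
    rw [Complex.norm_real, Real.norm_of_nonneg (by positivity), div_le_one (by positivity),
      Real.one_le_sqrt]
    linarith [Real.pi_gt_three]
  have h3 := norm_gradSymbol_le N (repr N k)
  have h4 := norm_coupling_le hχ σ i
  have h5 := norm_coupling_le hχ σ j
  rw [fpuSymbol, norm_neg, norm_mul, norm_mul, norm_mul, norm_mul]
  calc _ ≤ 1 * 1 * |(repr N k : ℝ)| * (1 * 1) := by gcongr
    _ = _ := by ring

lemma fpuSymbol_zero (χ : ℂ) (σ i j : Bool) (k₁ : PeriodicLattice N) :
    fpuSymbol N χ σ i j 0 k₁ = 0 := by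
  simp [fpuSymbol, gradSymbol]

open Classical in
/-- The symbol of the nonlinearity after rescaling time and normalising the Sobolev weight, without
the interactions of zero modes. -/
noncomputable def scaledSymbol (s T : ℝ) (χ : ℂ) (σ i j : Bool) (k k₁ : PeriodicLattice N) : ℂ :=
  if k = 0 ∨ k₁ = 0 ∨ k = k₁ then 0 else
    ((T * (sobWt N s k / (sobWt N s k₁ * sobWt N s (k - k₁))) : ℝ) : ℂ) * fpuSymbol N χ σ i j k k₁

lemma enorm_scaledSymbol_le {s : ℝ} (hs : 0 ≤ s) {T : ℝ} (hT : 0 < T) {χ : ℂ} (hχ : ‖χ‖ ≤ 1)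
    (σ i j : Bool) (k k₁ : PeriodicLattice N) :
    ‖scaledSymbol N s T χ σ i j k k₁‖ₑ ≤
      nonzeroInd k k₁ * ENNReal.ofReal (T * |(repr N k : ℝ)|) := by
  unfold scaledSymbol nonzeroInd
  split_ifs with h
  · simp
  · have h0 := sobWt_pos N s k
    have h1 := sobWt_pos N s k₁
    have h2 := sobWt_pos N s (k - k₁)
    rw [one_mul, ← ofReal_norm]
    refine ENNReal.ofReal_le_ofReal ?_
    have h3 : sobWt N s k / (sobWt N s k₁ * sobWt N s (k - k₁)) ≤ 1 :=
      (div_le_one (by positivity)).2 (sobWt_le N hs k k₁)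
    have h4 := norm_fpuSymbol_le N hχ σ i j k k₁
    rw [norm_mul, Complex.norm_real, Real.norm_of_nonneg (by positivity)]
    calc _ ≤ T * 1 * |(repr N k : ℝ)| := by gcongr
      _ = _ := by ring

lemma quadTerm_scaledSymbol_zero (s T : ℝ) (χ : ℂ)
    (Θ : Bool → Bool → Bool → PeriodicLattice N → PeriodicLattice N → ℝ)
    (b : Bool → PeriodicLattice N → ℂ) (t : ℝ) (σ : Bool) :
    quadTerm (scaledSymbol N s T χ) Θ b b t σ 0 = 0 := by
  simp [quadTerm, scaledSymbol]

/-- Discarding the zero modes changes nothing: the symbol of ∇_h vanishes at k = 0, and terms with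
k₁ = 0 or k₁ = k contain a factor b(0) = 0. -/
lemma quadTerm_scaledSymbol (s : ℝ) {T : ℝ} (χ : ℂ) {b : Bool → PeriodicLattice N → ℂ}
    (hb : ∀ σ, b σ 0 = 0) (t : ℝ) (σ : Bool) (k : PeriodicLattice N) :
    quadTerm (scaledSymbol N s T χ) (fun σ i j k k₁ => T * resPhase N σ i j k k₁) b b t σ k =
      T * (sobWt N s k * quadTerm (fpuSymbol N χ) (resPhase N)
        (fun σ k => ((sobWt N s k)⁻¹ : ℝ) * b σ k) (fun σ k => ((sobWt N s k)⁻¹ : ℝ) * b σ k)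
        (T * t) σ k) := by
  unfold quadTerm
  simp only [Finset.mul_sum]
  refine Finset.sum_congr rfl fun i _ => Finset.sum_congr rfl fun j _ =>
    Finset.sum_congr rfl fun k₁ _ => ?_
  unfold scaledSymbol
  split_ifs with h
  · rcases h with rfl | rfl | rfl
    · simp [fpuSymbol_zero]
    · simp [hb]
    · simp [hb]
  · have e : osc t (T * resPhase N σ i j k k₁) = osc (T * t) (resPhase N σ i j k k₁) := by
      unfold osc
      congr 2
      push_cast
      ring
    rw [e]
    push_cast
    have h1 : (sobWt N s k₁ : ℂ) ≠ 0 := by exact_mod_cast (sobWt_pos N s k₁).ne'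
    have h2 : (sobWt N s (k - k₁) : ℂ) ≠ 0 := by exact_mod_cast (sobWt_pos N s (k - k₁)).ne'
    field_simp

lemma sum_sobWt_sq (s : ℝ) (u₀ : Bool → PeriodicLattice N → ℂ) :
    ∑ σ, ∑ k, ‖(sobWt N s k : ℂ) * hat N (u₀ σ) k‖ ^ 2 =
      (Real.sqrt 2 ^ s) ^ 2 * pairNorm N s (u₀ true) (u₀ false) ^ 2 := by
  have h : ∀ σ, ∑ k, ‖(sobWt N s k : ℂ) * hat N (u₀ σ) k‖ ^ 2 =
      (Real.sqrt 2 ^ s) ^ 2 * sobolevNorm N s (u₀ σ) ^ 2 := by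
    intro σ
    rw [sobolevNorm, Real.sq_sqrt (Finset.sum_nonneg fun n _ => by
      have := bracket_pos n; positivity), sum_freqs, Finset.mul_sum]
    refine Finset.sum_congr rfl fun k _ => ?_
    have hb := bracket_pos (repr N k)
    rw [norm_mul, Complex.norm_real, Real.norm_of_nonneg (sobWt_pos N s k).le, mul_pow, sobWt,
      mul_pow, mul_comm 2 s, Real.rpow_mul hb.le, Real.rpow_two, mul_assoc]
    rfl
  rw [pairNorm, Real.sq_sqrt (by positivity), Fintype.sum_bool, h, h]
  ring

end Weights

/-! ### From the rescaled spectrum back to the Y norm. -/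

section Solution

variable (N : ℕ) [NeZero N]

/-- The function of space and time with the rescaled interaction-picture spectrum `g`. -/
noncomputable def fromSpectrum (s T : ℝ) (g : Bool → PeriodicLattice N × ℝ → ℂ) (σ : Bool) (t : ℝ) :
    PeriodicLattice N → ℂ :=
  synth N fun k => osc t (sgn σ * signedPhase N 1 (repr N k)) *
    (((sobWt N s k)⁻¹ : ℝ) * modes g (t / T) σ k)

lemma profile_fromSpectrum (s T : ℝ) (g : Bool → PeriodicLattice N × ℝ → ℂ) (t : ℝ) (σ : Bool)
    (k : PeriodicLattice N) :
    profile N (fromSpectrum N s T g) t σ k = ((sobWt N s k)⁻¹ : ℝ) * modes g (t / T) σ k := by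
  rw [profile, fromSpectrum, hat_synth, ← mul_assoc, ← osc_add, neg_add_cancel]
  simp [osc]

lemma continuous_fromSpectrum (s T : ℝ) {g : Bool → PeriodicLattice N × ℝ → ℂ}
    (hg : ModesIntegrable g) (σ : Bool) : Continuous (fromSpectrum N s T g σ) := by
  refine continuous_pi fun x => ?_
  unfold fromSpectrum synth
  have h : ∀ k, Continuous fun t => modes g (t / T) σ k := fun k =>
    (continuous_modes hg σ k).comp (continuous_id.div_const T)
  fun_prop

lemma phase_eq (n : ℤ) : phase N n = signedPhase N 1 n := by
  have := (mesh_pos (N := N)).ne'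
  unfold phase signedPhase
  field_simp

/-- The space-time Fourier transform of `fromSpectrum`. -/
noncomputable def spaceTimeSpectrum (s T : ℝ) (g : Bool → PeriodicLattice N × ℝ → ℂ) (σ : Bool)
    (τ : ℝ) (n : ℤ) : ℂ :=
  ((Real.sqrt (2 * Real.pi) * T * (sobWt N s (n : ZMod (2 * N)))⁻¹ : ℝ) : ℂ) *
    g σ ((n : ZMod (2 * N)), T * (τ - sgn σ * phase N n))

/-- The substitution x = T(τ - σ s_h(k)) undoes both the interaction picture and the rescaling; its
Jacobian and the normalisation of the inversion formula account for the factor √(2π) T. -/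
lemma isSpaceTimeFourier_fromSpectrum (s : ℝ) {T : ℝ} (hT : 0 < T)
    {g : Bool → PeriodicLattice N × ℝ → ℂ} (hg : ModesIntegrable g) (σ : Bool) :
    IsSpaceTimeFourier N (fromSpectrum N s T g σ) (spaceTimeSpectrum N s T g σ) := by
  intro n hn
  refine ⟨(integrable_comp_affine hT _ (hg σ n)).const_mul _, fun t => ?_⟩
  rw [latticeFourier_eq_hat N _ hn, fromSpectrum, hat_synth, repr_intCast hn, ← phase_eq]
  unfold spaceTimeSpectrum
  set w := sobWt N s (n : ZMod (2 * N))
  set c := sgn σ * phase N n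
  have h1 : ∀ τ, Complex.exp (Complex.I * ((t * τ : ℝ) : ℂ)) *
      (((Real.sqrt (2 * Real.pi) * T * w⁻¹ : ℝ) : ℂ) * g σ ((n : ZMod (2 * N)), T * (τ - c))) =
      ((Real.sqrt (2 * Real.pi) * T * w⁻¹ : ℝ) : ℂ) * osc t c *
        (fun x => osc (t / T) x * g σ ((n : ZMod (2 * N)), x)) (T * (τ - c)) := by
    intro τ
    have h2 : Complex.exp (Complex.I * ((t * τ : ℝ) : ℂ)) = osc t c * osc (t / T) (T * (τ - c)) := by
      unfold osc
      rw [← Complex.exp_add]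
      congr 1
      have hT' : (T : ℂ) ≠ 0 := by exact_mod_cast hT.ne'
      push_cast
      field_simp
      ring
    rw [h2]
    ring
  have h2 : ∫ x, osc (t / T) (T * (x - c)) * g σ ((n : ZMod (2 * N)), T * (x - c)) =
      ((T⁻¹ : ℝ) : ℂ) * ∫ x, osc (t / T) x * g σ ((n : ZMod (2 * N)), x) :=
    integral_comp_affine hT c fun x => osc (t / T) x * g σ ((n : ZMod (2 * N)), x)
  simp only [h1]
  rw [integral_const_mul, h2]
  unfold modes timeFT
  have hs : (Real.sqrt (2 * Real.pi) : ℂ) ≠ 0 := by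
    have : 0 < Real.sqrt (2 * Real.pi) := by positivity
    exact_mod_cast this.ne'
  have hT' : (T : ℂ) ≠ 0 := by exact_mod_cast hT.ne'
  push_cast
  field_simp

/-- In the X part, the squared amplitude T² and the Jacobian 1/T leave the weight T⟨x/T⟩, so for T ≤
1 undoing the rescaling costs nothing. In the ℓ²L¹ part the powers of T cancel exactly. -/
lemma mul_bracket_div_le {T : ℝ} (hT : 0 < T) (hT1 : T ≤ 1) (x : ℝ) :
    T * bracket (x / T) ≤ 1 + |x| := by
  have h : T * bracket (x / T) = Real.sqrt (T ^ 2 + x ^ 2) := by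
    rw [bracket, ← Real.sqrt_sq hT.le, ← Real.sqrt_mul (by positivity), Real.sqrt_sq hT.le]
    congr 1
    field_simp
  rw [h]
  refine Real.sqrt_le_iff.2 ⟨by positivity, ?_⟩
  have : T ^ 2 ≤ 1 := pow_le_one₀ hT.le hT1
  nlinarith [sq_abs x, abs_nonneg x]

lemma sqrt_two_rpow_inv_le_one {s : ℝ} (hs : 0 ≤ s) : (Real.sqrt 2 ^ s)⁻¹ ≤ 1 :=
  inv_le_one_of_one_le₀ (Real.one_le_rpow (by rw [Real.one_le_sqrt]; norm_num) hs)

lemma xNormHat_spaceTimeSpectrum_le {s : ℝ} (hs : 0 ≤ s) {T : ℝ} (hT : 0 < T) (hT1 : T ≤ 1)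
    (g : Bool → PeriodicLattice N × ℝ → ℂ) (σ : Bool) :
    xNormHat N s (1 / 2) (fun k => sgn σ * phase N k) (spaceTimeSpectrum N s T g σ) ≤
      (ENNReal.ofReal (2 * Real.pi) * ySys (eNorms g)) ^ (1 / 2 : ℝ) := by
  unfold xNormHat
  refine ENNReal.rpow_le_rpow ?_ (by norm_num)
  have hy : ∑ k, ∫⁻ x, wt x * eNorms g σ (k, x) ^ 2 ≤ ySys (eNorms g) := by
    refine (sum_lintegral_le_specMeasure fun p => wt p.2 * eNorms g σ p ^ 2).trans ?_
    refine le_trans (le_self_add : _ ≤ ySq (eNorms g σ)) ?_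
    exact Finset.single_le_sum (f := fun σ => ySq (eNorms g σ)) (fun _ _ => zero_le)
      (Finset.mem_univ σ)
  refine le_trans ?_ (mul_le_mul_right hy _)
  rw [sum_freqs, Finset.mul_sum]
  refine Finset.sum_le_sum fun k _ => ?_
  have hb := bracket_pos (repr N k)
  set c := sgn σ * phase N (repr N k)
  have hA : 0 < Real.sqrt 2 ^ s := by positivity
  have h1 : ∀ τ, ENNReal.ofReal (bracket (repr N k : ℝ) ^ (2 * s) *
      bracket (τ - c) ^ (2 * (1 / 2 : ℝ))) * ‖spaceTimeSpectrum N s T g σ τ (repr N k)‖ₑ ^ 2 ≤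
      (fun x => ENNReal.ofReal (2 * Real.pi) * ENNReal.ofReal T *
        (wt x * eNorms g σ (k, x) ^ 2)) (T * (τ - c)) := by
    intro τ
    unfold spaceTimeSpectrum wt eNorms
    simp only [coe_repr]
    rw [enorm_mul, ← ofReal_norm (((_ : ℝ) : ℂ)), Complex.norm_real,
      Real.norm_of_nonneg (by have := sobWt_pos N s k; positivity), mul_pow,
      ← ENNReal.ofReal_pow (by have := sobWt_pos N s k; positivity), ← mul_assoc,
      ← ENNReal.ofReal_mul (by have := bracket_pos (τ - c); positivity), ← mul_assoc,
      ← ENNReal.ofReal_mul (by positivity), ← ENNReal.ofReal_mul (by positivity)]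
    refine mul_le_mul_left (ENNReal.ofReal_le_ofReal ?_) _
    have h2 := mul_bracket_div_le hT hT1 (T * (τ - c))
    rw [mul_div_cancel_left₀ _ hT.ne'] at h2
    have h3 := sqrt_two_rpow_inv_le_one hs
    have h4 : bracket (repr N k : ℝ) ^ (2 * s) * (sobWt N s k)⁻¹ ^ 2 = (Real.sqrt 2 ^ s)⁻¹ ^ 2 := by
      have : 0 < bracket (repr N k : ℝ) ^ s := by positivity
      rw [sobWt, mul_comm 2 s, Real.rpow_mul hb.le, Real.rpow_two]
      field_simp
    calc bracket (repr N k : ℝ) ^ (2 * s) * bracket (τ - c) ^ (2 * (1 / 2 : ℝ)) *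
          (Real.sqrt (2 * Real.pi) * T * (sobWt N s k)⁻¹) ^ 2
        = (bracket (repr N k : ℝ) ^ (2 * s) * (sobWt N s k)⁻¹ ^ 2) *
          (Real.sqrt (2 * Real.pi) ^ 2 * T * (T * bracket (τ - c))) := by
          rw [show (2 * (1 / 2 : ℝ)) = 1 by norm_num, Real.rpow_one]; ring
      _ = (Real.sqrt 2 ^ s)⁻¹ ^ 2 * (2 * Real.pi * T * (T * bracket (τ - c))) := by
          rw [h4, Real.sq_sqrt (by positivity)]
      _ ≤ 1 ^ 2 * (2 * Real.pi * T * (1 + |T * (τ - c)|)) := by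
          have := bracket_pos (τ - c)
          gcongr
      _ = _ := by ring
  refine (lintegral_mono h1).trans ?_
  rw [lintegral_comp_affine hT c fun x => ENNReal.ofReal (2 * Real.pi) * ENNReal.ofReal T *
    (wt x * eNorms g σ (k, x) ^ 2), lintegral_const_mul' _ _ (by finiteness), ← mul_assoc, mul_left_comm,
    ← mul_assoc, mul_assoc (ENNReal.ofReal (2 * Real.pi)), ← ENNReal.ofReal_mul (by positivity),
    inv_mul_cancel₀ hT.ne', ENNReal.ofReal_one, mul_one]

lemma ellTwoLOneNorm_spaceTimeSpectrum_le {s : ℝ} (hs : 0 ≤ s) {T : ℝ} (hT : 0 < T)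
    (g : Bool → PeriodicLattice N × ℝ → ℂ) (σ : Bool) :
    ellTwoLOneNorm N s (spaceTimeSpectrum N s T g σ) ≤
      (ENNReal.ofReal (2 * Real.pi) * ySys (eNorms g)) ^ (1 / 2 : ℝ) := by
  unfold ellTwoLOneNorm
  refine ENNReal.rpow_le_rpow ?_ (by norm_num)
  have hy : ∑ k, (∫⁻ x, eNorms g σ (k, x)) ^ 2 ≤ ySys (eNorms g) := by
    refine le_trans (le_add_self : _ ≤ ySq (eNorms g σ)) ?_
    exact Finset.single_le_sum (f := fun σ => ySq (eNorms g σ)) (fun _ _ => zero_le)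
      (Finset.mem_univ σ)
  refine le_trans ?_ (mul_le_mul_right hy _)
  rw [sum_freqs, Finset.mul_sum]
  refine Finset.sum_le_sum fun k _ => ?_
  have hb := bracket_pos (repr N k)
  set c := sgn σ * phase N (repr N k)
  have hw := sobWt_pos N s k
  have h1 : ∀ τ, ENNReal.ofReal (bracket (repr N k : ℝ) ^ s) *
      ‖spaceTimeSpectrum N s T g σ τ (repr N k)‖ₑ ≤
      (fun x => ENNReal.ofReal (Real.sqrt (2 * Real.pi)) * ENNReal.ofReal T *
        eNorms g σ (k, x)) (T * (τ - c)) := by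
    intro τ
    unfold spaceTimeSpectrum eNorms
    simp only [coe_repr]
    rw [enorm_mul, ← ofReal_norm (((_ : ℝ) : ℂ)), Complex.norm_real,
      Real.norm_of_nonneg (by positivity), ← mul_assoc,
      ← ENNReal.ofReal_mul (by positivity), ← ENNReal.ofReal_mul (by positivity)]
    refine mul_le_mul_left (ENNReal.ofReal_le_ofReal ?_) _
    have h3 := sqrt_two_rpow_inv_le_one hs
    have h4 : bracket (repr N k : ℝ) ^ s * (sobWt N s k)⁻¹ = (Real.sqrt 2 ^ s)⁻¹ := by
      have : 0 < bracket (repr N k : ℝ) ^ s := by positivity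
      have : 0 < Real.sqrt 2 ^ s := by positivity
      rw [sobWt]
      field_simp
    calc bracket (repr N k : ℝ) ^ s * (Real.sqrt (2 * Real.pi) * T * (sobWt N s k)⁻¹)
        = (bracket (repr N k : ℝ) ^ s * (sobWt N s k)⁻¹) * (Real.sqrt (2 * Real.pi) * T) := by ring
      _ ≤ 1 * (Real.sqrt (2 * Real.pi) * T) := by rw [h4]; gcongr
      _ = _ := by ring
  have h2 : (∫⁻ τ, ENNReal.ofReal (bracket (repr N k : ℝ) ^ s) *
      ‖spaceTimeSpectrum N s T g σ τ (repr N k)‖ₑ) ≤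
      ENNReal.ofReal (Real.sqrt (2 * Real.pi)) * ∫⁻ x, eNorms g σ (k, x) := by
    refine (lintegral_mono h1).trans ?_
    rw [lintegral_comp_affine hT c fun x => ENNReal.ofReal (Real.sqrt (2 * Real.pi)) *
      ENNReal.ofReal T * eNorms g σ (k, x), lintegral_const_mul' _ _ (by finiteness), ← mul_assoc,
      mul_left_comm, mul_comm, mul_comm (ENNReal.ofReal _) (_ * _)]
    rw [← ENNReal.ofReal_mul (by positivity), inv_mul_cancel₀ hT.ne', ENNReal.ofReal_one, one_mul,
      mul_comm]
  calc _ ≤ (ENNReal.ofReal (Real.sqrt (2 * Real.pi)) * ∫⁻ x, eNorms g σ (k, x)) ^ 2 := by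
        gcongr
    _ = _ := by
        rw [mul_pow, ← ENNReal.ofReal_pow (by positivity), Real.sq_sqrt (by positivity)]

end Solution

end PeriodicFPU

/-! ### Lifespan, existence, and the two systems. -/

namespace PeriodicFPU

set_option linter.unusedSectionVars false

section WellPosedness

/-- The time of existence as a function of the size of the data. -/
noncomputable def lifespan (L R : ℝ) : ℝ := (1 + L * max R 0 ^ 2) ^ (-4 : ℝ)

lemma lifespan_base_pos {L : ℝ} (hL : 0 ≤ L) (R : ℝ) : 1 ≤ 1 + L * max R 0 ^ 2 := by
  have : 0 ≤ L * max R 0 ^ 2 := by positivity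
  linarith

lemma antitone_lifespan {L : ℝ} (hL : 0 ≤ L) : Antitone (lifespan L) := by
  intro a b hab
  have := lifespan_base_pos hL a
  refine Real.rpow_le_rpow_of_nonpos (by linarith) ?_ (by norm_num)
  gcongr

lemma lifespan_pos {L : ℝ} (hL : 0 ≤ L) (R : ℝ) : 0 < lifespan L R :=
  Real.rpow_pos_of_pos (by linarith [lifespan_base_pos hL R]) _

lemma lifespan_le_one {L : ℝ} (hL : 0 ≤ L) (R : ℝ) : lifespan L R ≤ 1 :=
  Real.rpow_le_one_of_one_le_of_nonpos (lifespan_base_pos hL R) (by norm_num)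

/-- The exponent -4 is matched to the gain T^{1/4}: the power is (1 + LR²)^{-1}. -/
lemma lifespan_mul_le_one {L : ℝ} (hL : 0 ≤ L) {R : ℝ} (hR : 0 ≤ R) :
    L * R ^ 2 * lifespan L R ^ (1 / 4 : ℝ) ≤ 1 := by
  have h := lifespan_base_pos hL R
  rw [lifespan, ← Real.rpow_mul (by linarith), max_eq_left hR] at *
  norm_num
  rw [Real.rpow_neg_one, ← div_eq_mul_inv, div_le_one (by linarith)]
  linarith

variable (N : ℕ) [NeZero N]

/-- Uniqueness for the FPU system with coupling parameter `χ`. -/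
theorem FPUSystem.eqOn {χ : ℂ} {T : ℝ} (hT : 0 < T) {u₀ : Bool → PeriodicLattice N → ℂ}
    {u w : Bool → ℝ → PeriodicLattice N → ℂ} (hu : ∀ σ, ContinuousOn (u σ) (Icc (-T) T))
    (hw : ∀ σ, ContinuousOn (w σ) (Icc (-T) T)) (hu' : FPUSystem N χ T u₀ u)
    (hw' : FPUSystem N χ T u₀ w) (σ : Bool) : EqOn (w σ) (u σ) (Icc (-T) T) := by
  have h := quadTerm_solution_unique (fpuSymbol N χ) (resPhase N) (fun σ => hat N (u₀ σ)) hT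
    (continuousOn_profile N hw) (continuousOn_profile N hu)
    ((fpuSystem_iff N χ hw).1 hw') ((fpuSystem_iff N χ hu).1 hu')
  intro t ht
  rw [← synth_hat N (w σ t), ← synth_hat N (u σ t)]
  congr 1
  ext k
  rw [hat_eq_osc_mul_profile, hat_eq_osc_mul_profile, h ht]

lemma ENNReal_rpow_half_le {P Q : ℝ} (hP : 0 ≤ P) (hQ : 0 ≤ Q) {Y : ℝ≥0∞}
    (hY : Y ≤ ENNReal.ofReal Q) :
    (ENNReal.ofReal P * Y) ^ (1 / 2 : ℝ) ≤ ENNReal.ofReal (Real.sqrt (P * Q)) := by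
  calc (ENNReal.ofReal P * Y) ^ (1 / 2 : ℝ) ≤ (ENNReal.ofReal P * ENNReal.ofReal Q) ^ (1 / 2 : ℝ) := by
        gcongr
    _ = _ := by
        rw [← ENNReal.ofReal_mul hP, ENNReal.ofReal_rpow_of_nonneg (by positivity) (by norm_num),
          Real.sqrt_eq_rpow]

/-- Existence for the FPU system with coupling parameter `χ`, with bounds uniform in the mesh
size. -/
theorem exists_fpuSystem_solution {s : ℝ} (hs : 0 ≤ s) : ∃ C L : ℝ, 0 < C ∧ 0 ≤ L ∧
    ∀ (N : ℕ) [NeZero N] (χ : ℂ), ‖χ‖ ≤ 1 → ∀ u₀ : Bool → PeriodicLattice N → ℂ,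
      (∀ σ, MeanZero N (u₀ σ)) → ∀ R : ℝ, R = pairNorm N s (u₀ true) (u₀ false) →
      ∃ u : Bool → ℝ → PeriodicLattice N → ℂ, (∀ σ, Continuous (u σ)) ∧
        FPUSystem N χ (lifespan L R) u₀ u ∧
        (∀ σ, ∀ t ∈ Icc (-lifespan L R) (lifespan L R), MeanZero N (u σ t)) ∧
        ∀ σ, yNormLoc N (sgn σ) s (lifespan L R) (u σ) ≤ ENNReal.ofReal (C * R) := by
  obtain ⟨K, hK, hex⟩ := exists_uniform_spectral_solution (c := 1 / 200) (S := (9 * sepSum).toReal)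
    (by norm_num) ENNReal.toReal_nonneg smoothSum_ne_top
  set A : ℝ := (Real.sqrt 2 ^ s) ^ 2 with hA
  have hA0 : 0 < A := by rw [hA]; positivity
  have hL : 0 ≤ K * A := by positivity
  -- The two parts of the Y norm are each at most √(2πKA) R, where A is the constant of the
  -- normalised Sobolev weight.
  refine ⟨2 * Real.sqrt (2 * Real.pi * (K * A)), K * A, by positivity, hL, ?_⟩
  intro N _ χ hχ u₀ hmean R hR
  have hR0 : 0 ≤ R := by rw [hR]; exact Real.sqrt_nonneg _
  set T := lifespan (K * A) R with hTdef
  have hT : 0 < T := lifespan_pos hL R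
  have hT1 : T ≤ 1 := lifespan_le_one hL R
  have hsum := sum_sobWt_sq N s u₀
  rw [← hR, ← hA] at hsum
  obtain ⟨g, hg, hgY, hgeq⟩ := hex (PeriodicLattice N) T (fun k => |(repr N k : ℝ)|)
    (fun σ i j k k₁ => T * resPhase N σ i j k k₁) (scaledSymbol N s T χ)
    (fun σ k => (sobWt N s k : ℂ) * hat N (u₀ σ) k) hT hT1
    (fun σ i j => isResonant_resPhase σ i j hT hT1)
    (fun σ i j k k₁ => enorm_scaledSymbol_le N hs hT hχ σ i j k k₁) (by
      rw [hsum]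
      have := lifespan_mul_le_one hL hR0
      linarith)
  rw [hsum] at hgY
  -- Zero modes start at zero, and the truncated symbol does not feed them. This is needed before
  -- the truncated nonlinearity can be identified with the true one.
  have hzero : ∀ t : ℝ, |t| ≤ 1 → ∀ σ, modes g t σ 0 = 0 := by
    intro t ht σ
    rw [hgeq t ht]
    simp [quadTerm_scaledSymbol_zero, (meanZero_iff N (u₀ σ)).1 (hmean σ)]
  have habs : ∀ t ∈ Icc (-T) T, |t / T| ≤ 1 := by
    intro t ht
    rw [abs_div, abs_of_pos hT, div_le_one hT, abs_le]
    exact ht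
  have hcont := continuous_fromSpectrum N s T hg
  refine ⟨fromSpectrum N s T g, hcont, ?_, ?_, ?_⟩
  · rw [fpuSystem_iff N χ fun σ => (hcont σ).continuousOn]
    intro t ht σ k
    have hw : (sobWt N s k : ℂ) ≠ 0 := by exact_mod_cast (sobWt_pos N s k).ne'
    set F : ℝ → ℂ := fun t' => quadTerm (fpuSymbol N χ) (resPhase N)
      (profile N (fromSpectrum N s T g) t') (profile N (fromSpectrum N s T g) t') t' σ k with hF
    have h1 : ∫ t' in (0 : ℝ)..t / T, quadTerm (scaledSymbol N s T χ)
        (fun σ i j k k₁ => T * resPhase N σ i j k k₁) (modes g t') (modes g t') t' σ k =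
        ∫ t' in (0 : ℝ)..t / T, (T : ℂ) * ((sobWt N s k : ℂ) * F (T * t')) := by
      refine intervalIntegral.integral_congr fun t' ht' => ?_
      have hle : |t'| ≤ 1 := by
        have h2 := abs_sub_left_of_mem_uIcc ht'
        simp only [sub_zero] at h2
        exact h2.trans (habs t ht)
      simp only [hF]
      rw [quadTerm_scaledSymbol N s χ (hzero t' hle)]
      have h3 : profile N (fromSpectrum N s T g) (T * t') =
          fun σ k => (((sobWt N s k)⁻¹ : ℝ) : ℂ) * modes g t' σ k := by
        ext σ k
        rw [profile_fromSpectrum, mul_div_cancel_left₀ _ hT.ne']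
      rw [h3]
    have h4 := intervalIntegral.smul_integral_comp_mul_left (a := 0) (b := t / T) F T
    rw [mul_zero, mul_div_cancel₀ _ hT.ne', Complex.real_smul] at h4
    rw [profile_fromSpectrum, hgeq _ (habs t ht), h1, intervalIntegral.integral_const_mul,
      intervalIntegral.integral_const_mul, ← h4]
    push_cast
    field_simp
  · intro σ t ht
    rw [meanZero_iff, hat_eq_osc_mul_profile, profile_fromSpectrum, hzero _ (habs t ht)]
    simp
  · intro σ
    have hK0 : 0 ≤ K * (A * R ^ 2) := by positivity
    have hx := (xNormHat_spaceTimeSpectrum_le N hs hT hT1 g σ).trans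
      (ENNReal_rpow_half_le (by positivity) hK0 hgY)
    have hl := (ellTwoLOneNorm_spaceTimeSpectrum_le N hs hT g σ).trans
      (ENNReal_rpow_half_le (by positivity) hK0 hgY)
    -- The function built from the spectrum is defined for all times, and it serves as its own
    -- extension in the infimum.
    calc yNormLoc N (sgn σ) s T (fromSpectrum N s T g σ)
        ≤ yNorm N (sgn σ) s (fromSpectrum N s T g σ) :=
          iInf₂_le (fromSpectrum N s T g σ) (eqOn_refl (fromSpectrum N s T g σ) (Icc (-T) T))
      _ ≤ _ := iInf₂_le _ (isSpaceTimeFourier_fromSpectrum N s hT hg σ)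
      _ ≤ _ := add_le_add hx hl
      _ = ENNReal.ofReal (2 * Real.sqrt (2 * Real.pi * (K * A)) * R) := by
        rw [← ENNReal.ofReal_add (by positivity) (by positivity)]
        congr 1
        have : 2 * Real.pi * (K * (A * R ^ 2)) = 2 * Real.pi * (K * A) * R ^ 2 := by ring
        rw [this, Real.sqrt_mul (by positivity), Real.sqrt_sq hR0]
        ring

/-- A pair of functions, indexed by signs. -/
def signPair {α : Type*} (p m : α) (σ : Bool) : α := if σ then p else m

lemma isCoupledSolution_iff {T : ℝ} {u₀ : Bool → PeriodicLattice N → ℂ}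
    {u : Bool → ℝ → PeriodicLattice N → ℂ} :
    IsCoupledSolution N T (u₀ true) (u₀ false) (u true) (u false) ↔
      (∀ σ, ContinuousOn (u σ) (Icc (-T) T)) ∧ FPUSystem N 1 T u₀ u := by
  constructor
  · rintro ⟨h1, h2, h3, h4⟩
    refine ⟨fun σ => by cases σ <;> assumption, fun σ => ?_⟩
    cases σ
    · simpa [CoupledEquation] using h4
    · simpa [CoupledEquation] using h3
  · rintro ⟨h1, h2⟩
    refine ⟨h1 true, h1 false, ?_, ?_⟩
    · simpa [CoupledEquation] using h2 true
    · simpa [CoupledEquation] using h2 false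

lemma isDecoupledSolution_iff {T : ℝ} {u₀ : Bool → PeriodicLattice N → ℂ}
    {u : Bool → ℝ → PeriodicLattice N → ℂ} :
    IsDecoupledSolution N T (u₀ true) (u₀ false) (u true) (u false) ↔
      (∀ σ, ContinuousOn (u σ) (Icc (-T) T)) ∧ FPUSystem N 0 T u₀ u := by
  constructor
  · rintro ⟨h1, h2, h3, h4⟩
    refine ⟨fun σ => by cases σ <;> assumption, fun σ => ?_⟩
    cases σ
    · simpa [DecoupledEquation] using h4
    · simpa [DecoupledEquation] using h3
  · rintro ⟨h1, h2⟩
    refine ⟨h1 true, h1 false, ?_, ?_⟩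
    · simpa [DecoupledEquation] using h2 true
    · simpa [DecoupledEquation] using h2 false

end WellPosedness

end PeriodicFPU

theorem proposition4p9 (s : ℝ) (hs : 0 ≤ s) :
    ∃ C : ℝ, 0 < C ∧ ∃ T : ℝ → ℝ, Antitone T ∧ (∀ R : ℝ, 0 < T R ∧ T R ≤ 1) ∧
      ∀ (N : ℕ) [NeZero N], PeriodicFPU.mesh N ≤ 1 →
      ∀ u₀p u₀m : PeriodicFPU.PeriodicLattice N → ℂ,
        PeriodicFPU.MeanZero N u₀p → PeriodicFPU.MeanZero N u₀m →
      ∀ R : ℝ, R = PeriodicFPU.pairNorm N s u₀p u₀m →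
        (∃ up um : ℝ → PeriodicFPU.PeriodicLattice N → ℂ,
          PeriodicFPU.IsCoupledSolution N (T R) u₀p u₀m up um ∧
          (∀ wp wm : ℝ → PeriodicFPU.PeriodicLattice N → ℂ,
            PeriodicFPU.IsCoupledSolution N (T R) u₀p u₀m wp wm →
              Set.EqOn wp up (Set.Icc (-T R) (T R)) ∧ Set.EqOn wm um (Set.Icc (-T R) (T R))) ∧
          (∀ t ∈ Set.Icc (-T R) (T R),
            PeriodicFPU.MeanZero N (up t) ∧ PeriodicFPU.MeanZero N (um t)) ∧
          PeriodicFPU.yNormLoc N 1 s (T R) up ≤ ENNReal.ofReal (C * R) ∧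
          PeriodicFPU.yNormLoc N (-1) s (T R) um ≤ ENNReal.ofReal (C * R)) ∧
        (∃ vp vm : ℝ → PeriodicFPU.PeriodicLattice N → ℂ,
          PeriodicFPU.IsDecoupledSolution N (T R) u₀p u₀m vp vm ∧
          (∀ wp wm : ℝ → PeriodicFPU.PeriodicLattice N → ℂ,
            PeriodicFPU.IsDecoupledSolution N (T R) u₀p u₀m wp wm →
              Set.EqOn wp vp (Set.Icc (-T R) (T R)) ∧ Set.EqOn wm vm (Set.Icc (-T R) (T R))) ∧
          (∀ t ∈ Set.Icc (-T R) (T R),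
            PeriodicFPU.MeanZero N (vp t) ∧ PeriodicFPU.MeanZero N (vm t)) ∧
          PeriodicFPU.yNormLoc N 1 s (T R) vp ≤ ENNReal.ofReal (C * R) ∧
          PeriodicFPU.yNormLoc N (-1) s (T R) vm ≤ ENNReal.ofReal (C * R)) := by
  obtain ⟨C, L, hC, hL, hex⟩ := PeriodicFPU.exists_fpuSystem_solution hs
  refine ⟨C, hC, PeriodicFPU.lifespan L, PeriodicFPU.antitone_lifespan hL,
    fun R => ⟨PeriodicFPU.lifespan_pos hL R, PeriodicFPU.lifespan_le_one hL R⟩, ?_⟩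
  intro N _ _ u₀p u₀m hp hm R hR
  have hT := PeriodicFPU.lifespan_pos hL R
  have hmean : ∀ σ, PeriodicFPU.MeanZero N (PeriodicFPU.signPair u₀p u₀m σ) := by
    intro σ; cases σ <;> assumption
  constructor
  -- Coupling parameter 1 is the coupled system, 0 the decoupled one; the constants C and L do not
  -- depend on it.
  · obtain ⟨u, hc, hu, h0, hY⟩ := hex N 1 (by simp) (PeriodicFPU.signPair u₀p u₀m) hmean R hR
    have hc' := fun σ => (hc σ).continuousOn (s :=
      Icc (-PeriodicFPU.lifespan L R) (PeriodicFPU.lifespan L R))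
    refine ⟨u true, u false, (PeriodicFPU.isCoupledSolution_iff N
      (u₀ := PeriodicFPU.signPair u₀p u₀m)).2 ⟨hc', hu⟩, fun wp wm hw => ?_,
      fun t ht => ⟨h0 true t ht, h0 false t ht⟩, by simpa using hY true, by simpa using hY false⟩
    obtain ⟨hwc, hw'⟩ := (PeriodicFPU.isCoupledSolution_iff N
      (u₀ := PeriodicFPU.signPair u₀p u₀m) (u := PeriodicFPU.signPair wp wm)).1 hw
    exact ⟨hu.eqOn N hT hc' hwc hw' true, hu.eqOn N hT hc' hwc hw' false⟩
  · obtain ⟨u, hc, hu, h0, hY⟩ := hex N 0 (by simp) (PeriodicFPU.signPair u₀p u₀m) hmean R hR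
    have hc' := fun σ => (hc σ).continuousOn (s :=
      Icc (-PeriodicFPU.lifespan L R) (PeriodicFPU.lifespan L R))
    refine ⟨u true, u false, (PeriodicFPU.isDecoupledSolution_iff N
      (u₀ := PeriodicFPU.signPair u₀p u₀m)).2 ⟨hc', hu⟩, fun wp wm hw => ?_,
      fun t ht => ⟨h0 true t ht, h0 false t ht⟩, by simpa using hY true, by simpa using hY false⟩
    obtain ⟨hwc, hw'⟩ := (PeriodicFPU.isDecoupledSolution_iff N
      (u₀ := PeriodicFPU.signPair u₀p u₀m) (u := PeriodicFPU.signPair wp wm)).1 hw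
    exact ⟨hu.eqOn N hT hc' hwc hw' true, hu.eqOn N hT hc' hwc hw' false⟩
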